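/- Let $d\in\mathbb N$. Let $(\Omega,\mathcal F,\mathbb P)$ be a probability space with a group action $(\tau_x)_{x\in\mathbb R^d}$ of $\mathbb R^d$ on $\Omega$ such that $(x,\omega)\mapsto\tau_x\omega$ is measurable, every $\tau_x$ preserves $\mathbb P$, and the action is ergodic. Let $A,B\subset\mathbb R^m$ be nonempty compact sets, let $f:A\times B\to\mathbb R^d$ be continuous, and suppose that there are $\delta>0$ and a unit vector $e\in\mathbb R^d$ with $\langle f(a,b),e\rangle\ge\delta$ for all $(a,b)\in A\times B$. Let $\ell:\mathbb R^d\times A\times B\times\Omega\to\mathbb R$ be jointly measurable and such that - $\ell(\cdot,\cdot,\cdot,\omega)$ is bounded and uniformly continuous on $\mathbb R^d\times A\times B$ for every $\omega$; - $|\ell(x,a,b,\omega)-\ell(y,a,b,\omega)|\le \mathrm{Lip}(\ell)\,|x-y|$ for all $x,y,a,b,\omega$, for a constant $\mathrm{Lip}(\ell)>0$; - $\ell(x,a,b,\omega)=\ell(0,a,b,\tau_x\omega)$ for all $x,a,b,\omega$; - $\ell$ has finite range of dependence: there is $\rho>0$ such that, for all $S,\widehat S\subseteq\mathbb R^d$ with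 $\inf\{|x-y|:x\in S,\,y\in\widehat S\}>\rho$, the $\sigma$-algebras generated by $\{\ell(x,a,b,\cdot):x\in S,\,a\in A,\,b\in B\}$ and by $\{\ell(x,a,b,\cdot):x\in\widehat S,\,a\in A,\,b\in B\}$ are independent. Set $$H(x,p,\omega)=\max_{b\in B}\min_{a\in A}\{-\ell(x,a,b,\omega)-\langle f(a,b),p\rangle\},$$ and suppose that $H$ is jointly measurable and that, for a constant $\beta>0$ and all $x,y,p,q\in\mathbb R^d$ and $\omega\in\Omega$, $|H(x,p,\omega)|\le\beta(1+|p|)$, $|H(x,p,\omega)-H(x,q,\omega)|\le\beta|p-q|$ and $|H(x,p,\omega)-H(y,p,\omega)|\le\beta|x-y|$. For $\theta\in\mathbb R^d$ and $\varepsilon>0$ let $\tilde u^\varepsilon_\theta(\cdot,\cdot,\omega)$ be, for every $\omega\in\Omega$, the continuous function on $[0,\infty)\times\mathbb R^d$ that solves $\partial_t u+H(x/\varepsilon,D_xu,\omega)=0$ in $(0,\infty)\times\mathbb R^d$ in the viscosity sense and satisfies $u(0,x)=\langle\theta,x\rangle$ for all $x$. Then there is a deterministic function $\overline H:\mathbb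 R^d\to\mathbb R$ such that, for all $\theta\in\mathbb R^d$, $T>0$ and $R>0$, $$\mathbb P\Big(\sup_{(t,x)\in[0,T]\times B_R}\big|\tilde u^\varepsilon_\theta(t,x,\omega)-\langle\theta,x\rangle+t\overline H(\theta)\big|\ge K\,(-\varepsilon\ln\varepsilon)^{1/2}\Big)\le\varepsilon^2\qquad\text{for all }0<\varepsilon\le\tfrac12,$$ where $B_R$ is the open ball of radius $R$ centered at $0$ and the constant $K$ depends only on $R$, $T$, $|\theta|$, $d$, $\beta$, $\rho$, $\delta$, $\mathrm{Lip}(\ell)$ and $\|f\|_\infty=\sup_{A\times B}|f|$. -/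

import Mathlib

open MeasureTheory Set

/-- The Euclidean space `ℝ^d`. -/
abbrev Eucl (d : ℕ) : Type := EuclideanSpace ℝ (Fin d)

noncomputable section

/-- Membership of a random Hamiltonian `H(x, p, ω)` in the class `ℋ` with constant `β`: joint
measurability, linear growth in `p`, and `β`-Lipschitz continuity in `p` and in `x`. -/
structure IsClassH {d : ℕ} {Ω : Type*} [MeasurableSpace Ω]
    (H : Eucl d → Eucl d → Ω → ℝ) (β : ℝ) : Prop where
  measurable : Measurable (fun q : Eucl d × Eucl d × Ω => H q.1 q.2.1 q.2.2)
  growth : ∀ x p ω, |H x p ω| ≤ β * (1 + ‖p‖)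
  lipschitz_p : ∀ x p q ω, |H x p ω - H x q ω| ≤ β * ‖p - q‖
  lipschitz_x : ∀ x y p ω, |H x p ω - H y p ω| ≤ β * ‖x - y‖

/-- The max-min Hamiltonian
`H(x, p, ω) = max_{b ∈ B} min_{a ∈ A} { - ℓ(x, a, b, ω) - ⟨f(a, b), p⟩ }`.
(For `A`, `B` compact and nonempty and `f`, `ℓ` continuous in `(a, b)`, the supremum and the
infimum are attained.) -/
def gameHamiltonian {d m : ℕ} {Ω : Type*} {A B : Set (Eucl m)}
    (f : A → B → Eucl d) (ℓ : Eucl d → A → B → Ω → ℝ) :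
    Eucl d → Eucl d → Ω → ℝ :=
  fun x p ω => ⨆ b : B, ⨅ a : A, (- ℓ x a b ω - inner ℝ (f a b) p)

/-- The dynamics `f` is continuous and oriented with constant `δ`: for some unit vector `e`,
`⟨f(a, b), e⟩ ≥ δ` for all `a`, `b`. -/
structure IsOrientedDynamics {d m : ℕ} {A B : Set (Eucl m)}
    (f : A → B → Eucl d) (δ : ℝ) : Prop where
  continuous : Continuous (fun q : A × B => f q.1 q.2)
  oriented : ∃ e : Eucl d, ‖e‖ = 1 ∧ ∀ a b, δ ≤ inner ℝ (f a b) e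

/-- The running cost `ℓ` is jointly measurable, bounded and uniformly continuous on
`ℝ^d × A × B` for each `ω`, `L`-Lipschitz in `x`, and stationary with respect to the action
`x +ᵥ ω = τ_x ω` of `ℝ^d` on `Ω`. -/
structure IsStationaryCost {d m : ℕ} {Ω : Type*} [MeasurableSpace Ω] [AddAction (Eucl d) Ω]
    {A B : Set (Eucl m)} (ℓ : Eucl d → A → B → Ω → ℝ) (L : ℝ) : Prop where
  measurable : Measurable (fun q : Eucl d × A × B × Ω => ℓ q.1 q.2.1 q.2.2.1 q.2.2.2)
  bounded : ∀ ω, ∃ C : ℝ, ∀ x a b, |ℓ x a b ω| ≤ C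
  uniformContinuous : ∀ ω, UniformContinuous (fun q : Eucl d × A × B => ℓ q.1 q.2.1 q.2.2 ω)
  lipschitz : ∀ x y a b ω, |ℓ x a b ω - ℓ y a b ω| ≤ L * ‖x - y‖
  stationary : ∀ x a b ω, ℓ x a b ω = ℓ 0 a b (x +ᵥ ω)

/-- The σ-algebra on `Ω` generated by the random variables `X i x`, `i ∈ I`, `x ∈ S`. -/
def sigmaOn {d : ℕ} {I Ω : Type*} (X : I → Eucl d → Ω → ℝ) (S : Set (Eucl d)) :
    MeasurableSpace Ω :=
  ⨆ i : I, ⨆ x ∈ S, MeasurableSpace.comap (X i x) (borel ℝ)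

/-- The distance `inf { |x - y| : x ∈ S, y ∈ S' }` between two sets (`∞` if one is empty). -/
def setDist {d : ℕ} (S S' : Set (Eucl d)) : ENNReal :=
  ⨅ x ∈ S, ⨅ y ∈ S', edist x y

/-- Finite range of dependence `ρ`: the σ-algebras generated by the fields over two sets of
points at distance more than `ρ` are independent. -/
def HasFiniteRange {d : ℕ} {I Ω : Type*} [MeasurableSpace Ω] (μ : Measure Ω)
    (X : I → Eucl d → Ω → ℝ) (ρ : ℝ) : Prop :=
  ∀ S S' : Set (Eucl d), ENNReal.ofReal ρ < setDist S S' →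
    ProbabilityTheory.Indep (sigmaOn X S) (sigmaOn X S') μ

/-- `u` is a viscosity subsolution of `∂ₜ u + H(x, Dₓ u) = 0` in `(0, ∞) × ℝ^d`. -/
def IsViscositySubsolution {d : ℕ} (H : Eucl d → Eucl d → ℝ) (u : ℝ → Eucl d → ℝ) : Prop :=
  ∀ φ : ℝ × Eucl d → ℝ, ContDiffOn ℝ 1 φ (Ioi 0 ×ˢ univ) →
    ∀ (t : ℝ) (x : Eucl d), 0 < t →
      IsLocalMax (fun q : ℝ × Eucl d => u q.1 q.2 - φ q) (t, x) →
      deriv (fun s => φ (s, x)) t + H x (gradient (fun y => φ (t, y)) x) ≤ 0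

/-- `u` is a viscosity supersolution of `∂ₜ u + H(x, Dₓ u) = 0` in `(0, ∞) × ℝ^d`. -/
def IsViscositySupersolution {d : ℕ} (H : Eucl d → Eucl d → ℝ) (u : ℝ → Eucl d → ℝ) : Prop :=
  ∀ φ : ℝ × Eucl d → ℝ, ContDiffOn ℝ 1 φ (Ioi 0 ×ˢ univ) →
    ∀ (t : ℝ) (x : Eucl d), 0 < t →
      IsLocalMin (fun q : ℝ × Eucl d => u q.1 q.2 - φ q) (t, x) →
      0 ≤ deriv (fun s => φ (s, x)) t + H x (gradient (fun y => φ (t, y)) x)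

/-- `u` is a solution of the Cauchy problem `∂ₜ u + H(x, Dₓ u) = 0` in `(0, ∞) × ℝ^d`,
`u(0, ·) = g`: it is continuous on `[0, ∞) × ℝ^d`, attains the initial datum, and solves the
equation in the viscosity sense. The values of `u` at negative times are irrelevant. -/
structure IsCauchySolution {d : ℕ} (H : Eucl d → Eucl d → ℝ) (g : Eucl d → ℝ)
    (u : ℝ → Eucl d → ℝ) : Prop where
  continuousOn : ContinuousOn (fun q : ℝ × Eucl d => u q.1 q.2) (Ici 0 ×ˢ univ)
  initial : ∀ x, u 0 x = g x
  subsolution : IsViscositySubsolution H u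
  supersolution : IsViscositySupersolution H u

end

/-! The equation is that of a zero-sum differential game: `-H(x, p)` is the upper value of `ℓ + ⟨f,
p⟩`, so the solution is the value of a game with dynamics `f`, running cost `ℓ` and terminal cost
`⟨θ, ·⟩`. Continuous-time strategies are avoided by a discrete game of step `h`, whose regularity,
finite speed of propagation and measurability are inductions on the number of steps. Doubling of
variables (`exists_scheme_sub_supersolution_le`) shows that its values converge to any continuous
viscosity solution, so estimates uniform in `h` pass to the solution.

The probabilistic input is the orientation. Every trajectory advances along `e` at speed at least
`δ`, so it spends a bounded time in a slab orthogonal to `e`, and changing the cost there by a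
bounded amount changes the value by `O(1)`, whatever the horizon (`abs_gameValue_sub_le_of_slab`).
Revealing the environment slab by slab gives a Doob martingale. To bound an increment, erase the new
slab and a buffer wider than `ρ`: the erased value depends on the known past and on a far future
independent of both stages, so its conditional expectation does not move
(`ae_abs_condExp_sub_le_of_indep_sup`). With `O(t)` increments, Azuma's inequality gives
fluctuations of order `√t`.

Stationarity, a grid and a union bound make this uniform over balls of radius `n` at the price `√(n
log n)`. Uniformly on such a ball the value at time `s` is then `⟨θ, y⟩` plus its mean at `0`, so
finite speed and dynamic programming make the mean additive up to `√(n log n)`. A dyadic argument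
(`exists_linear_of_nearly_additive`) makes it linear with an error of the same order; minus the
slope is the effective Hamiltonian. Rescaling with `n` of order `1 / ε` gives the rate. -/

/-! ### Upper values of payoff matrices. -/

section Minimax

variable {A B : Type*}

/-- The upper value `inf_b sup_a g(a, b)` of a payoff matrix. -/
noncomputable def minimax (g : A → B → ℝ) : ℝ := ⨅ b, ⨆ a, g a b

variable [Nonempty A] [Nonempty B]

/-- The bounds keep `⨆` and `⨅` on `ℝ` away from their default values. -/
theorem minimax_le_add {g g' : A → B → ℝ} {C C' k : ℝ} (hg : ∀ a b, |g a b| ≤ C)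
    (hg' : ∀ a b, |g' a b| ≤ C') (h : ∀ a b, g a b ≤ g' a b + k) :
    minimax g ≤ minimax g' + k := by
  have hbdd : ∀ b, BddAbove (range fun a => g' a b) := fun b =>
    ⟨C', by rintro _ ⟨a, rfl⟩; exact (abs_le.1 (hg' a b)).2⟩
  have hbelow : BddBelow (range fun b => ⨆ a, g a b) := by
    refine ⟨-C, ?_⟩
    rintro _ ⟨b, rfl⟩
    obtain ⟨a⟩ := ‹Nonempty A›
    exact (abs_le.1 (hg a b)).1.trans
      (le_ciSup (f := fun a => g a b) ⟨C, by rintro _ ⟨a, rfl⟩; exact (abs_le.1 (hg a b)).2⟩ a)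
  rw [← sub_le_iff_le_add]
  refine le_ciInf fun b => ?_
  rw [sub_le_iff_le_add]
  refine (ciInf_le hbelow b).trans (ciSup_le fun a => (h a b).trans ?_)
  gcongr
  exact le_ciSup (hbdd b) a

/-- The shift `k` makes contraction and commutation with constants instances of one estimate; `r =
0` gives exact identities. -/
theorem abs_minimax_sub_sub_le {g g' : A → B → ℝ} {C C' k r : ℝ} (hg : ∀ a b, |g a b| ≤ C)
    (hg' : ∀ a b, |g' a b| ≤ C') (h : ∀ a b, |g a b - g' a b - k| ≤ r) :
    |minimax g - minimax g' - k| ≤ r := by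
  rw [abs_le]
  constructor
  · have := minimax_le_add (k := r - k) hg' hg fun a b => by linarith [(abs_le.1 (h a b)).1]
    linarith
  · have := minimax_le_add (k := r + k) hg hg' fun a b => by linarith [(abs_le.1 (h a b)).2]
    linarith

theorem abs_minimax_sub_le {g g' : A → B → ℝ} {C C' r : ℝ} (hg : ∀ a b, |g a b| ≤ C)
    (hg' : ∀ a b, |g' a b| ≤ C') (h : ∀ a b, |g a b - g' a b| ≤ r) :
    |minimax g - minimax g'| ≤ r := by
  simpa using abs_minimax_sub_sub_le (k := 0) hg hg' (by simpa using h)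

theorem minimax_mul_add {g : A → B → ℝ} {C h c : ℝ} (hh : 0 ≤ h) (hg : ∀ a b, |g a b| ≤ C) :
    minimax (fun a b => h * g a b + c) = h * minimax g + c := by
  have hmul : minimax (fun a b => h * g a b) = h * minimax g := by
    unfold minimax
    rw [Real.mul_iInf_of_nonneg hh]
    congr 1; ext b
    rw [Real.mul_iSup_of_nonneg hh]
  have hb : ∀ a b, |h * g a b| ≤ h * C := fun a b => by
    rw [abs_mul, abs_of_nonneg hh]; exact mul_le_mul_of_nonneg_left (hg a b) hh
  have hb' : ∀ a b, |h * g a b + c| ≤ h * C + |c| := fun a b =>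
    (abs_add_le _ _).trans (by gcongr; exact hb a b)
  have := abs_minimax_sub_sub_le (k := c) (r := 0) hb' hb (fun a b => by simp)
  rw [hmul] at this
  have := abs_nonpos_iff.1 this
  linarith

end Minimax

/-- No boundedness is needed: on `ℝ`, `sInf s` is `-sSup (-s)`, so negation exchanges the two even
at default values. -/
theorem gameHamiltonian_eq {d m : ℕ} {Ω : Type*} {A B : Set (Eucl m)}
    (f : A → B → Eucl d) (ℓ : Eucl d → A → B → Ω → ℝ) (x p : Eucl d) (ω : Ω) :
    gameHamiltonian f ℓ x p ω = - minimax (fun a b => ℓ x a b ω + inner ℝ (f a b) p) := by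
  unfold gameHamiltonian minimax
  rw [iInf, Real.sInf_def, neg_neg, iSup]
  congr 1
  ext y
  simp only [mem_range, mem_neg]
  refine exists_congr fun b => ?_
  rw [iInf, Real.sInf_def, neg_eq_iff_eq_neg, iSup]
  have : range (fun a => ℓ x a b ω + inner ℝ (f a b) p)
      = -range (fun a => -ℓ x a b ω - inner ℝ (f a b) p) := by
    ext z
    simp only [mem_range, mem_neg]
    exact exists_congr fun a => ⟨fun h => by linarith, fun h => by linarith⟩
  rw [this]

/-! ### The discrete game: regularity, propagation, consistency. -/

section GameValue

variable {d : ℕ} {A B : Type*}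

/-- The value after `n` steps of length `h` of the discrete game with dynamics `f`, running cost `c`
and terminal cost `⟨θ, ·⟩`. -/
noncomputable def gameValue (f : A → B → Eucl d) (c : Eucl d → A → B → ℝ) (h : ℝ) (θ : Eucl d) :
    ℕ → Eucl d → ℝ
  | 0 => fun x => inner ℝ θ x
  | n + 1 => fun x => minimax fun a b => h * c x a b + gameValue f c h θ n (x + h • f a b)

/-- A running cost which is bounded, and `L`-Lipschitz in the state variable. -/
structure IsRegularCost (c : Eucl d → A → B → ℝ) (L : ℝ) : Prop where
  bounded : ∃ C, ∀ x a b, |c x a b| ≤ C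
  lipschitz : ∀ x y a b, |c x a b - c y a b| ≤ L * ‖x - y‖

variable {f : A → B → Eucl d} {c : Eucl d → A → B → ℝ} {h F L : ℝ} {θ : Eucl d}

theorem gameValue_zero (x : Eucl d) : gameValue f c h θ 0 x = inner ℝ θ x := rfl

theorem gameValue_succ (n : ℕ) (x : Eucl d) : gameValue f c h θ (n + 1) x =
    minimax fun a b => h * c x a b + gameValue f c h θ n (x + h • f a b) := rfl

theorem exists_abs_step_le (hf : ∀ a b, ‖f a b‖ ≤ F) (hc : ∃ C, ∀ x a b, |c x a b| ≤ C)
    (hh : 0 ≤ h) {φ : Eucl d → ℝ} {Λ : ℝ} (hφ : ∀ x y, |φ x - φ y| ≤ Λ * ‖x - y‖) (x : Eucl d) :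
    ∃ C, ∀ a b, |h * c x a b + φ (x + h • f a b)| ≤ C := by
  obtain ⟨C, hC⟩ := hc
  refine ⟨h * C + (|φ x| + |Λ| * (h * F)), fun a b => (abs_add_le _ _).trans ?_⟩
  have h1 : |h * c x a b| ≤ h * C := by
    rw [abs_mul, abs_of_nonneg hh]; exact mul_le_mul_of_nonneg_left (hC x a b) hh
  have h2 : |φ (x + h • f a b) - φ x| ≤ |Λ| * (h * F) := by
    refine (hφ _ _).trans ?_
    rw [add_sub_cancel_left, norm_smul, Real.norm_of_nonneg hh]
    exact mul_le_mul (le_abs_self _) (mul_le_mul_of_nonneg_left (hf a b) hh) (by positivity)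
      (abs_nonneg _)
  have h3 : |φ (x + h • f a b)| ≤ |φ x| + |φ (x + h • f a b) - φ x| := by
    have := abs_add_le (φ x) (φ (x + h • f a b) - φ x)
    simpa using this
  linarith

theorem exists_abs_hamiltonian_le (hf : ∀ a b, ‖f a b‖ ≤ F) (hc : IsRegularCost c L)
    (x p : Eucl d) : ∃ C, ∀ a b, |c x a b + inner ℝ (f a b) p| ≤ C := by
  obtain ⟨C, hC⟩ := hc.bounded
  refine ⟨C + F * ‖p‖, fun a b => (abs_add_le _ _).trans (add_le_add (hC x a b) ?_)⟩
  exact (abs_real_inner_le_norm _ _).trans (mul_le_mul_of_nonneg_right (hf a b) (norm_nonneg _))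

/-- The terminal cost is homogeneous of degree one, so scaling space and time by `ε` scales the
payoff by `ε`. This links the oscillating problem to the unit scale. -/
theorem gameValue_scale {ε : ℝ} (hε : 0 < ε) (n : ℕ) (x : Eucl d) :
    gameValue f (fun y => c (ε⁻¹ • y)) (ε * h) θ n x = ε * gameValue f c h θ n (ε⁻¹ • x) := by
  induction n generalizing x with
  | zero => simp [gameValue_zero, inner_smul_right, hε.ne']
  | succ n ih =>
    rw [gameValue_succ, gameValue_succ, minimax, minimax, Real.mul_iInf_of_nonneg hε.le]
    congr 1; ext b
    rw [Real.mul_iSup_of_nonneg hε.le]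
    congr 1; ext a
    rw [ih, smul_add, smul_smul, ← mul_assoc, inv_mul_cancel₀ hε.ne', one_mul]
    ring

variable [Nonempty A] [Nonempty B]

/-- Trajectories driven by the same controls keep the separation `x - y`, so each step adds only `h
* L` to the Lipschitz constant. -/
theorem gameValue_lipschitz (hf : ∀ a b, ‖f a b‖ ≤ F) (hc : IsRegularCost c L) (hh : 0 ≤ h)
    (n : ℕ) (x y : Eucl d) :
    |gameValue f c h θ n x - gameValue f c h θ n y| ≤ (‖θ‖ + n * h * L) * ‖x - y‖ := by
  induction n generalizing x y with
  | zero =>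
    simp only [gameValue_zero, ← inner_sub_right, Nat.cast_zero, zero_mul, add_zero]
    exact abs_real_inner_le_norm _ _
  | succ n ih =>
    obtain ⟨C, hC⟩ := exists_abs_step_le hf hc.bounded hh ih x
    obtain ⟨C', hC'⟩ := exists_abs_step_le hf hc.bounded hh ih y
    refine abs_minimax_sub_le hC hC' fun a b => ?_
    have h1 := mul_le_mul_of_nonneg_left (hc.lipschitz x y a b) hh
    rw [← abs_of_nonneg hh, ← abs_mul, abs_of_nonneg hh] at h1
    have h2 := ih (x + h • f a b) (y + h • f a b)
    rw [add_sub_add_right_eq_sub] at h2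
    have h3 := abs_add_le (h * (c x a b - c y a b))
      (gameValue f c h θ n (x + h • f a b) - gameValue f c h θ n (y + h • f a b))
    rw [show h * c x a b + gameValue f c h θ n (x + h • f a b) -
      (h * c y a b + gameValue f c h θ n (y + h • f a b)) = h * (c x a b - c y a b) +
      (gameValue f c h θ n (x + h • f a b) - gameValue f c h θ n (y + h • f a b)) by ring]
    push_cast
    nlinarith

theorem exists_abs_gameValue_step_le (hf : ∀ a b, ‖f a b‖ ≤ F) (hc : IsRegularCost c L)
    (hh : 0 ≤ h) (n : ℕ) (x : Eucl d) :
    ∃ C, ∀ a b, |h * c x a b + gameValue f c h θ n (x + h • f a b)| ≤ C :=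
  exists_abs_step_le hf hc.bounded hh (gameValue_lipschitz hf hc hh n) x

/-- Finite speed of propagation: the values after `n + k` and `m + k` steps at `x` differ by at most
as much as those after `n` and `m` steps on the ball of radius `k h F` about `x`. -/
theorem abs_gameValue_add_sub_le (hf : ∀ a b, ‖f a b‖ ≤ F) (hc : IsRegularCost c L) (hh : 0 ≤ h)
    (n m k : ℕ) (x : Eucl d) {r s : ℝ}
    (hr : ∀ y, ‖y - x‖ ≤ k * h * F →
      |gameValue f c h θ n y - gameValue f c h θ m y - s| ≤ r) :
    |gameValue f c h θ (n + k) x - gameValue f c h θ (m + k) x - s| ≤ r := by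
  induction k generalizing x with
  | zero => simpa using hr x (by simp)
  | succ k ih =>
    obtain ⟨C, hC⟩ := exists_abs_gameValue_step_le (θ := θ) hf hc hh (n + k) x
    obtain ⟨C', hC'⟩ := exists_abs_gameValue_step_le (θ := θ) hf hc hh (m + k) x
    refine abs_minimax_sub_sub_le hC hC' fun a b => ?_
    rw [add_sub_add_left_eq_sub]
    refine ih _ fun y hy => hr y ?_
    have h1 : ‖y - x‖ ≤ ‖y - (x + h • f a b)‖ + ‖h • f a b‖ := by
      have := norm_add_le (y - (x + h • f a b)) (h • f a b)
      rwa [show y - (x + h • f a b) + h • f a b = y - x by abel] at this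
    rw [norm_smul, Real.norm_of_nonneg hh] at h1
    have h2 := mul_le_mul_of_nonneg_left (hf a b) hh
    push_cast
    linarith

/-- The scheme is exact on linear data; the time regularity of the value starts from here. -/
theorem gameValue_one (hf : ∀ a b, ‖f a b‖ ≤ F) (hc : IsRegularCost c L) (hh : 0 ≤ h)
    (x : Eucl d) : gameValue f c h θ 1 x =
      h * minimax (fun a b => c x a b + inner ℝ (f a b) θ) + inner ℝ θ x := by
  obtain ⟨C, hC⟩ := exists_abs_hamiltonian_le hf hc x θ
  rw [gameValue_succ, ← minimax_mul_add hh hC]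
  congr 1; ext a b
  rw [gameValue_zero, inner_add_right, inner_smul_right, real_inner_comm θ]
  ring

/-- One step applied to the linear datum moves it by at most `C₁ * h` everywhere, and further common
steps do not enlarge a difference. -/
theorem abs_gameValue_succ_sub_le (hf : ∀ a b, ‖f a b‖ ≤ F) (hc : IsRegularCost c L) (hh : 0 ≤ h)
    {C₁ : ℝ} (hC₁ : ∀ x, |minimax (fun a b => c x a b + inner ℝ (f a b) θ)| ≤ C₁)
    (n : ℕ) (x : Eucl d) :
    |gameValue f c h θ (n + 1) x - gameValue f c h θ n x| ≤ C₁ * h := by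
  have := abs_gameValue_add_sub_le (θ := θ) (r := C₁ * h) (s := 0) hf hc hh 1 0 n x fun y _ => by
    rw [gameValue_one hf hc hh, gameValue_zero, add_sub_cancel_right, sub_zero, abs_mul,
      abs_of_nonneg hh, mul_comm]
    exact mul_le_mul_of_nonneg_right (hC₁ y) hh
  simpa [add_comm] using this

theorem abs_gameValue_sub_le (hf : ∀ a b, ‖f a b‖ ≤ F) (hc : IsRegularCost c L) (hh : 0 ≤ h)
    {C₁ : ℝ} (hC₁ : ∀ x, |minimax (fun a b => c x a b + inner ℝ (f a b) θ)| ≤ C₁)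
    (n k : ℕ) (x : Eucl d) :
    |gameValue f c h θ (n + k) x - gameValue f c h θ n x| ≤ C₁ * (k * h) := by
  induction k with
  | zero => simp
  | succ k ih =>
    have h1 := abs_gameValue_succ_sub_le (θ := θ) hf hc hh hC₁ (n + k) x
    have h2 := abs_sub_le (gameValue f c h θ (n + k + 1) x) (gameValue f c h θ (n + k) x)
      (gameValue f c h θ n x)
    rw [← add_assoc]
    push_cast
    linarith

/-- The linear terminal cost feels a translation only through a constant. With a stationary cost,
the value minus `⟨θ, x⟩` is therefore a stationary field. -/
theorem gameValue_translate (hf : ∀ a b, ‖f a b‖ ≤ F) (hc : IsRegularCost c L) (hh : 0 ≤ h)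
    (z : Eucl d) (n : ℕ) (x : Eucl d) :
    gameValue f c h θ n (z + x) = gameValue f (fun y => c (z + y)) h θ n x + inner ℝ θ z := by
  have hc' : IsRegularCost (fun y => c (z + y)) L :=
    ⟨hc.bounded.imp fun C hC x => hC _, fun x y a b => by simpa using hc.lipschitz (z + x) (z + y) a b⟩
  induction n generalizing x with
  | zero => simp [gameValue_zero, inner_add_right, add_comm]
  | succ n ih =>
    obtain ⟨C, hC⟩ := exists_abs_gameValue_step_le (θ := θ) hf hc hh n (z + x)
    obtain ⟨C', hC'⟩ := exists_abs_gameValue_step_le (θ := θ) hf hc' hh n x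
    have := abs_minimax_sub_sub_le (r := 0) (k := inner ℝ θ z) hC hC' fun a b => by
      rw [add_assoc, ih]; simp
    rw [gameValue_succ, gameValue_succ]
    linarith [abs_nonpos_iff.1 this]

/-- Two costs which differ by at most `r`, and only in the slab `s₀ ≤ ⟨y, e⟩ ≤ s₁`, have values that
differ by at most `r` times the longest time which an oriented trajectory spends in the slab. -/
theorem abs_gameValue_sub_le_of_slab {c' : Eucl d → A → B → ℝ} {L' : ℝ}
    (hf : ∀ a b, ‖f a b‖ ≤ F) (hc : IsRegularCost c L) (hc' : IsRegularCost c' L') (hh : 0 ≤ h)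
    {δ : ℝ} (hδ : 0 < δ) {e : Eucl d} (he : ∀ a b, δ ≤ inner ℝ (f a b) e) {r s₀ s₁ : ℝ}
    (hr : 0 ≤ r) (hs : s₀ ≤ s₁) (hcc : ∀ x a b, |c x a b - c' x a b| ≤ r)
    (hout : ∀ x a b, inner ℝ x e < s₀ ∨ s₁ < inner ℝ x e → c x a b = c' x a b)
    (n : ℕ) (x : Eucl d) :
    |gameValue f c h θ n x - gameValue f c' h θ n x| ≤ r * ((s₁ - s₀ + h * δ) / δ) := by
  -- `Θ z / δ` bounds the time still to be spent in the slab from height `z`; the extra `h * δ` pays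
  -- for the step that starts in the slab and leaves it.
  set Θ : ℝ → ℝ := fun z => max 0 (min (s₁ + h * δ - z) (s₁ + h * δ - s₀)) with hΘ
  have hanti : Antitone Θ := fun z z' hz => by
    simp only [hΘ]
    exact max_le_max le_rfl (min_le_min (by linarith) le_rfl)
  have hΘle : ∀ z, Θ z ≤ s₁ - s₀ + h * δ := fun z =>
    max_le (by nlinarith) ((min_le_right _ _).trans (by linarith))
  suffices H : |gameValue f c h θ n x - gameValue f c' h θ n x| ≤ r * (Θ (inner ℝ x e) / δ) by
    refine H.trans (mul_le_mul_of_nonneg_left ?_ hr)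
    exact div_le_div_of_nonneg_right (hΘle _) hδ.le
  induction n generalizing x with
  | zero =>
    simp only [gameValue_zero, sub_self, abs_zero]
    exact mul_nonneg hr (div_nonneg (le_max_left _ _) hδ.le)
  | succ n ih =>
    obtain ⟨C, hC⟩ := exists_abs_gameValue_step_le (θ := θ) hf hc hh n x
    obtain ⟨C', hC'⟩ := exists_abs_gameValue_step_le (θ := θ) hf hc' hh n x
    refine abs_minimax_sub_le hC hC' fun a b => ?_
    have h1 := ih (x + h • f a b)
    have h2 : Θ (inner ℝ (x + h • f a b) e) ≤ Θ (inner ℝ x e + h * δ) := by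
      apply hanti
      rw [inner_add_left, inner_smul_left]
      have := mul_le_mul_of_nonneg_left (he a b) hh
      simpa using this
    have h3 : |h * c x a b + gameValue f c h θ n (x + h • f a b) -
        (h * c' x a b + gameValue f c' h θ n (x + h • f a b))| ≤
        h * |c x a b - c' x a b| + r * (Θ (inner ℝ x e + h * δ) / δ) := by
      rw [show h * c x a b + gameValue f c h θ n (x + h • f a b) -
        (h * c' x a b + gameValue f c' h θ n (x + h • f a b)) = h * (c x a b - c' x a b) +
        (gameValue f c h θ n (x + h • f a b) - gameValue f c' h θ n (x + h • f a b)) by ring]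
      refine (abs_add_le _ _).trans (add_le_add ?_ (h1.trans ?_))
      · rw [abs_mul, abs_of_nonneg hh]
      · gcongr
    refine h3.trans ?_
    rcases lt_or_ge (inner ℝ x e) s₀ with hz | hz
    · rw [hout x a b (Or.inl hz), sub_self, abs_zero, mul_zero, zero_add]
      gcongr
      exact hanti (by nlinarith)
    rcases lt_or_ge s₁ (inner ℝ x e) with hz' | hz'
    · rw [hout x a b (Or.inr hz'), sub_self, abs_zero, mul_zero, zero_add]
      gcongr
      exact hanti (by nlinarith)
    -- Inside the slab a step contributes at most `h * r` and uses up at least `h * δ` of the budget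
    -- `Θ`.
    have h4 : Θ (inner ℝ x e + h * δ) + h * δ ≤ Θ (inner ℝ x e) := by
      have e1 : Θ (inner ℝ x e) = s₁ + h * δ - inner ℝ x e := by
        simp only [hΘ]
        rw [min_eq_left (by linarith), max_eq_right (by nlinarith)]
      have e2 : Θ (inner ℝ x e + h * δ) ≤ s₁ - inner ℝ x e :=
        max_le (by linarith) ((min_le_left _ _).trans (by linarith))
      linarith
    have h5 : h * |c x a b - c' x a b| ≤ h * r := mul_le_mul_of_nonneg_left (hcc x a b) hh
    have h6 : r * (Θ (inner ℝ x e + h * δ) / δ) + h * r ≤ r * (Θ (inner ℝ x e) / δ) := by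
      have : Θ (inner ℝ x e + h * δ) / δ + h ≤ Θ (inner ℝ x e) / δ := by
        rw [div_add' _ _ _ hδ.ne']
        gcongr
      nlinarith
    linarith

/-- Consistency on quadratics: by monotonicity the touching quadratic may replace the value, and a
move of length at most `h * F` produces the curvature error. -/
theorem gameValue_succ_le_of_le_quadratic (hf : ∀ a b, ‖f a b‖ ≤ F) (hc : IsRegularCost c L)
    (hh : 0 ≤ h) {n : ℕ} {x p : Eucl d} {q κ : ℝ} (hκ : 0 ≤ κ)
    (hq : ∀ z, gameValue f c h θ n z ≤ q + inner ℝ p (z - x) + κ * ‖z - x‖ ^ 2) :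
    gameValue f c h θ (n + 1) x ≤
      q + h * minimax (fun a b => c x a b + inner ℝ (f a b) p) + κ * F ^ 2 * h ^ 2 := by
  obtain ⟨C, hC⟩ := exists_abs_gameValue_step_le (θ := θ) hf hc hh n x
  obtain ⟨C', hC'⟩ := exists_abs_hamiltonian_le hf hc x p
  have hC'' : ∀ a b, |h * (c x a b + inner ℝ (f a b) p)| ≤ h * C' := fun a b => by
    rw [abs_mul, abs_of_nonneg hh]; exact mul_le_mul_of_nonneg_left (hC' a b) hh
  have := minimax_le_add (k := q + κ * F ^ 2 * h ^ 2) hC hC'' fun a b => by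
    have h1 := hq (x + h • f a b)
    rw [add_sub_cancel_left, inner_smul_right, norm_smul, Real.norm_of_nonneg hh,
      real_inner_comm] at h1
    have h2 : κ * (h * ‖f a b‖) ^ 2 ≤ κ * F ^ 2 * h ^ 2 := by
      rw [mul_pow, mul_assoc, mul_comm (F ^ 2)]
      gcongr
      exact hf a b
    linarith
  have h0 := minimax_mul_add (c := 0) hh hC'
  simp only [add_zero] at h0
  rw [gameValue_succ]
  linarith

theorem le_gameValue_succ_of_quadratic_le (hf : ∀ a b, ‖f a b‖ ≤ F) (hc : IsRegularCost c L)
    (hh : 0 ≤ h) {n : ℕ} {x p : Eucl d} {q κ : ℝ} (hκ : 0 ≤ κ)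
    (hq : ∀ z, q + inner ℝ p (z - x) - κ * ‖z - x‖ ^ 2 ≤ gameValue f c h θ n z) :
    q + h * minimax (fun a b => c x a b + inner ℝ (f a b) p) - κ * F ^ 2 * h ^ 2 ≤
      gameValue f c h θ (n + 1) x := by
  obtain ⟨C, hC⟩ := exists_abs_gameValue_step_le (θ := θ) hf hc hh n x
  obtain ⟨C', hC'⟩ := exists_abs_hamiltonian_le hf hc x p
  have hC'' : ∀ a b, |h * (c x a b + inner ℝ (f a b) p)| ≤ h * C' := fun a b => by
    rw [abs_mul, abs_of_nonneg hh]; exact mul_le_mul_of_nonneg_left (hC' a b) hh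
  have := minimax_le_add (k := -q + κ * F ^ 2 * h ^ 2) hC'' hC fun a b => by
    have h1 := hq (x + h • f a b)
    rw [add_sub_cancel_left, inner_smul_right, norm_smul, Real.norm_of_nonneg hh,
      real_inner_comm] at h1
    have h2 : κ * (h * ‖f a b‖) ^ 2 ≤ κ * F ^ 2 * h ^ 2 := by
      rw [mul_pow, mul_assoc, mul_comm (F ^ 2)]
      gcongr
      exact hf a b
    linarith
  have h0 := minimax_mul_add (c := 0) hh hC'
  simp only [add_zero] at h0
  rw [gameValue_succ]
  linarith

end GameValue

/-! ### Measurability of the discrete value. -/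

section Measurability

variable {d : ℕ} {A B Ω : Type*} [TopologicalSpace A] [TopologicalSpace B] [CompactSpace A]
  [CompactSpace B] [SecondCountableTopology A] [SecondCountableTopology B]

/-- Continuity in the controls reduces the extrema to countable dense sets. -/
theorem measurable_minimax {mΩ : MeasurableSpace Ω} {g : Ω → A → B → ℝ}
    (hm : ∀ a b, Measurable fun ω => g ω a b)
    (hg : ∀ ω, Continuous fun q : A × B => g ω q.1 q.2) :
    Measurable fun ω => minimax (g ω) := by
  obtain ⟨SA, hSA, hSAd⟩ := TopologicalSpace.exists_countable_dense A
  obtain ⟨SB, hSB, hSBd⟩ := TopologicalSpace.exists_countable_dense B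
  have := hSA.to_subtype
  have := hSB.to_subtype
  have hkey : (fun ω => minimax (g ω)) = fun ω => ⨅ b : SB, ⨆ a : SA, g ω a b := by
    ext ω
    have hcont : Continuous fun b => ⨆ a, g ω a b := by
      have := (isCompact_univ (X := A)).continuous_sSup (f := fun b a => g ω a b)
        ((hg ω).comp continuous_swap)
      simpa only [image_univ, iSup] using this
    have hb : BddBelow (range fun b => ⨆ a, g ω a b) := by
      rw [← image_univ]
      exact (isCompact_univ.image hcont).bddBelow
    unfold minimax
    rw [← hSBd.ciInf hcont hb]
    congr 1; ext b
    have hcb : Continuous fun a => g ω a b := (hg ω).comp (Continuous.prodMk_left (b : B))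
    rw [hSAd.ciSup hcb]
    rw [← image_univ]
    exact (isCompact_univ.image hcb).bddAbove
  rw [hkey]
  exact Measurable.iInf fun b => Measurable.iSup fun a => hm _ _

/-- Trajectories never move backwards along `e` and advance by at most `h * G` per step, so only the
cost in a slab matters. The σ-algebra is arbitrary, to be taken as that of a slab or half-space; `L`
may depend on `ω` because the costs modified in a slab have such a constant. -/
theorem measurable_gameValue [Nonempty A] [Nonempty B] {mΩ : MeasurableSpace Ω} {f : A → B → Eucl d}
    {c : Ω → Eucl d → A → B → ℝ} {h F θ} {e : Eucl d} {s₀ s₁ G : ℝ} {L : Ω → ℝ}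
    (hfc : Continuous fun q : A × B => f q.1 q.2) (hf : ∀ a b, ‖f a b‖ ≤ F)
    (hc : ∀ ω, IsRegularCost (c ω) (L ω)) (hh : 0 ≤ h)
    (hcc : ∀ ω x, Continuous fun q : A × B => c ω x q.1 q.2)
    (he : ∀ a b, 0 ≤ inner ℝ (f a b) e) (hG : ∀ a b, inner ℝ (f a b) e ≤ G) (hG0 : 0 ≤ G)
    (hm : ∀ x a b, s₀ ≤ inner ℝ x e → inner ℝ x e < s₁ → Measurable fun ω => c ω x a b)
    (n : ℕ) (x : Eucl d) (hx₀ : s₀ ≤ inner ℝ x e) (hx₁ : inner ℝ x e + n * h * G < s₁) :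
    Measurable fun ω => gameValue f (c ω) h θ n x := by
  induction n generalizing x with
  | zero => exact measurable_const
  | succ n ih =>
    push_cast at hx₁
    refine measurable_minimax (fun a b => ?_) fun ω => ?_
    · refine ((hm x a b hx₀ ?_).const_mul h).add (ih _ ?_ ?_)
      · nlinarith [mul_nonneg (mul_nonneg (Nat.cast_nonneg (α := ℝ) n) hh) hG0, mul_nonneg hh hG0]
      · rw [inner_add_left, inner_smul_left]
        have := mul_nonneg hh (he a b)
        simp only [conj_trivial]
        linarith
      · rw [inner_add_left, inner_smul_left]
        have := mul_le_mul_of_nonneg_left (hG a b) hh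
        simp only [conj_trivial]
        linarith
    · refine (continuous_const.mul (hcc ω x)).add ?_
      have hlip : Continuous (gameValue f (c ω) h θ n) := by
        refine LipschitzWith.continuous (K := Real.toNNReal (‖θ‖ + n * h * L ω)) ?_
        refine LipschitzWith.of_dist_le' fun y z => ?_
        rw [Real.dist_eq, dist_eq_norm]
        exact gameValue_lipschitz hf (hc ω) hh n y z
      exact hlip.comp (continuous_const.add (hfc.const_smul h))

end Measurability

/-! ### Comparison of monotone schemes with viscosity solutions. -/

section Viscosity

variable {d : ℕ}

/-- The regularized norm `√(1 + |y|²)`. -/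
noncomputable def japaneseNorm (y : Eucl d) : ℝ := Real.sqrt (1 + ‖y‖ ^ 2)

theorem one_le_japaneseNorm (y : Eucl d) : 1 ≤ japaneseNorm y := by
  rw [japaneseNorm, Real.one_le_sqrt]; nlinarith [sq_nonneg ‖y‖]

theorem norm_le_japaneseNorm (y : Eucl d) : ‖y‖ ≤ japaneseNorm y :=
  Real.le_sqrt_of_sq_le (by linarith)

theorem contDiff_japaneseNorm : ContDiff ℝ 1 (japaneseNorm (d := d)) := by
  unfold japaneseNorm
  exact (contDiff_const.add (contDiff_id.norm_sq ℝ)).sqrt fun y => by positivity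

theorem hasGradientAt_japaneseNorm (y : Eucl d) :
    HasGradientAt (japaneseNorm (d := d)) ((japaneseNorm y)⁻¹ • y) y := by
  have h1 : HasFDerivAt (fun y : Eucl d => 1 + ‖y‖ ^ 2) (2 • innerSL ℝ y) y := by
    have := ((hasFDerivAt_id y).norm_sq).const_add 1
    simpa using this
  have h2 := h1.sqrt (by positivity)
  rw [hasGradientAt_iff_hasFDerivAt]
  unfold japaneseNorm
  refine h2.congr_fderiv ?_
  ext z
  simp
  ring

/-- The barrier `κ exp(λ (√(1 + |y|²) + β s - r))`, a supersolution of `∂ₜψ ≥ β |Dψ|`. -/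
noncomputable def coneBarrier (κ lam β r : ℝ) (q : ℝ × Eucl d) : ℝ :=
  κ * Real.exp (lam * (japaneseNorm q.2 + β * q.1 - r))

theorem contDiff_coneBarrier (κ lam β r : ℝ) : ContDiff ℝ 1 (coneBarrier (d := d) κ lam β r) := by
  have := (contDiff_japaneseNorm (d := d)).comp (contDiff_snd (E := ℝ) (F := Eucl d) (n := 1))
  have h2 : ContDiff ℝ 1 fun q : ℝ × Eucl d => japaneseNorm q.2 := this
  unfold coneBarrier
  fun_prop

theorem hasDerivAt_coneBarrier (κ lam β r s : ℝ) (y : Eucl d) :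
    HasDerivAt (fun s => coneBarrier κ lam β r (s, y))
      (β * (lam * coneBarrier κ lam β r (s, y))) s := by
  have h1 : HasDerivAt (fun s : ℝ => lam * (japaneseNorm y + β * s - r)) (lam * β) s := by
    have := ((((hasDerivAt_id s).const_mul β).const_add (japaneseNorm y)).sub_const r).const_mul lam
    simpa using this
  refine (h1.exp.const_mul κ).congr_deriv ?_
  simp only [coneBarrier]
  ring

theorem hasGradientAt_coneBarrier (κ lam β r s : ℝ) (y : Eucl d) :
    HasGradientAt (fun y => coneBarrier κ lam β r (s, y))
      ((lam * coneBarrier κ lam β r (s, y) * (japaneseNorm y)⁻¹) • y) y := by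
  have h1 : HasFDerivAt (fun y : Eucl d => lam * (japaneseNorm y + β * s - r))
      (lam • InnerProductSpace.toDual ℝ _ ((japaneseNorm y)⁻¹ • y)) y :=
    (((hasGradientAt_japaneseNorm y).hasFDerivAt.add_const (β * s)).sub_const r).const_mul lam
  rw [hasGradientAt_iff_hasFDerivAt]
  refine (h1.exp.const_mul κ).congr_fderiv ?_
  ext z
  simp [coneBarrier]
  ring

theorem norm_gradient_coneBarrier_le {κ lam : ℝ} (hκ : 0 ≤ κ) (hlam : 0 ≤ lam) (β r s : ℝ)
    (y : Eucl d) : ‖(lam * coneBarrier κ lam β r (s, y) * (japaneseNorm y)⁻¹) • y‖ ≤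
      lam * coneBarrier κ lam β r (s, y) := by
  have hψ : 0 ≤ lam * coneBarrier κ lam β r (s, y) := by unfold coneBarrier; positivity
  have h1 := one_le_japaneseNorm y
  rw [norm_smul, norm_mul, Real.norm_of_nonneg hψ, norm_inv, Real.norm_of_nonneg (by linarith),
    mul_assoc]
  refine mul_le_of_le_one_right hψ ?_
  rw [inv_mul_le_iff₀ (by linarith), mul_one]
  exact norm_le_japaneseNorm y

/-- The test function touching a supersolution in the doubling of variables. -/
noncomputable def doublingTest (v₀ : ℝ) (x : Eucl d) (t α η κ lam β r : ℝ) (q : ℝ × Eucl d) : ℝ :=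
  v₀ - (‖x - q.2‖ ^ 2 + (t - q.1) ^ 2) / (2 * α) - η * q.1 - coneBarrier κ lam β r q

theorem contDiff_doublingTest (v₀ : ℝ) (x : Eucl d) (t α η κ lam β r : ℝ) :
    ContDiff ℝ 1 (doublingTest v₀ x t α η κ lam β r) := by
  have h1 := contDiff_coneBarrier (d := d) κ lam β r
  have h2 : ContDiff ℝ 1 fun q : ℝ × Eucl d => ‖x - q.2‖ ^ 2 :=
    (contDiff_const.sub contDiff_snd).norm_sq ℝ
  unfold doublingTest
  fun_prop

theorem hasDerivAt_doublingTest (v₀ : ℝ) (x : Eucl d) (t : ℝ) {α : ℝ} (hα : α ≠ 0)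
    (η κ lam β r s : ℝ) (y : Eucl d) :
    HasDerivAt (fun s => doublingTest v₀ x t α η κ lam β r (s, y))
      ((t - s) / α - η - β * (lam * coneBarrier κ lam β r (s, y))) s := by
  have h1 : HasDerivAt (fun s : ℝ => (‖x - y‖ ^ 2 + (t - s) ^ 2) / (2 * α)) (-((t - s) / α)) s := by
    have := ((((hasDerivAt_id s).const_sub t).pow 2).const_add (‖x - y‖ ^ 2)).div_const (2 * α)
    refine this.congr_deriv ?_
    simp
    field_simp
  have h2 := ((h1.const_sub v₀).sub ((hasDerivAt_id s).const_mul η)).sub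
    (hasDerivAt_coneBarrier κ lam β r s y)
  refine h2.congr_deriv ?_
  ring

theorem hasGradientAt_doublingTest (v₀ : ℝ) (x : Eucl d) (t : ℝ) {α : ℝ} (hα : α ≠ 0)
    (η κ lam β r s : ℝ) (y : Eucl d) :
    HasGradientAt (fun y => doublingTest v₀ x t α η κ lam β r (s, y))
      (α⁻¹ • (x - y) - (lam * coneBarrier κ lam β r (s, y) * (japaneseNorm y)⁻¹) • y) y := by
  have h1 := ((((hasFDerivAt_id y).const_sub x).norm_sq).add_const ((t - s) ^ 2)).mul_const
    ((2 * α)⁻¹)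
  have h2 := ((h1.const_sub v₀).sub_const (η * s)).sub
    (hasGradientAt_coneBarrier κ lam β r s y).hasFDerivAt
  rw [hasGradientAt_iff_hasFDerivAt]
  refine h2.congr_fderiv ?_
  ext z
  simp
  field_simp
  ring

theorem continuous_coneFunction (β : ℝ) :
    Continuous fun q : ℝ × Eucl d => japaneseNorm q.2 + β * q.1 := by
  have := (contDiff_japaneseNorm (d := d)).continuous
  fun_prop

theorem isCompact_cone {β : ℝ} (hβ : 0 < β) (r : ℝ) :
    IsCompact {q : ℝ × Eucl d | 0 ≤ q.1 ∧ japaneseNorm q.2 + β * q.1 ≤ r} := by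
  refine IsCompact.of_isClosed_subset ((isCompact_Icc (a := (0 : ℝ)) (b := r / β)).prod
    (isCompact_closedBall (0 : Eucl d) r)) ?_ ?_
  · exact (isClosed_le continuous_const continuous_fst).inter
      (isClosed_le (continuous_coneFunction β) continuous_const)
  · rintro ⟨s, y⟩ ⟨hs, hy⟩
    have h1 := one_le_japaneseNorm y
    have h2 := norm_le_japaneseNorm y
    simp only at hs hy
    refine ⟨⟨hs, ?_⟩, ?_⟩
    · simp only
      rw [le_div_iff₀ hβ]; nlinarith
    · rw [mem_closedBall_zero_iff]; nlinarith

/-- The time derivative of the barrier is `β` times a bound for its spatial gradient, so it absorbs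
the resulting change of `H` and only the momentum of the quadratic penalty remains. -/
theorem IsViscositySupersolution.doubling_inequality {H : Eucl d → Eucl d → ℝ}
    {u : ℝ → Eucl d → ℝ} (hsuper : IsViscositySupersolution H u) {β : ℝ} (hβ : 0 ≤ β)
    (hHp : ∀ x p q, |H x p - H x q| ≤ β * ‖p - q‖) {v₀ t s α η κ lam r : ℝ} {x y : Eucl d}
    (hs : 0 < s) (hα : 0 < α) (hκ : 0 ≤ κ) (hlam : 0 ≤ lam)
    (hloc : ∀ᶠ q : ℝ × Eucl d in nhds (s, y),
      u s y + (‖x - y‖ ^ 2 + (t - s) ^ 2) / (2 * α) + η * s + coneBarrier κ lam β r (s, y) ≤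
      u q.1 q.2 + (‖x - q.2‖ ^ 2 + (t - q.1) ^ 2) / (2 * α) + η * q.1
        + coneBarrier κ lam β r q) :
    0 ≤ (t - s) / α - η + H y (α⁻¹ • (x - y)) := by
  have hloc' : IsLocalMin
      (fun q : ℝ × Eucl d => u q.1 q.2 - doublingTest v₀ x t α η κ lam β r q) (s, y) := by
    filter_upwards [hloc] with q hq
    simp only [doublingTest]
    linarith
  have h3 := hsuper _ (contDiff_doublingTest _ _ _ _ _ _ _ _ _).contDiffOn s y hs hloc'
  rw [(hasDerivAt_doublingTest _ _ _ hα.ne' _ _ _ _ _ _ _).deriv,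
    (hasGradientAt_doublingTest _ _ _ hα.ne' _ _ _ _ _ _ _).gradient] at h3
  have h4 := (abs_le.1 (hHp y (α⁻¹ • (x - y) -
    (lam * coneBarrier κ lam β r (s, y) * (japaneseNorm y)⁻¹) • y) (α⁻¹ • (x - y)))).2
  rw [sub_sub_cancel_left, norm_neg] at h4
  have h6 := mul_le_mul_of_nonneg_left (norm_gradient_coneBarrier_le hκ hlam β r s y) hβ
  linarith

/-- At a maximum the penalty itself is the test quadratic; expanding it about `x` gives the momentum
`α⁻¹ • (x - y)`, and a time step reproduces the time slope up to a term of order `h / α`. -/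
theorem scheme_doubling_inequality {w v₁ : Eucl d → ℝ} {Hx : Eucl d → Eucl d → ℝ} {F h α s : ℝ}
    {k : ℕ} {x y : Eucl d} (hh : 0 < h) (hα : 0 < α)
    (hvs : ∀ x p q κ, 0 ≤ κ → (∀ z, w z ≤ q + inner ℝ p (z - x) + κ * ‖z - x‖ ^ 2) →
      v₁ x ≤ q - h * Hx x p + κ * F ^ 2 * h ^ 2)
    (hmax : ∀ z, w z - (‖z - y‖ ^ 2 + (k * h - s) ^ 2) / (2 * α) ≤
      v₁ x - (‖x - y‖ ^ 2 + (((k + 1 : ℕ) : ℝ) * h - s) ^ 2) / (2 * α)) :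
    (((k + 1 : ℕ) : ℝ) * h - s) / α + Hx x (α⁻¹ • (x - y)) ≤ h * (1 + F ^ 2) / (2 * α) := by
  have hscheme : v₁ x ≤ v₁ x + (h ^ 2 - 2 * h * (((k + 1 : ℕ) : ℝ) * h - s)) / (2 * α)
      - h * Hx x (α⁻¹ • (x - y)) + (2 * α)⁻¹ * F ^ 2 * h ^ 2 := by
    refine hvs x _ _ _ (by positivity) fun z => ?_
    have h1 := hmax z
    have h2 : ‖z - y‖ ^ 2 = ‖x - y‖ ^ 2 + 2 * inner ℝ (x - y) (z - x) + ‖z - x‖ ^ 2 := by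
      rw [← norm_add_sq_real]; congr 2; abel
    have h3 : inner ℝ (α⁻¹ • (x - y)) (z - x) = α⁻¹ * inner ℝ (x - y) (z - x) := by
      rw [inner_smul_left]; simp
    rw [h2] at h1
    rw [h3]
    generalize inner ℝ (x - y) (z - x) = i at *
    generalize ‖x - y‖ ^ 2 = j at *
    generalize ‖z - x‖ ^ 2 = l at *
    have h4 : (j + 2 * i + l + (k * h - s) ^ 2) / (2 * α)
        = (j + (((k + 1 : ℕ) : ℝ) * h - s) ^ 2) / (2 * α)
        + (h ^ 2 - 2 * h * (((k + 1 : ℕ) : ℝ) * h - s)) / (2 * α)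
        + α⁻¹ * i + (2 * α)⁻¹ * l := by
      push_cast; field_simp; ring
    linarith
  generalize Hx x (α⁻¹ • (x - y)) = g at *
  have e1 : (h ^ 2 - 2 * h * (((k + 1 : ℕ) : ℝ) * h - s)) / (2 * α) + (2 * α)⁻¹ * F ^ 2 * h ^ 2 =
      h * (h * (1 + F ^ 2) / (2 * α) - (((k + 1 : ℕ) : ℝ) * h - s) / α) := by
    field_simp; ring
  have e2 : 0 ≤ h * (h * (1 + F ^ 2) / (2 * α) - (((k + 1 : ℕ) : ℝ) * h - s) / α - g) := by
    linarith
  have := nonneg_of_mul_nonneg_right e2 hh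
  linarith

/-- The step index is discrete, so continuity matters only in the other variables. -/
theorem continuousOn_doubling {N : Set ℕ} {K : Set (Eucl d)} {Q : Set (ℝ × Eucl d)}
    {v : ℕ → Eucl d → ℝ} {u : ℝ → Eucl d → ℝ} {ψ : ℝ × Eucl d → ℝ} {h α η Λ : ℝ}
    (hu : ContinuousOn (fun q : ℝ × Eucl d => u q.1 q.2) Q) (hψ : Continuous ψ)
    (hv : ∀ n ∈ N, ∀ x y, |v n x - v n y| ≤ Λ * ‖x - y‖) :
    ContinuousOn (fun q : ℕ × Eucl d × ℝ × Eucl d => v q.1 q.2.1 -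
      (u q.2.2.1 q.2.2.2 + (‖q.2.1 - q.2.2.2‖ ^ 2 + (q.1 * h - q.2.2.1) ^ 2) / (2 * α)
        + η * q.2.2.1 + ψ q.2.2)) (N ×ˢ (K ×ˢ Q)) := by
  have hvc : ContinuousOn (fun q : ℕ × Eucl d × ℝ × Eucl d => v q.1 q.2.1) (N ×ˢ (K ×ˢ Q)) := by
    rintro ⟨n, x, w⟩ ⟨hn, -⟩
    have hvn : Continuous (v n) := by
      refine LipschitzWith.continuous (K := Real.toNNReal Λ) (LipschitzWith.of_dist_le' ?_)
      intro y z
      rw [Real.dist_eq, dist_eq_norm]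
      exact hv n hn y z
    have : ContinuousAt (fun q : ℕ × Eucl d × ℝ × Eucl d => v n q.2.1) (n, x, w) := by
      fun_prop
    refine (this.congr ?_).continuousWithinAt
    have h0 : ∀ᶠ k in nhds n, k = n := by rw [nhds_discrete]; exact rfl
    have h1 : ∀ᶠ q : ℕ × Eucl d × ℝ × Eucl d in nhds (n, x, w), q.1 = n :=
      (continuousAt_fst (p := (n, x, w))).eventually h0
    filter_upwards [h1] with q hq
    rw [hq]
  have hcast : Continuous fun q : ℕ × Eucl d × ℝ × Eucl d => (q.1 : ℝ) :=
    continuous_of_discreteTopology.comp continuous_fst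
  refine hvc.sub (((ContinuousOn.add ?_ ?_).add ?_).add ?_)
  · exact hu.comp (f := fun q : ℕ × Eucl d × ℝ × Eucl d => q.2.2)
      (continuous_snd.comp continuous_snd).continuousOn fun q hq => hq.2.2
  · exact Continuous.continuousOn (by fun_prop)
  · exact Continuous.continuousOn (by fun_prop)
  · exact (hψ.comp (continuous_snd.comp continuous_snd)).continuousOn

set_option maxHeartbeats 1600000 in
/-- A monotone scheme which is consistent on quadratic functions with the Hamilton–Jacobi equation
stays asymptotically below any viscosity supersolution with the same initial datum. -/
theorem exists_scheme_sub_supersolution_le {H : Eucl d → Eucl d → ℝ} {u : ℝ → Eucl d → ℝ}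
    {β β' Λ C₀ F T R κ : ℝ} (hβ : 0 < β) (hβ' : 0 ≤ β') (hΛ : 0 ≤ Λ) (hC₀ : 0 ≤ C₀) (hT : 0 < T)
    (hκ : 0 < κ) (hHp : ∀ x p q, |H x p - H x q| ≤ β * ‖p - q‖)
    (hHx : ∀ x y p, |H x p - H y p| ≤ β' * ‖x - y‖)
    (hu : ContinuousOn (fun q : ℝ × Eucl d => u q.1 q.2) (Ici 0 ×ˢ univ))
    (hsuper : IsViscositySupersolution H u) :
    ∃ h₀ > 0, ∀ h, 0 < h → h < h₀ → ∀ v : ℕ → Eucl d → ℝ, (∀ x, v 0 x = u 0 x) →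
      (∀ n : ℕ, n * h ≤ T → ∀ x y, |v n x - v n y| ≤ Λ * ‖x - y‖) →
      (∀ n : ℕ, n * h ≤ T → ∀ x, |v n x - v 0 x| ≤ C₀ * (n * h)) →
      (∀ n x p q k, 0 ≤ k → (∀ z, v n z ≤ q + inner ℝ p (z - x) + k * ‖z - x‖ ^ 2) →
        v (n + 1) x ≤ q - h * H x p + k * F ^ 2 * h ^ 2) →
      ∀ (n : ℕ) x, n * h ≤ T → ‖x‖ ≤ R → v n x - u (n * h) x ≤ κ := by
  -- With this `r` the barrier is at most `κ / 4` where `‖x‖ ≤ R` and `t ≤ T`. On the lateral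
  -- boundary of the larger cone `Q`, a suitable `lam` makes it exceed `M'`.
  set r : ℝ := Real.sqrt (1 + R ^ 2) + β * T with hr
  set Q : Set (ℝ × Eucl d) := {q | 0 ≤ q.1 ∧ japaneseNorm q.2 + β * q.1 ≤ r + 1} with hQ
  have hQc : IsCompact Q := isCompact_cone hβ _
  have hQu : ContinuousOn (fun q : ℝ × Eucl d => u q.1 q.2) Q :=
    hu.mono fun q hq => ⟨hq.1, mem_univ _⟩
  have hu0 : Continuous (u 0) := by
    have h1 : ContinuousOn (fun y : Eucl d => u 0 y) univ :=
      hu.comp (f := fun y : Eucl d => ((0 : ℝ), y)) (by fun_prop)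
        fun y _ => ⟨self_mem_Ici, mem_univ _⟩
    exact continuousOn_univ.1 h1
  have hQ0 : ContinuousOn (fun q : ℝ × Eucl d => u 0 q.2 - u q.1 q.2) Q :=
    (hu0.comp continuous_snd).continuousOn.sub hQu
  obtain ⟨M, hM⟩ : ∃ M, ∀ q ∈ Q, u 0 q.2 - u q.1 q.2 ≤ M := by
    obtain ⟨M, hM⟩ := (hQc.image_of_continuousOn hQ0).bddAbove
    exact ⟨M, fun q hq => hM (mem_image_of_mem _ hq)⟩
  set M' : ℝ := |M| + C₀ * T + Λ ^ 2 with hM'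
  have hM'0 : 0 ≤ M' := by positivity
  obtain ⟨lam, hlam0, hlam⟩ : ∃ lam : ℝ, 0 ≤ lam ∧ M' < κ / 4 * Real.exp lam := by
    refine ⟨4 / κ * M', by positivity, ?_⟩
    have := Real.add_one_le_exp (4 / κ * M')
    have h2 : κ / 4 * (4 / κ * M') = M' := by field_simp
    nlinarith
  obtain ⟨r₀, hr₀, hmod⟩ : ∃ r₀ > 0, ∀ q ∈ Q, q.1 < r₀ → u 0 q.2 - u q.1 q.2 ≤ κ / 8 := by
    have huc := hQc.uniformContinuousOn_of_continuous hQu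
    rw [Metric.uniformContinuousOn_iff] at huc
    obtain ⟨r₀, hr₀, h⟩ := huc (κ / 8) (by positivity)
    refine ⟨r₀, hr₀, fun q hq hq1 => ?_⟩
    have hq0 : ((0 : ℝ), q.2) ∈ Q := ⟨le_rfl, by simp only; nlinarith [hq.1, hq.2]⟩
    have := h _ hq0 q hq (by
      rw [dist_prod_same_right, Real.dist_eq, zero_sub, abs_neg, abs_of_nonneg hq.1]; exact hq1)
    rw [Real.dist_eq] at this
    exact (le_abs_self _).trans this.le
  -- The penalty `η * s` costs at most `κ / 4` up to time `T` and supplies the strict gap of the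
  -- final contradiction.
  set η : ℝ := κ / (4 * T) with hη
  have hη0 : 0 < η := by positivity
  -- After `α ≤ 1`, the conditions force at the maximum `|n h - s| < r₀`, `C₀ |n h - s| < κ / 8`, `Λ
  -- ‖x - y‖ < κ / 8`, and a spatial variation of `H` below `η / 2`.
  obtain ⟨α, hα, hα1, hα2, hα3, hα4, hα5⟩ : ∃ α : ℝ, 0 < α ∧ α ≤ 1 ∧ 2 * α * M' < r₀ ^ 2 ∧
      C₀ ^ 2 * (2 * α * M') < (κ / 8) ^ 2 ∧ 2 * α * Λ ^ 2 < κ / 8 ∧ 2 * β' * α * Λ < η / 2 := by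
    have key : ∀ a b : ℝ, 0 < b → ∀ᶠ α in nhdsWithin (0 : ℝ) (Ioi 0), a * α < b := fun a b hb => by
      have : Filter.Tendsto (fun α : ℝ => a * α) (nhdsWithin 0 (Ioi 0)) (nhds (a * 0)) :=
        (Continuous.tendsto (by fun_prop) 0).mono_left nhdsWithin_le_nhds
      rw [mul_zero] at this
      exact this.eventually (gt_mem_nhds hb)
    have hpos : ∀ᶠ α in nhdsWithin (0 : ℝ) (Ioi 0), 0 < α := self_mem_nhdsWithin
    obtain ⟨α, h0, h1, h2, h3, h4, h5⟩ := (Filter.eventually_and.2 ⟨hpos,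
      Filter.eventually_and.2 ⟨key 1 1 one_pos, Filter.eventually_and.2
      ⟨key (2 * M') (r₀ ^ 2) (by positivity), Filter.eventually_and.2
      ⟨key (C₀ ^ 2 * (2 * M')) ((κ / 8) ^ 2) (by positivity), Filter.eventually_and.2
      ⟨key (2 * Λ ^ 2) (κ / 8) (by positivity),
        key (2 * β' * Λ) (η / 2) (by positivity)⟩⟩⟩⟩⟩ : ∀ᶠ α in nhdsWithin (0 : ℝ) (Ioi 0), _).exists
    exact ⟨α, h0, by linarith, by linarith, by linarith, by linarith, by linarith⟩
  refine ⟨η * α / (1 + F ^ 2), by positivity, fun h hh hh₀ v hv0 hvL hvt hvs n₀ x₀ hn₀ hx₀ => ?_⟩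
  have hκ4 : 0 ≤ κ / 4 := by positivity
  by_contra hcon
  push Not at hcon
  set ψ := coneBarrier (d := d) (κ / 4) lam β r with hψ
  set Φ : ℕ × Eucl d × ℝ × Eucl d → ℝ := fun q => v q.1 q.2.1 -
    (u q.2.2.1 q.2.2.2 + (‖q.2.1 - q.2.2.2‖ ^ 2 + (q.1 * h - q.2.2.1) ^ 2) / (2 * α)
      + η * q.2.2.1 + ψ q.2.2) with hΦ
  have hψ0 : ∀ q, 0 ≤ ψ q := fun q => by simp only [hψ, coneBarrier]; positivity
  set R₂ : ℝ := r + 1 + 2 * α * Λ with hR₂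
  set D : Set (ℕ × Eucl d × ℝ × Eucl d) :=
    {n : ℕ | n * h ≤ T} ×ˢ (Metric.closedBall 0 R₂ ×ˢ Q) with hD
  have hyr : ∀ q ∈ Q, ‖q.2‖ ≤ r + 1 := fun q hq => by
    have := norm_le_japaneseNorm q.2
    nlinarith [hq.1, hq.2]
  have hfin : {n : ℕ | n * h ≤ T}.Finite := by
    refine (finite_Iic ⌈T / h⌉₊).subset fun n hn => ?_
    have h1 : (n : ℝ) ≤ T / h := by rw [le_div_iff₀ hh]; exact hn
    exact_mod_cast h1.trans (Nat.le_ceil _)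
  have hDc : IsCompact D := hfin.isCompact.prod ((isCompact_closedBall _ _).prod hQc)
  have hΦc : ContinuousOn Φ D :=
    continuousOn_doubling hQu (contDiff_coneBarrier (κ / 4) lam β r).continuous fun n hn => hvL n hn
  have hstart : (n₀, x₀, (n₀ * h : ℝ), x₀) ∈ D := by
    have hj : japaneseNorm x₀ ≤ Real.sqrt (1 + R ^ 2) := by
      unfold japaneseNorm; gcongr
    have h1 := mul_le_mul_of_nonneg_left hn₀ hβ.le
    have hq : ((n₀ * h : ℝ), x₀) ∈ Q := ⟨by positivity, by simp only; linarith⟩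
    refine ⟨hn₀, ?_, hq⟩
    rw [mem_closedBall_zero_iff]
    have : 0 ≤ 2 * α * Λ := by positivity
    linarith [hyr _ hq]
  obtain ⟨⟨n, x, s, y⟩, hmem, hmax⟩ := hDc.exists_isMaxOn ⟨_, hstart⟩ hΦc
  obtain ⟨hn : (n : ℝ) * h ≤ T, hx, hsy⟩ := hmem
  have hmax' : ∀ (k : ℕ) z w, (k : ℝ) * h ≤ T → ‖z‖ ≤ R₂ → w ∈ Q →
      Φ (k, z, w) ≤ Φ (n, x, s, y) := fun k z w hk hz hw =>
    hmax ⟨hk, mem_closedBall_zero_iff.2 hz, hw⟩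
  -- The scheme needs a maximum over all `z`, not only over the compact set: farther than `2 * α *
  -- Λ` from `y` the penalty beats the Lipschitz growth of `v`.
  have hglob : ∀ (k : ℕ) z, (k : ℝ) * h ≤ T → Φ (k, z, s, y) ≤ Φ (n, x, s, y) := by
    intro k z hk
    by_cases hz : ‖z‖ ≤ R₂
    · exact hmax' k z _ hk hz hsy
    · have hy := hyr _ hsy
      simp only at hy
      have hyR : ‖y‖ ≤ R₂ := by
        have : 0 ≤ 2 * α * Λ := by positivity
        linarith
      refine le_trans ?_ (hmax' k y _ hk hyR hsy)
      have hzy : 2 * α * Λ ≤ ‖z - y‖ := by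
        have := norm_sub_norm_le z y
        linarith
      have h1 := (abs_le.1 (hvL k hk z y)).2
      have h2 : Λ * ‖z - y‖ ≤ ‖z - y‖ ^ 2 / (2 * α) := by
        rw [le_div_iff₀ (by positivity)]
        linarith [mul_le_mul_of_nonneg_right hzy (norm_nonneg (z - y))]
      simp only [hΦ, sub_self, norm_zero]
      rw [add_div, add_div]
      norm_num
      linarith
  have hs0 : 0 ≤ s := hsy.1
  have hΦκ : κ / 2 < Φ (n, x, s, y) := by
    refine lt_of_lt_of_le ?_ (hmax hstart)
    have h1 : ψ (n₀ * h, x₀) ≤ κ / 4 := by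
      have hj : japaneseNorm x₀ ≤ Real.sqrt (1 + R ^ 2) := by
        unfold japaneseNorm; gcongr
      have h1 := mul_le_mul_of_nonneg_left hn₀ hβ.le
      have : lam * (japaneseNorm x₀ + β * (n₀ * h) - r) ≤ 0 :=
        mul_nonpos_of_nonneg_of_nonpos hlam0 (by linarith)
      have := Real.exp_le_one_iff.2 this
      simp only [hψ, coneBarrier]
      nlinarith
    have h2 : η * (n₀ * h) ≤ κ / 4 := by
      calc η * (n₀ * h) ≤ η * T := by gcongr
        _ = κ / 4 := by rw [hη]; field_simp
    simp only [hΦ, sub_self, norm_zero]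
    norm_num
    linarith
  have hxy : ‖x - y‖ ≤ 2 * α * Λ := by
    by_contra! hlt
    have h0 := hglob n y hn
    have h1 := (abs_le.1 (hvL n hn x y)).2
    have h2 : Λ * ‖x - y‖ < ‖x - y‖ ^ 2 / (2 * α) := by
      rw [lt_div_iff₀ (by positivity)]
      have : 0 < ‖x - y‖ := lt_of_le_of_lt (by positivity) hlt
      linarith [mul_lt_mul_of_pos_right hlt this]
    simp only [hΦ, sub_self, norm_zero] at h0
    rw [add_div, add_div] at h0
    norm_num at h0
    linarith
  have hvy : v n x - u s y ≤ u 0 y - u s y + C₀ * (n * h) + Λ * ‖x - y‖ := by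
    have h1 := (abs_le.1 (hvL n hn x y)).2
    have h2 := (abs_le.1 (hvt n hn y)).2
    rw [hv0] at h2
    linarith
  have hΛxy : Λ * ‖x - y‖ - ‖x - y‖ ^ 2 / (2 * α) ≤ Λ ^ 2 := by
    have : Λ * ‖x - y‖ ≤ ‖x - y‖ ^ 2 / (2 * α) + α / 2 * Λ ^ 2 := by
      have h1 : 0 ≤ (‖x - y‖ - α * Λ) ^ 2 / (2 * α) := by positivity
      have h2 : (‖x - y‖ - α * Λ) ^ 2 / (2 * α) =
          ‖x - y‖ ^ 2 / (2 * α) + α / 2 * Λ ^ 2 - Λ * ‖x - y‖ := by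
        field_simp; ring
      linarith
    linarith [mul_le_mul_of_nonneg_right hα1 (sq_nonneg Λ), sq_nonneg Λ]
  have hbound : Φ (n, x, s, y) ≤ M' - (n * h - s) ^ 2 / (2 * α) - ψ (s, y) := by
    have h1 := hM _ hsy
    simp only at h1
    have h2 : C₀ * (n * h) ≤ C₀ * T := by gcongr
    have h3 := mul_nonneg hη0.le hs0
    have h4 := le_abs_self M
    simp only [hΦ]
    rw [add_div]
    linarith
  have htime : (n * h - s) ^ 2 ≤ 2 * α * M' := by
    have h1 := hψ0 (s, y)
    have h2 : (n * h - s) ^ 2 / (2 * α) ≤ M' := by linarith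
    rw [div_le_iff₀ (by positivity)] at h2
    linarith
  -- A maximum on the lateral boundary would be negative, since the barrier exceeds `M'` there.
  have hint : japaneseNorm y + β * s < r + 1 := by
    refine lt_of_le_of_ne hsy.2 fun heq => ?_
    have h1 : ψ (s, y) = κ / 4 * Real.exp lam := by
      simp only [hψ, coneBarrier]
      rw [heq]; ring_nf
    have h2 : 0 ≤ (n * h - s) ^ 2 / (2 * α) := by positivity
    linarith
  have hΦle : Φ (n, x, s, y) ≤ v n x - u s y := by
    have h1 := hψ0 (s, y)
    have h2 : 0 ≤ (‖x - y‖ ^ 2 + (n * h - s) ^ 2) / (2 * α) := by positivity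
    have h3 := mul_nonneg hη0.le hs0
    simp only [hΦ]
    linarith
  have hΛ2 : Λ * ‖x - y‖ < κ / 8 := by linarith [mul_le_mul_of_nonneg_left hxy hΛ]
  -- At `s = 0` the time regularity of the scheme, and at `n = 0` the continuity of `u`, would keep
  -- the maximum below `κ / 4`.
  rcases hs0.eq_or_lt with hs | hs
  · subst hs
    have h1 : C₀ * (n * h) < κ / 8 := by
      refine lt_of_pow_lt_pow_left₀ 2 (by positivity) ?_
      rw [mul_pow]
      rw [sub_zero] at htime
      exact lt_of_le_of_lt (by gcongr) hα3
    linarith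
  rcases Nat.eq_zero_or_pos n with hn0 | hn0
  · subst hn0
    have h1 : s < r₀ := by
      refine lt_of_pow_lt_pow_left₀ 2 hr₀.le ?_
      have : ((0 : ℕ) * h - s) ^ 2 = s ^ 2 := by push_cast; ring
      rw [this] at htime
      linarith
    have h2 := hmod _ hsy h1
    simp only [Nat.cast_zero, zero_mul, mul_zero] at hvy h2
    linarith
  obtain ⟨k, rfl⟩ : ∃ k, n = k + 1 := ⟨n - 1, by omega⟩
  have hev : ∀ᶠ q : ℝ × Eucl d in nhds (s, y),
      u s y + (‖x - y‖ ^ 2 + (((k + 1 : ℕ) : ℝ) * h - s) ^ 2) / (2 * α) + η * s + ψ (s, y) ≤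
      u q.1 q.2 + (‖x - q.2‖ ^ 2 + (((k + 1 : ℕ) : ℝ) * h - q.1) ^ 2) / (2 * α) + η * q.1 + ψ q := by
    have h1 : ∀ᶠ q : ℝ × Eucl d in nhds (s, y), 0 < q.1 :=
      (isOpen_lt continuous_const continuous_fst).mem_nhds hs
    have h2 : ∀ᶠ q : ℝ × Eucl d in nhds (s, y), japaneseNorm q.2 + β * q.1 < r + 1 :=
      (isOpen_lt (continuous_coneFunction β) continuous_const).mem_nhds hint
    filter_upwards [h1, h2] with q hq1 hq2
    have h3 := hmax' (k + 1) x q hn (mem_closedBall_zero_iff.1 hx) ⟨hq1.le, hq2.le⟩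
    exact (sub_le_sub_iff_left _).1 h3
  -- The viscosity and scheme inequalities share time slope and momentum; their difference bounds
  -- `η` by two errors, each less than `η / 2`.
  have hvisc : 0 ≤ (((k + 1 : ℕ) : ℝ) * h - s) / α - η + H y (α⁻¹ • (x - y)) :=
    hsuper.doubling_inequality (v₀ := 0) (t := ((k + 1 : ℕ) : ℝ) * h) (s := s) (α := α) (η := η)
      (κ := κ / 4) (lam := lam) (r := r) (x := x) (y := y) hβ.le hHp hs hα hκ4 hlam0 hev
  have h1 : (((k + 1 : ℕ) : ℝ) * h - s) / α + H x (α⁻¹ • (x - y)) ≤ h * (1 + F ^ 2) / (2 * α) := by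
    refine scheme_doubling_inequality hh hα (hvs k) fun z => ?_
    have hk : (k : ℝ) * h ≤ T := by
      push_cast at hn; linarith
    have h1 : v k z - (_ + _ + _ + _) ≤ v (k + 1) x - (_ + _ + _ + _) := hglob k z hk
    linarith only [h1]
  have h2 := (abs_le.1 (hHx x y (α⁻¹ • (x - y)))).1
  have h3 : β' * ‖x - y‖ ≤ 2 * β' * α * Λ := by linarith [mul_le_mul_of_nonneg_left hxy hβ']
  have h4 : h * (1 + F ^ 2) / (2 * α) < η / 2 := by
    rw [lt_div_iff₀ (by positivity)] at hh₀
    rw [div_lt_iff₀ (by positivity)]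
    linarith
  linarith

/-- Lets the one-sided comparison, applied to the negated values, give the other bound too. -/
theorem IsViscositySubsolution.neg {H : Eucl d → Eucl d → ℝ} {u : ℝ → Eucl d → ℝ}
    (hu : IsViscositySubsolution H u) :
    IsViscositySupersolution (fun x p => -H x (-p)) (fun t x => -u t x) := by
  intro φ hφ t x ht hloc
  have hmax : IsLocalMax (fun q : ℝ × Eucl d => u q.1 q.2 - (-φ) q) (t, x) := by
    have := hloc.neg
    refine this.congr (Filter.Eventually.of_forall fun q => ?_)
    simp
    ring
  have h1 := hu (-φ) hφ.neg t x ht hmax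
  have h2 : deriv (fun s => (-φ) (s, x)) t = -deriv (fun s => φ (s, x)) t := by
    simp only [Pi.neg_apply]
    exact deriv.fun_neg
  have h3 : gradient (fun y => (-φ) (t, y)) x = -gradient (fun y => φ (t, y)) x := by
    simp only [gradient, Pi.neg_apply, fderiv_fun_neg, map_neg]
  rw [h2, h3] at h1
  linarith

end Viscosity

/-! ### Convergence of the discrete game to the solution. -/

section Convergence

variable {d : ℕ} {A B : Type*} [Nonempty A] [Nonempty B]

/-- The discrete game values converge locally uniformly to any solution of the Cauchy problem. -/
theorem exists_abs_gameValue_sub_solution_le {f : A → B → Eucl d} {c : Eucl d → A → B → ℝ}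
    {F L β β' C₁ T R κ : ℝ} {θ : Eucl d} {H : Eucl d → Eucl d → ℝ} {u : ℝ → Eucl d → ℝ}
    (hf : ∀ a b, ‖f a b‖ ≤ F) (hc : IsRegularCost c L) (hL : 0 ≤ L) (hβ : 0 < β) (hβ' : 0 ≤ β')
    (hH : ∀ x p, H x p = -minimax fun a b => c x a b + inner ℝ (f a b) p)
    (hHp : ∀ x p q, |H x p - H x q| ≤ β * ‖p - q‖)
    (hHx : ∀ x y p, |H x p - H y p| ≤ β' * ‖x - y‖) (hC₁ : ∀ x, |H x θ| ≤ C₁)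
    (hu : IsCauchySolution H (fun x => inner ℝ θ x) u) (hT : 0 < T) (hκ : 0 < κ) :
    ∃ h₀ > 0, ∀ h, 0 < h → h < h₀ → ∀ (n : ℕ) x, n * h ≤ T → ‖x‖ ≤ R →
      |gameValue f c h θ n x - u (n * h) x| ≤ κ := by
  have hC0 : 0 ≤ C₁ := (abs_nonneg _).trans (hC₁ 0)
  have hC₁' : ∀ x, |minimax (fun a b => c x a b + inner ℝ (f a b) θ)| ≤ C₁ := fun x => by
    have := hC₁ x
    rwa [hH, abs_neg] at this
  have hΛ : 0 ≤ ‖θ‖ + T * L := by positivity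
  have hlip : ∀ h, 0 < h → ∀ n : ℕ, n * h ≤ T → ∀ x y,
      |gameValue f c h θ n x - gameValue f c h θ n y| ≤ (‖θ‖ + T * L) * ‖x - y‖ := by
    intro h hh n hn x y
    refine (gameValue_lipschitz hf hc hh.le n x y).trans ?_
    gcongr
  have htime : ∀ h, 0 < h → ∀ (n : ℕ) x,
      |gameValue f c h θ n x - gameValue f c h θ 0 x| ≤ C₁ * (n * h) := fun h hh n x => by
    simpa using abs_gameValue_sub_le (θ := θ) hf hc hh.le hC₁' 0 n x
  obtain ⟨h₁, hh₁, H₁⟩ := exists_scheme_sub_supersolution_le (F := F) (R := R) hβ hβ' hΛ hC0 hT hκ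
    hHp hHx hu.continuousOn hu.supersolution
  obtain ⟨h₂, hh₂, H₂⟩ := exists_scheme_sub_supersolution_le (F := F) (R := R)
    (H := fun x p => -H x (-p)) (u := fun t x => -u t x) hβ hβ' hΛ hC0 hT hκ
    (fun x p q => by
      have := hHp x (-q) (-p)
      rw [show -q - -p = p - q by abel] at this
      rwa [show -H x (-p) - -H x (-q) = H x (-q) - H x (-p) by ring])
    (fun x y p => by
      have := hHx x y (-p)
      rwa [show -H x (-p) - -H y (-p) = -(H x (-p) - H y (-p)) by ring, abs_neg])
    hu.continuousOn.neg hu.subsolution.neg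
  refine ⟨min h₁ h₂, lt_min hh₁ hh₂, fun h hh hlt n x hn hx => ?_⟩
  have e1 := H₁ h hh (hlt.trans_le (min_le_left _ _)) (gameValue f c h θ)
    (fun x => (hu.initial x).symm) (hlip h hh) (fun n _ => htime h hh n)
    (fun n x p q k hk hq => by
      have := gameValue_succ_le_of_le_quadratic hf hc hh.le hk hq
      rw [hH]; linarith) n x hn hx
  have e2 := H₂ h hh (hlt.trans_le (min_le_right _ _)) (fun n x => -gameValue f c h θ n x)
    (fun x => by rw [hu.initial x]; rfl)
    (fun n hn x y => by
      have := hlip h hh n hn x y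
      rwa [← abs_neg, neg_sub_neg, neg_sub])
    (fun n _ x => by
      have := htime h hh n x
      rwa [← abs_neg, neg_sub_neg, neg_sub])
    (fun n x p q k hk hq => by
      have := le_gameValue_succ_of_quadratic_le (p := -p) (q := -q) hf hc hh.le hk fun z => by
        have := hq z
        rw [inner_neg_left]
        linarith
      rw [hH]; linarith) n x hn hx
  rw [abs_le]
  constructor <;> linarith

end Convergence

/-! ### Conditional expectation and independent σ-algebras. -/

section ConditionalExpectation

open ProbabilityTheory

variable {Ω : Type*} {mΩ : MeasurableSpace Ω} {μ : Measure Ω}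

theorem isPiSystem_image2_inter (m₁ m₂ : MeasurableSpace Ω) :
    IsPiSystem (image2 (fun a b => a ∩ b) {a | MeasurableSet[m₁] a} {b | MeasurableSet[m₂] b}) := by
  rintro _ ⟨a, ha, b, hb, rfl⟩ _ ⟨a', ha', b', hb', rfl⟩ -
  exact ⟨a ∩ a', MeasurableSet.inter ha ha', b ∩ b', MeasurableSet.inter hb hb',
    inter_inter_inter_comm _ _ _ _⟩

theorem sup_eq_generateFrom_image2_inter (m₁ m₂ : MeasurableSpace Ω) :
    m₁ ⊔ m₂ = MeasurableSpace.generateFrom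
      (image2 (fun a b => a ∩ b) {a | MeasurableSet[m₁] a} {b | MeasurableSet[m₂] b}) := by
  refine le_antisymm (sup_le (fun a ha => ?_) fun b hb => ?_)
    (MeasurableSpace.generateFrom_le ?_)
  · exact MeasurableSpace.measurableSet_generateFrom
      ⟨a, ha, univ, MeasurableSet.univ, inter_univ a⟩
  · exact MeasurableSpace.measurableSet_generateFrom
      ⟨univ, MeasurableSet.univ, b, hb, univ_inter b⟩
  · rintro _ ⟨a, ha, b, hb, rfl⟩
    exact MeasurableSet.inter ((le_sup_left : m₁ ≤ m₁ ⊔ m₂) a ha)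
      ((le_sup_right : m₂ ≤ m₁ ⊔ m₂) b hb)

/-- The indicators split the integrand into independent factors. Intersections of this kind form the
π-system on which identities over a join are tested. -/
theorem setIntegral_inter_of_indep {m G : MeasurableSpace Ω} (hm : m ≤ mΩ) (hG : G ≤ mΩ)
    (hind : Indep m G μ) {g : Ω → ℝ} (hg : StronglyMeasurable[m] g) {a b : Set Ω}
    (ha : MeasurableSet[m] a) (hb : MeasurableSet[G] b) :
    ∫ ω in a ∩ b, g ω ∂μ = (∫ ω in a, g ω ∂μ) * μ.real b := by
  have h1 : Measurable[m] (a.indicator g) := hg.measurable.indicator ha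
  have h2 : Measurable[G] (b.indicator (1 : Ω → ℝ)) := measurable_one.indicator hb
  have hif : IndepFun (a.indicator g) (b.indicator (1 : Ω → ℝ)) μ := by
    rw [IndepFun_iff_Indep]
    exact indep_of_indep_of_le_left (indep_of_indep_of_le_right hind h2.comap_le) h1.comap_le
  have h3 := hif.integral_fun_mul_eq_mul_integral (h1.mono hm le_rfl).aestronglyMeasurable
    (h2.mono hG le_rfl).aestronglyMeasurable
  rw [integral_indicator (hm a ha), integral_indicator_one (hG b hb)] at h3
  rw [← h3, ← integral_indicator ((hm a ha).inter (hG b hb))]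
  congr 1; ext ω
  by_cases hωa : ω ∈ a <;> by_cases hωb : ω ∈ b <;> simp [hωa, hωb]

variable [IsProbabilityMeasure μ]

/-- Conditionally on `m₁`, events of a larger σ-algebra independent of `G` do not depend on `G`. -/
theorem condExp_indicator_sup_eq {m₁ m₂ G : MeasurableSpace Ω} (h₁₂ : m₁ ≤ m₂) (h₂ : m₂ ≤ mΩ)
    (hG : G ≤ mΩ) (hind : Indep m₂ G μ) {s : Set Ω} (hs : MeasurableSet[m₂] s) :
    μ[s.indicator (1 : Ω → ℝ) | m₁] =ᵐ[μ] μ[s.indicator (1 : Ω → ℝ) | m₁ ⊔ G] := by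
  have h₁ : m₁ ≤ mΩ := h₁₂.trans h₂
  have hsi : Integrable (s.indicator (1 : Ω → ℝ)) μ :=
    (integrable_const (1 : ℝ)).indicator (h₂ s hs)
  have hgi : Integrable (μ[s.indicator (1 : Ω → ℝ) | m₁]) μ := integrable_condExp
  have hsup : m₁ ⊔ G ≤ mΩ := sup_le h₁ hG
  refine ae_eq_condExp_of_forall_setIntegral_eq hsup hsi (fun _ _ _ => hgi.integrableOn) ?_
    (stronglyMeasurable_condExp.mono le_sup_left).aestronglyMeasurable
  suffices H : ∀ t, MeasurableSet[m₁ ⊔ G] t → ∫ ω in t, (μ[s.indicator (1 : Ω → ℝ) | m₁]) ω ∂μ =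
      ∫ ω in t, s.indicator (1 : Ω → ℝ) ω ∂μ from fun t ht _ => H t ht
  refine MeasurableSpace.induction_on_inter (sup_eq_generateFrom_image2_inter m₁ G)
    (isPiSystem_image2_inter m₁ G) ?_ ?_ ?_ ?_
  · simp
  · rintro _ ⟨a, ha, b, hb, rfl⟩
    have hs2 : StronglyMeasurable[m₂] (s.indicator (1 : Ω → ℝ)) :=
      stronglyMeasurable_one.indicator hs
    rw [setIntegral_inter_of_indep h₁ hG (indep_of_indep_of_le_left hind h₁₂)
      stronglyMeasurable_condExp ha hb, setIntegral_condExp h₁ hsi ha,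
      setIntegral_inter_of_indep h₂ hG hind hs2 (h₁₂ a ha) hb]
  · intro t ht h
    have e1 := integral_add_compl (hsup t ht) hgi
    have e2 := integral_add_compl (hsup t ht) hsi
    rw [integral_condExp h₁] at e1
    linarith
  · intro f hd hf h
    rw [integral_iUnion (fun i => hsup _ (hf i)) hd hgi.integrableOn,
      integral_iUnion (fun i => hsup _ (hf i)) hd hsi.integrableOn]
    exact tsum_congr h

/-- By duality: tested against `Y`, the indicator of an `m₂`-event may be replaced by its projection
on `m₁ ⊔ G`, which is its projection on `m₁`; the projection is then moved onto `Y`. -/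
theorem condExp_eq_of_indep_sup {m₁ m₂ G : MeasurableSpace Ω} (h₁₂ : m₁ ≤ m₂) (h₂ : m₂ ≤ mΩ)
    (hG : G ≤ mΩ) (hind : Indep m₂ G μ) {Y : Ω → ℝ} (hY : StronglyMeasurable[m₁ ⊔ G] Y)
    (hYi : Integrable Y μ) : μ[Y | m₁] =ᵐ[μ] μ[Y | m₂] := by
  have h₁ : m₁ ≤ mΩ := h₁₂.trans h₂
  have hsup : m₁ ⊔ G ≤ mΩ := sup_le h₁ hG
  refine ae_eq_condExp_of_forall_setIntegral_eq h₂ hYi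
    (fun _ _ _ => integrable_condExp.integrableOn) ?_
    (stronglyMeasurable_condExp.mono h₁₂).aestronglyMeasurable
  intro s hs _
  set χ : Ω → ℝ := s.indicator (1 : Ω → ℝ) with hχ
  have hχi : Integrable χ μ := (integrable_const (1 : ℝ)).indicator (h₂ s hs)
  have hχb : ∀ Z : Ω → ℝ, Integrable Z μ → Integrable (χ * Z) μ := fun Z hZ => by
    have : χ * Z = s.indicator Z := by
      ext ω; by_cases hω : ω ∈ s <;> simp [hχ, hω]
    rw [this]; exact hZ.indicator (h₂ s hs)
  have hset : ∀ Z : Ω → ℝ, ∫ ω in s, Z ω ∂μ = ∫ ω, (χ * Z) ω ∂μ := fun Z => by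
    rw [← integral_indicator (h₂ s hs)]
    congr 1; ext ω; by_cases hω : ω ∈ s <;> simp [hχ, hω]
  have hgb : ∀ᵐ ω ∂μ, ‖(μ[χ | m₁]) ω‖ ≤ 1 := by
    exact ae_bdd_abs_condExp_of_ae_bdd_abs (Filter.Eventually.of_forall fun ω => by
      by_cases hω : ω ∈ s <;> simp [hχ, hω])
  have hgY : Integrable (μ[χ | m₁] * Y) μ := by
    refine hYi.bdd_mul (c := 1) ?_ hgb
    exact (stronglyMeasurable_condExp.mono h₁).aestronglyMeasurable
  have e1 : ∫ ω, (χ * μ[Y | m₁]) ω ∂μ = ∫ ω, (μ[χ | m₁] * μ[Y | m₁]) ω ∂μ := by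
    rw [← integral_condExp h₁]
    exact integral_congr_ae (condExp_mul_of_stronglyMeasurable_right
      stronglyMeasurable_condExp (hχb _ integrable_condExp) hχi)
  have e2 : ∫ ω, (μ[χ | m₁] * Y) ω ∂μ = ∫ ω, (μ[χ | m₁] * μ[Y | m₁]) ω ∂μ := by
    rw [← integral_condExp h₁]
    exact integral_congr_ae (condExp_mul_of_stronglyMeasurable_left
      stronglyMeasurable_condExp hgY hYi)
  have e3 : ∫ ω, (χ * Y) ω ∂μ = ∫ ω, (μ[χ | m₁] * Y) ω ∂μ := by
    rw [← integral_condExp hsup]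
    refine integral_congr_ae ?_
    refine (condExp_mul_of_stronglyMeasurable_right hY (hχb _ hYi) hχi).trans ?_
    filter_upwards [condExp_indicator_sup_eq h₁₂ h₂ hG hind hs] with ω hω
    simp only [Pi.mul_apply]
    rw [hω]
  rw [hset, hset, e1, e3, e2]

/-- `Y` plays `X` with the newly revealed information erased. Its conditional expectation does not
move, and each conditional expectation of `X - Y` contributes at most `D`. -/
theorem ae_abs_condExp_sub_le_of_indep_sup {m₁ m₂ G : MeasurableSpace Ω} (h₁₂ : m₁ ≤ m₂)
    (h₂ : m₂ ≤ mΩ) (hG : G ≤ mΩ) (hind : Indep m₂ G μ) {X Y : Ω → ℝ}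
    (hY : StronglyMeasurable[m₁ ⊔ G] Y) (hX : Integrable X μ) {D : ℝ}
    (hXY : ∀ᵐ ω ∂μ, |(X - Y) ω| ≤ D) :
    ∀ᵐ ω ∂μ, |(μ[X | m₂]) ω - (μ[X | m₁]) ω| ≤ 2 * D := by
  have hsup : m₁ ⊔ G ≤ mΩ := sup_le (h₁₂.trans h₂) hG
  have hXYi : Integrable (X - Y) μ :=
    Integrable.of_bound (hX.aestronglyMeasurable.sub (hY.mono hsup).aestronglyMeasurable) D hXY
  have hYi : Integrable Y μ := by
    have := hX.sub hXYi
    rwa [sub_sub_cancel] at this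
  have hYeq := condExp_eq_of_indep_sup h₁₂ h₂ hG hind hY hYi
  have hsplit : ∀ m' : MeasurableSpace Ω, μ[X | m'] =ᵐ[μ] μ[X - Y | m'] + μ[Y | m'] := fun m' => by
    have := condExp_add hXYi hYi m'
    rwa [sub_add_cancel] at this
  have hb₁ := ae_bdd_abs_condExp_of_ae_bdd_abs (m := m₁) hXY
  have hb₂ := ae_bdd_abs_condExp_of_ae_bdd_abs (m := m₂) hXY
  filter_upwards [hYeq, hsplit m₁, hsplit m₂, hb₁, hb₂] with ω e1 e2 e3 e4 e5
  rw [e2, e3, Pi.add_apply, Pi.add_apply, e1, add_sub_add_right_eq_sub]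
  exact (abs_sub _ _).trans (by linarith)

end ConditionalExpectation

/-! ### Azuma's inequality. -/

section Azuma

open ProbabilityTheory

variable {Ω : Type*} {mΩ : MeasurableSpace Ω} {μ : Measure Ω} [IsProbabilityMeasure μ]

/-- On `[-c, c]` the convex exponential lies below its chord. -/
theorem exp_mul_le_cosh_add {s c x : ℝ} (hc : 0 < c) (hx : |x| ≤ c) :
    Real.exp (s * x) ≤ Real.cosh (s * c) + x / c * Real.sinh (s * c) := by
  obtain ⟨h1, h2⟩ := abs_le.1 hx
  have ha : 0 ≤ (1 + x / c) / 2 := by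
    have : -1 ≤ x / c := by rw [le_div_iff₀ hc]; linarith
    linarith
  have hb : 0 ≤ (1 - x / c) / 2 := by
    have : x / c ≤ 1 := by rw [div_le_iff₀ hc]; linarith
    linarith
  have hconv := convexOn_exp.2 (mem_univ (s * c)) (mem_univ (-(s * c))) ha hb (by ring)
  simp only [smul_eq_mul] at hconv
  have e1 : (1 + x / c) / 2 * (s * c) + (1 - x / c) / 2 * (-(s * c)) = s * x := by
    field_simp; ring
  rw [e1] at hconv
  refine hconv.trans (le_of_eq ?_)
  rw [Real.cosh_eq, Real.sinh_eq]
  ring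

/-- The linear part of the chord bound is a martingale increment, orthogonal to the `m₁`-measurable
weight; the rest is `cosh x ≤ exp (x² / 2)`. -/
theorem integral_exp_mul_condExp_succ_le {m₁ m₂ : MeasurableSpace Ω} (h₁₂ : m₁ ≤ m₂) (h₂ : m₂ ≤ mΩ)
    {X : Ω → ℝ} {M c s : ℝ} (hM : ∀ᵐ ω ∂μ, |X ω| ≤ M) (hc : 0 < c)
    (hdiff : ∀ᵐ ω ∂μ, |(μ[X | m₂]) ω - (μ[X | m₁]) ω| ≤ c) :
    ∫ ω, Real.exp (s * (μ[X | m₂]) ω) ∂μ ≤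
      Real.exp (c ^ 2 * s ^ 2 / 2) * ∫ ω, Real.exp (s * (μ[X | m₁]) ω) ∂μ := by
  have h₁ : m₁ ≤ mΩ := h₁₂.trans h₂
  have hb : ∀ m : MeasurableSpace Ω, ∀ᵐ ω ∂μ, |(μ[X | m]) ω| ≤ M := fun m =>
    ae_bdd_abs_condExp_of_ae_bdd_abs hM
  have hexpb : ∀ m : MeasurableSpace Ω, ∀ᵐ ω ∂μ,
      ‖Real.exp (s * (μ[X | m]) ω)‖ ≤ Real.exp (|s| * M) := fun m => by
    filter_upwards [hb m] with ω hω
    rw [Real.norm_of_nonneg (Real.exp_pos _).le, Real.exp_le_exp]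
    refine (le_abs_self _).trans ?_
    rw [abs_mul]
    gcongr
  have hsm : ∀ m : MeasurableSpace Ω,
      StronglyMeasurable[m] fun ω => Real.exp (s * (μ[X | m]) ω) := fun m =>
    Real.continuous_exp.comp_stronglyMeasurable (stronglyMeasurable_condExp.const_mul s)
  have hint : ∀ m : MeasurableSpace Ω, m ≤ mΩ →
      Integrable (fun ω => Real.exp (s * (μ[X | m]) ω)) μ := fun m hm =>
    Integrable.of_bound ((hsm m).mono hm).aestronglyMeasurable _ (hexpb m)
  set e : Ω → ℝ := fun ω => Real.exp (s * (μ[X | m₁]) ω) with he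
  set D : Ω → ℝ := μ[X | m₂] - μ[X | m₁] with hD
  have hDi : Integrable D μ := integrable_condExp.sub integrable_condExp
  have heD : Integrable (e * D) μ :=
    hDi.bdd_mul (hint m₁ h₁).aestronglyMeasurable (hexpb m₁)
  have hzero : ∫ ω, (e * D) ω ∂μ = 0 := by
    rw [← integral_condExp h₁]
    have h0 : μ[D | m₁] =ᵐ[μ] 0 := by
      refine (condExp_sub integrable_condExp integrable_condExp m₁).trans ?_
      have e1 := condExp_condExp_of_le (f := X) (μ := μ) h₁₂ h₂
      have e2 := condExp_of_stronglyMeasurable h₁ (stronglyMeasurable_condExp (f := X) (μ := μ))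
        integrable_condExp
      filter_upwards [e1] with ω hω
      rw [Pi.sub_apply, hω, e2, sub_self, Pi.zero_apply]
    have h1 := condExp_mul_of_stronglyMeasurable_left (hsm m₁) heD hDi
    rw [integral_congr_ae (h1.trans (h0.mono fun ω hω => ?_)), integral_zero]
    show e ω * (μ[D | m₁]) ω = (0 : ℝ)
    rw [hω, Pi.zero_apply, mul_zero]
  calc ∫ ω, Real.exp (s * (μ[X | m₂]) ω) ∂μ
      ≤ ∫ ω, (Real.cosh (s * c) * e ω + Real.sinh (s * c) / c * (e * D) ω) ∂μ := by
        refine integral_mono_ae (hint m₂ h₂)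
          (((hint m₁ h₁).const_mul _).add (heD.const_mul _)) ?_
        filter_upwards [hdiff] with ω hω
        have h1 := exp_mul_le_cosh_add (s := s) hc hω
        have h2 : Real.exp (s * (μ[X | m₂]) ω) =
            e ω * Real.exp (s * ((μ[X | m₂]) ω - (μ[X | m₁]) ω)) := by
          rw [he, ← Real.exp_add]; ring_nf
        rw [h2]
        refine (mul_le_mul_of_nonneg_left h1 (Real.exp_pos _).le).trans (le_of_eq ?_)
        simp only [Pi.mul_apply, hD, Pi.sub_apply]
        ring
    _ = Real.cosh (s * c) * ∫ ω, e ω ∂μ := by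
        rw [integral_add ((hint m₁ h₁).const_mul _) (heD.const_mul _), integral_const_mul,
          integral_const_mul, hzero, mul_zero, add_zero]
    _ ≤ Real.exp (c ^ 2 * s ^ 2 / 2) * ∫ ω, e ω ∂μ := by
        refine mul_le_mul_of_nonneg_right ?_ (integral_nonneg fun ω => (Real.exp_pos _).le)
        refine (Real.cosh_le_exp_half_sq _).trans (le_of_eq ?_)
        ring_nf

/-- The Azuma–Hoeffding inequality for the Doob martingale of a bounded random variable. -/
theorem azuma_hoeffding {X : Ω → ℝ} {ℱ : ℕ → MeasurableSpace Ω} {N : ℕ} {M c : ℝ}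
    (hℱ : ∀ k, ℱ k ≤ mΩ) (hmono : ∀ k, ℱ k ≤ ℱ (k + 1)) (hX : AEStronglyMeasurable X μ)
    (hM : ∀ᵐ ω ∂μ, |X ω| ≤ M)
    (h0 : μ[X | ℱ 0] =ᵐ[μ] fun _ => ∫ ω, X ω ∂μ) (hN : μ[X | ℱ N] =ᵐ[μ] X) (hc : 0 < c)
    (hdiff : ∀ k, ∀ᵐ ω ∂μ, |(μ[X | ℱ (k + 1)]) ω - (μ[X | ℱ k]) ω| ≤ c) {r : ℝ} (hr : 0 ≤ r) :
    μ.real {ω | r ≤ |X ω - ∫ ω', X ω' ∂μ|} ≤ 2 * Real.exp (-r ^ 2 / (2 * (N * c ^ 2))) := by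
  set E := ∫ ω', X ω' ∂μ with hE
  have hstep : ∀ (s : ℝ) (k : ℕ), ∫ ω, Real.exp (s * (μ[X | ℱ k]) ω) ∂μ ≤
      Real.exp (k * c ^ 2 * s ^ 2 / 2 + s * E) := by
    intro s k
    induction k with
    | zero =>
      rw [integral_congr_ae (g := fun _ => Real.exp (s * E))
        (h0.mono fun ω hω => by simp only [hω])]
      simp
    | succ k ih =>
      refine (integral_exp_mul_condExp_succ_le (hmono k) (hℱ _) hM hc (hdiff k)).trans ?_
      refine (mul_le_mul_of_nonneg_left ih (Real.exp_pos _).le).trans (le_of_eq ?_)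
      rw [← Real.exp_add]
      push_cast
      ring_nf
  have hexp : ∀ s : ℝ, Integrable (fun ω => Real.exp (s * (X ω - E))) μ := by
    intro s
    refine Integrable.of_bound (C := Real.exp (|s| * (M + |E|))) ?_ ?_
    · exact Real.continuous_exp.comp_aestronglyMeasurable
        ((hX.sub aestronglyMeasurable_const).const_mul s)
    · filter_upwards [hM] with ω hω
      rw [Real.norm_of_nonneg (Real.exp_pos _).le, Real.exp_le_exp]
      refine (le_abs_self _).trans ?_
      rw [abs_mul]
      gcongr
      exact (abs_sub _ _).trans (by linarith)
  have hmgf : ∀ s : ℝ, mgf (fun ω => X ω - E) μ s ≤ Real.exp (N * c ^ 2 * s ^ 2 / 2) := by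
    intro s
    have h1 := hstep s N
    rw [integral_congr_ae (g := fun ω => Real.exp (s * X ω))
      (hN.mono fun ω hω => by simp only [hω])] at h1
    rw [mgf]
    have h2 : ∀ ω, Real.exp (s * (X ω - E)) = Real.exp (-(s * E)) * Real.exp (s * X ω) :=
      fun ω => by rw [← Real.exp_add]; ring_nf
    simp_rw [h2]
    rw [integral_const_mul]
    refine (mul_le_mul_of_nonneg_left h1 (Real.exp_pos _).le).trans (le_of_eq ?_)
    rw [← Real.exp_add]
    ring_nf
  have hsub : HasSubgaussianMGF (fun ω => X ω - E) ⟨N * c ^ 2, by positivity⟩ μ :=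
    ⟨hexp, hmgf⟩
  have hsub' : HasSubgaussianMGF (fun ω => -(X ω - E)) ⟨N * c ^ 2, by positivity⟩ μ := hsub.neg
  have h1 : μ.real {ω | r ≤ X ω - E} ≤ Real.exp (-r ^ 2 / (2 * (N * c ^ 2))) :=
    hsub.measure_ge_le hr
  have h2 : μ.real {ω | r ≤ -(X ω - E)} ≤ Real.exp (-r ^ 2 / (2 * (N * c ^ 2))) :=
    hsub'.measure_ge_le hr
  have h3 : {ω | r ≤ |X ω - E|} ⊆ {ω | r ≤ X ω - E} ∪ {ω | r ≤ -(X ω - E)} := fun ω hω =>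
    le_abs.1 (show r ≤ |X ω - E| from hω)
  have h4 := (measureReal_mono (μ := μ) h3).trans (measureReal_union_le _ _)
  linarith

end Azuma

/-! ### σ-algebras generated by the field on a set. -/

section SigmaOn

variable {d m : ℕ} {Ω : Type*} {A B : Set (Eucl m)} {ℓ : Eucl d → A → B → Ω → ℝ}

theorem measurable_sigmaOn {S : Set (Eucl d)} {x : Eucl d} (hx : x ∈ S) (a : A) (b : B) :
    Measurable[sigmaOn (fun (i : A × B) x ω => ℓ x i.1 i.2 ω) S] fun ω => ℓ x a b ω := by
  have h1 : MeasurableSpace.comap (fun ω => ℓ x a b ω) (borel ℝ) ≤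
      sigmaOn (fun (i : A × B) x ω => ℓ x i.1 i.2 ω) S :=
    le_iSup_of_le (a, b) (le_iSup₂_of_le x hx le_rfl)
  exact (comap_measurable _).mono h1 le_rfl

theorem sigmaOn_mono {I : Type*} {X : I → Eucl d → Ω → ℝ} {S S' : Set (Eucl d)} (h : S ⊆ S') :
    sigmaOn X S ≤ sigmaOn X S' :=
  iSup_mono fun _ => biSup_mono fun _ hx => h hx

end SigmaOn

/-! ### Essential oscillation of the random cost. -/

section RandomCost

open ProbabilityTheory

variable {d m : ℕ} {Ω : Type*} [MeasurableSpace Ω] {μ : Measure Ω} {A B : Set (Eucl m)}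
  {ℓ : Eucl d → A → B → Ω → ℝ} {L ρ : ℝ}

section

variable [AddAction (Eucl d) Ω]

theorem IsStationaryCost.isRegularCost (hℓ : IsStationaryCost ℓ L) (ω : Ω) :
    IsRegularCost (fun x a b => ℓ x a b ω) L :=
  ⟨hℓ.bounded ω, fun x y a b => hℓ.lipschitz x y a b ω⟩

theorem IsStationaryCost.continuous (hℓ : IsStationaryCost ℓ L) (ω : Ω) (x : Eucl d) :
    Continuous fun q : A × B => ℓ x q.1 q.2 ω :=
  (hℓ.uniformContinuous ω).continuous.comp (Continuous.prodMk_right x)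

theorem IsStationaryCost.measurable_apply (hℓ : IsStationaryCost ℓ L) (x : Eucl d) (a : A) (b : B) :
    Measurable fun ω => ℓ x a b ω :=
  hℓ.measurable.comp (measurable_const.prodMk (measurable_const.prodMk
    (measurable_const.prodMk measurable_id)))

theorem IsStationaryCost.sigmaOn_le (hℓ : IsStationaryCost ℓ L) (S : Set (Eucl d)) :
    sigmaOn (fun (i : A × B) x ω => ℓ x i.1 i.2 ω) S ≤ ‹MeasurableSpace Ω› :=
  iSup_le fun i => iSup₂_le fun x _ => (hℓ.measurable_apply x i.1 i.2).comap_le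

end

theorem lt_setDist_halfSpaces {e : Eucl d} (he : ‖e‖ = 1) (hρ : 0 ≤ ρ) (s : ℝ) :
    ENNReal.ofReal ρ < setDist {y : Eucl d | inner ℝ y e < s} {y | s + ρ + 1 ≤ inner ℝ y e} := by
  refine lt_of_lt_of_le ((ENNReal.ofReal_lt_ofReal_iff (by linarith)).2 (lt_add_one ρ)) ?_
  refine le_iInf₂ fun x hx => le_iInf₂ fun y hy => ?_
  rw [edist_dist]
  refine ENNReal.ofReal_le_ofReal ?_
  have h1 : inner ℝ (y - x) e ≤ ‖y - x‖ * ‖e‖ := real_inner_le_norm _ _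
  rw [he, mul_one, inner_sub_left] at h1
  rw [dist_comm, dist_eq_norm]
  simp only [mem_ofPred_eq] at hx hy
  linarith

variable [IsProbabilityMeasure μ]

/-- Fubini under the product law freezes one variable at a typical value `m₀`; equality of the laws
transfers the bound to `X`. -/
theorem exists_ae_abs_sub_le_of_indepFun {X Y : Ω → ℝ} (hX : Measurable X) (hY : Measurable Y)
    (hind : IndepFun X Y μ) (hid : μ.map X = μ.map Y) {c : ℝ} (hc : ∀ ω, |X ω - Y ω| ≤ c) :
    ∃ m₀, ∀ᵐ ω ∂μ, |X ω - m₀| ≤ c := by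
  have h1 := (indepFun_iff_map_prod_eq_prod_map_map hX.aemeasurable hY.aemeasurable).1 hind
  have hms : MeasurableSet {q : ℝ × ℝ | |q.1 - q.2| ≤ c} :=
    (isClosed_le (by fun_prop) continuous_const).measurableSet
  have h2 : ∀ᵐ q ∂((μ.map X).prod (μ.map Y)), |q.1 - q.2| ≤ c := by
    rw [← h1, ae_map_iff (hX.prodMk hY).aemeasurable hms]
    exact Filter.Eventually.of_forall hc
  have h3 := Measure.ae_ae_of_ae_prod h2
  have : IsProbabilityMeasure (μ.map X) := Measure.isProbabilityMeasure_map hX.aemeasurable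
  obtain ⟨m₀, hm₀⟩ := h3.exists
  refine ⟨m₀, ?_⟩
  rw [← hid] at hm₀
  have h4 := ae_of_ae_map hX.aemeasurable hm₀
  filter_upwards [h4] with ω hω
  rwa [abs_sub_comm]

variable [AddAction (Eucl d) Ω] [MeasurableVAdd₂ (Eucl d) Ω] [VAddInvariantMeasure (Eucl d) Ω μ]

/-- The finite range of dependence and the Lipschitz continuity bound the essential oscillation of
the cost, although the cost itself may be large. -/
theorem IsStationaryCost.exists_ae_abs_sub_le (hℓ : IsStationaryCost ℓ L)
    (hrange : HasFiniteRange μ (fun (i : A × B) x ω => ℓ x i.1 i.2 ω) ρ) (hρ : 0 ≤ ρ)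
    (hA : A.Nonempty) (hB : B.Nonempty) {e : Eucl d} (he : ‖e‖ = 1) :
    ∃ ω₀, ∀ᵐ ω ∂μ, ∀ x a b, |ℓ x a b ω - ℓ 0 a b ω₀| ≤ 2 * (L * (ρ + 1)) := by
  have := hA.to_subtype
  have := hB.to_subtype
  have hmp : ∀ x : Eucl d, MeasurePreserving (fun ω : Ω => x +ᵥ ω) μ μ := fun x =>
    measurePreserving_vadd x μ
  -- Costs at distance `ρ + 1` are independent with the same law, yet differ by at most `L * (ρ +
  -- 1)`.
  have key : ∀ (a : A) (b : B), ∃ m₀, ∀ᵐ ω ∂μ, |ℓ 0 a b ω - m₀| ≤ L * (ρ + 1) := by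
    intro a b
    set z : Eucl d := (ρ + 1) • e with hz
    have hzn : ‖z‖ = ρ + 1 := by
      rw [hz, norm_smul, he, mul_one, Real.norm_of_nonneg (by linarith)]
    refine exists_ae_abs_sub_le_of_indepFun (hℓ.measurable_apply 0 a b)
      (hℓ.measurable_apply z a b) ?_ ?_ fun ω => ?_
    · have h1 : ENNReal.ofReal ρ < setDist {(0 : Eucl d)} {z} := by
        simp only [setDist, mem_singleton_iff, iInf_iInf_eq_left]
        rw [edist_dist, dist_zero_left, hzn]
        exact (ENNReal.ofReal_lt_ofReal_iff (by linarith)).2 (lt_add_one ρ)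
      rw [IndepFun_iff_Indep]
      exact indep_of_indep_of_le_left (indep_of_indep_of_le_right (hrange _ _ h1)
        (measurable_sigmaOn (mem_singleton z) a b).comap_le)
        (measurable_sigmaOn (mem_singleton 0) a b).comap_le
    · have h1 : (fun ω => ℓ z a b ω) = (fun ω => ℓ 0 a b ω) ∘ fun ω => z +ᵥ ω := by
        ext ω; exact hℓ.stationary z a b ω
      rw [h1, ← Measure.map_map (hℓ.measurable_apply 0 a b) (hmp z).measurable, (hmp z).map_eq]
    · have := hℓ.lipschitz 0 z a b ω
      rwa [zero_sub, norm_neg, hzn] at this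
  choose m₀ hm₀ using key
  have key' : ∀ x a b, ∀ᵐ ω ∂μ, |ℓ x a b ω - m₀ a b| ≤ L * (ρ + 1) := by
    intro x a b
    filter_upwards [(hmp x).quasiMeasurePreserving.ae (hm₀ a b)] with ω hω
    rwa [hℓ.stationary x a b ω]
  let u := TopologicalSpace.denseSeq (Eucl d)
  let v := TopologicalSpace.denseSeq (A × B)
  have hall : ∀ᵐ ω ∂μ, ∀ i j, |ℓ (u i) (v j).1 (v j).2 ω - m₀ (v j).1 (v j).2| ≤ L * (ρ + 1) :=
    ae_all_iff.2 fun i => ae_all_iff.2 fun j => key' _ _ _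
  have hall0 : ∀ᵐ ω ∂μ, ∀ j, |ℓ 0 (v j).1 (v j).2 ω - m₀ (v j).1 (v j).2| ≤ L * (ρ + 1) :=
    ae_all_iff.2 fun j => key' _ _ _
  -- `m₀` need not be continuous in the controls, whereas the cost at one typical `ω₀` is. The
  -- replacement costs the factor `2` and lets density reach all points at once.
  obtain ⟨ω₀, hω₀⟩ := hall0.exists
  refine ⟨ω₀, ?_⟩
  filter_upwards [hall] with ω hω
  have hd : DenseRange (Prod.map u v) :=
    (TopologicalSpace.denseRange_denseSeq _).prodMap (TopologicalSpace.denseRange_denseSeq _)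
  have hcl : IsClosed {q : Eucl d × A × B |
      |ℓ q.1 q.2.1 q.2.2 ω - ℓ 0 q.2.1 q.2.2 ω₀| ≤ 2 * (L * (ρ + 1))} := by
    refine isClosed_le (Continuous.abs (Continuous.sub ?_ ?_)) continuous_const
    · exact (hℓ.uniformContinuous ω).continuous
    · exact (hℓ.continuous ω₀ 0).comp continuous_snd
  have hP := isClosed_property hd hcl fun ij => by
    have h1 := hω ij.1 ij.2
    have h2 := hω₀ ij.2
    rw [abs_sub_comm] at h2
    have h3 := abs_sub_le (ℓ (u ij.1) (v ij.2).1 (v ij.2).2 ω) (m₀ (v ij.2).1 (v ij.2).2)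
      (ℓ 0 (v ij.2).1 (v ij.2).2 ω₀)
    simp only [Prod.map_fst, Prod.map_snd]
    linarith
  exact fun x a b => hP (x, a, b)

end RandomCost

/-! ### Erasing the cost in a slab. -/

section SlabCutoff

/-- The piecewise linear cutoff which is `1` on `[s₀, s₁]` and vanishes outside
`[s₀ - 1, s₁ + 1]`. -/
noncomputable def slabCutoff (s₀ s₁ z : ℝ) : ℝ := max 0 (min 1 (min (z - (s₀ - 1)) (s₁ + 1 - z)))

variable {s₀ s₁ z : ℝ}

theorem slabCutoff_nonneg : 0 ≤ slabCutoff s₀ s₁ z := le_max_left _ _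

theorem slabCutoff_le_one : slabCutoff s₀ s₁ z ≤ 1 := max_le zero_le_one (min_le_left _ _)

theorem slabCutoff_eq_one (h₀ : s₀ ≤ z) (h₁ : z ≤ s₁) : slabCutoff s₀ s₁ z = 1 := by
  rw [slabCutoff, min_eq_left (le_min (by linarith) (by linarith)), max_eq_right zero_le_one]

theorem slabCutoff_eq_zero (h : z < s₀ - 1 ∨ s₁ + 1 < z) : slabCutoff s₀ s₁ z = 0 := by
  refine max_eq_left ((min_le_right _ _).trans ?_)
  rcases h with h | h
  · exact (min_le_left _ _).trans (by linarith)
  · exact (min_le_right _ _).trans (by linarith)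

theorem abs_slabCutoff_sub_le (z z' : ℝ) :
    |slabCutoff s₀ s₁ z - slabCutoff s₀ s₁ z'| ≤ |z - z'| := by
  have h1 := abs_max_sub_max_le_max 0 (min 1 (min (z - (s₀ - 1)) (s₁ + 1 - z))) 0
    (min 1 (min (z' - (s₀ - 1)) (s₁ + 1 - z')))
  have h2 := abs_min_sub_min_le_max 1 (min (z - (s₀ - 1)) (s₁ + 1 - z)) 1
    (min (z' - (s₀ - 1)) (s₁ + 1 - z'))
  have h3 := abs_min_sub_min_le_max (z - (s₀ - 1)) (s₁ + 1 - z) (z' - (s₀ - 1)) (s₁ + 1 - z')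
  rw [sub_sub_sub_cancel_right, sub_sub_sub_cancel_left, abs_sub_comm z' z, max_self] at h3
  rw [sub_self, abs_zero] at h1 h2
  exact h1.trans (max_le (abs_nonneg _) (h2.trans (max_le (abs_nonneg _) h3)))

variable {d : ℕ} {A B : Type*}

/-- The cost `c` replaced by the constant-in-space cost `c₀` in a slab orthogonal to `e`. -/
noncomputable def slabCost (e : Eucl d) (s₀ s₁ : ℝ) (c : Eucl d → A → B → ℝ) (c₀ : A → B → ℝ)
    (x : Eucl d) (a : A) (b : B) : ℝ :=
  c x a b + slabCutoff s₀ s₁ (inner ℝ x e) * (c₀ a b - c x a b)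

/-- The ramps of the cutoff have slope one along the unit vector `e`, which adds `C` to the
Lipschitz constant. -/
theorem IsRegularCost.slabCost {c : Eucl d → A → B → ℝ} {L : ℝ} (hc : IsRegularCost c L)
    {e : Eucl d} (he : ‖e‖ = 1) (s₀ s₁ : ℝ) {c₀ : A → B → ℝ} {C : ℝ}
    (hc₀ : ∀ x a b, |c₀ a b - c x a b| ≤ C) :
    IsRegularCost (slabCost e s₀ s₁ c c₀) (L + C) := by
  have hχ : ∀ z, 0 ≤ slabCutoff s₀ s₁ z ∧ slabCutoff s₀ s₁ z ≤ 1 := fun z =>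
    ⟨slabCutoff_nonneg, slabCutoff_le_one⟩
  constructor
  · obtain ⟨M, hM⟩ := hc.bounded
    refine ⟨M + C, fun x a b => (abs_add_le _ _).trans (add_le_add (hM x a b) ?_)⟩
    rw [abs_mul, abs_of_nonneg (hχ _).1]
    exact (mul_le_of_le_one_left (abs_nonneg _) (hχ _).2).trans (hc₀ x a b)
  · intro x y a b
    have e1 : _root_.slabCost e s₀ s₁ c c₀ x a b - _root_.slabCost e s₀ s₁ c c₀ y a b =
        (1 - slabCutoff s₀ s₁ (inner ℝ x e)) * (c x a b - c y a b) +
        (slabCutoff s₀ s₁ (inner ℝ x e) - slabCutoff s₀ s₁ (inner ℝ y e)) *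
          (c₀ a b - c y a b) := by
      unfold _root_.slabCost; ring
    rw [e1, add_mul]
    refine (abs_add_le _ _).trans (add_le_add ?_ ?_)
    · rw [abs_mul, abs_of_nonneg (by linarith [(hχ (inner ℝ x e)).2])]
      exact (mul_le_of_le_one_left (abs_nonneg _) (by linarith [(hχ (inner ℝ x e)).1])).trans
        (hc.lipschitz x y a b)
    · rw [abs_mul, mul_comm C]
      refine mul_le_mul ((abs_slabCutoff_sub_le _ _).trans ?_) (hc₀ y a b) (abs_nonneg _)
        (norm_nonneg _)
      rw [← inner_sub_left]
      simpa [he] using abs_real_inner_le_norm (x - y) e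

end SlabCutoff

/-! ### Concentration of the discrete value. -/

section Concentration

open ProbabilityTheory

variable {d m : ℕ} {Ω : Type*} [MeasurableSpace Ω] {μ : Measure Ω} [IsProbabilityMeasure μ]
  [AddAction (Eucl d) Ω] [MeasurableVAdd₂ (Eucl d) Ω] [VAddInvariantMeasure (Eucl d) Ω μ]
  {A B : Set (Eucl m)} {f : A → B → Eucl d} {ℓ : Eucl d → A → B → Ω → ℝ} {F L ρ δ h : ℝ}
  {θ e : Eucl d}

/-- Revealing one more unit slab of the environment moves the conditional expectation of the game
value by a bounded amount. -/
theorem ae_abs_condExp_gameValue_sub_le (hA : IsCompact A) (hA' : A.Nonempty) (hB : IsCompact B)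
    (hB' : B.Nonempty) (hfc : Continuous fun q : A × B => f q.1 q.2) (hf : ∀ a b, ‖f a b‖ ≤ F)
    (he : ‖e‖ = 1) (hδ : 0 < δ) (hfe : ∀ a b, δ ≤ inner ℝ (f a b) e) (hL : 0 < L) (hρ : 0 < ρ)
    (hℓ : IsStationaryCost ℓ L)
    (hrange : HasFiniteRange μ (fun (i : A × B) x ω => ℓ x i.1 i.2 ω) ρ)
    (hh : 0 < h) (hh1 : h ≤ 1) (n : ℕ) (s : ℝ) {C : ℝ}
    (hb : ∀ ω, |gameValue f (fun x a b => ℓ x a b ω) h θ n 0| ≤ C) :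
    ∀ᵐ ω ∂μ, |(μ[fun ω => gameValue f (fun x a b => ℓ x a b ω) h θ n 0 |
        sigmaOn (fun (i : A × B) x ω => ℓ x i.1 i.2 ω) {y | inner ℝ y e < s + 1}]) ω -
      (μ[fun ω => gameValue f (fun x a b => ℓ x a b ω) h θ n 0 |
        sigmaOn (fun (i : A × B) x ω => ℓ x i.1 i.2 ω) {y | inner ℝ y e < s}]) ω| ≤
      2 * (2 * (L * (ρ + 1)) * ((ρ + 4 + δ) / δ)) := by
  have := hA'.to_subtype
  have := hB'.to_subtype
  have := isCompact_iff_compactSpace.1 hA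
  have := isCompact_iff_compactSpace.1 hB
  obtain ⟨ω₀, hω₀⟩ := hℓ.exists_ae_abs_sub_le hrange hρ.le hA' hB' he
  set X : Ω → ℝ := fun ω => gameValue f (fun x a b => ℓ x a b ω) h θ n 0 with hX
  set Xi := (fun (i : A × B) x ω => ℓ x i.1 i.2 ω) with hXi
  -- The erased region is the slab about to be revealed and a buffer of width `ρ + 1`, so that what
  -- lies beyond is independent of everything below height `s + 1`.
  set c' : Ω → Eucl d → A → B → ℝ := fun ω =>
    slabCost e s (s + 1 + ρ + 1) (fun x a b => ℓ x a b ω) fun a b => ℓ 0 a b ω₀ with hc'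
  set Y : Ω → ℝ := fun ω => gameValue f (c' ω) h θ n 0 with hY
  have hsub : {y : Eucl d | inner ℝ y e < s} ⊆ {y | inner ℝ y e < s + 1} :=
    fun y (hy : inner ℝ y e < s) => show inner ℝ y e < s + 1 by linarith
  have hF0 : 0 ≤ F := by
    obtain ⟨a⟩ := ‹Nonempty A›
    obtain ⟨b⟩ := ‹Nonempty B›
    exact (norm_nonneg _).trans (hf a b)
  have hfe0 : ∀ a b, 0 ≤ inner ℝ (f a b) e := fun a b => hδ.le.trans (hfe a b)
  have hfF : ∀ a b, inner ℝ (f a b) e ≤ F := fun a b => by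
    have := real_inner_le_norm (f a b) e
    rw [he, mul_one] at this
    exact this.trans (hf a b)
  have hCω : ∀ ω, ∃ C, ∀ x a b, |ℓ 0 a b ω₀ - ℓ x a b ω| ≤ C := fun ω => by
    obtain ⟨C, hC⟩ := hℓ.bounded ω
    obtain ⟨C₀, hC₀⟩ := hℓ.bounded ω₀
    exact ⟨C₀ + C, fun x a b => (abs_sub _ _).trans (add_le_add (hC₀ 0 a b) (hC x a b))⟩
  choose Cω hCω using hCω
  have hreg : ∀ ω, IsRegularCost (c' ω) (L + Cω ω) := fun ω =>
    (hℓ.isRegularCost ω).slabCost he _ _ (hCω ω)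
  have hYm : Measurable[sigmaOn Xi {y : Eucl d | inner ℝ y e < s} ⊔
      sigmaOn Xi {y : Eucl d | s + 1 + ρ + 1 ≤ inner ℝ y e}] Y := by
    refine measurable_gameValue (mΩ := _) (e := e) (s₀ := 0) (s₁ := n * h * F + 1) hfc hf hreg
      hh.le ?_ hfe0 hfF hF0 ?_ n 0 (by simp) (by simp)
    · intro ω x
      have h1 := hℓ.continuous ω x
      have h2 := hℓ.continuous ω₀ 0
      simp only [hc', slabCost]
      exact h1.add (continuous_const.mul (h2.sub h1))
    · intro x a b _ _
      simp only [hc', slabCost]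
      -- Before and beyond the slab, the cost is measurable for one of the two σ-algebras; in
      -- between the cutoff is `1` and the cost is deterministic.
      by_cases hx1 : inner ℝ x e < s
      · have h1 : Measurable[sigmaOn Xi {y : Eucl d | inner ℝ y e < s} ⊔
      sigmaOn Xi {y : Eucl d | s + 1 + ρ + 1 ≤ inner ℝ y e}] fun ω => ℓ x a b ω :=
          (measurable_sigmaOn (S := {y : Eucl d | inner ℝ y e < s}) hx1 a b).mono le_sup_left le_rfl
        exact h1.add ((measurable_const.sub h1).const_mul _)
      by_cases hx2 : s + 1 + ρ + 1 ≤ inner ℝ x e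
      · have h1 : Measurable[sigmaOn Xi {y : Eucl d | inner ℝ y e < s} ⊔
      sigmaOn Xi {y : Eucl d | s + 1 + ρ + 1 ≤ inner ℝ y e}] fun ω => ℓ x a b ω :=
          (measurable_sigmaOn (S := {y : Eucl d | s + 1 + ρ + 1 ≤ inner ℝ y e}) hx2 a b).mono
            le_sup_right le_rfl
        exact h1.add ((measurable_const.sub h1).const_mul _)
      · rw [slabCutoff_eq_one (not_lt.1 hx1) (not_le.1 hx2).le]
        simp only [one_mul, add_sub_cancel]
        exact measurable_const
  have hXm : Measurable X := by
    refine measurable_gameValue (e := e) (s₀ := 0) (s₁ := n * h * F + 1) hfc hf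
      (fun ω => hℓ.isRegularCost ω) hh.le (fun ω x => hℓ.continuous ω x) hfe0 hfF hF0
      (fun x a b _ _ => hℓ.measurable_apply x a b) n 0 (by simp) (by simp)
  have hXY : ∀ᵐ ω ∂μ, |(X - Y) ω| ≤ 2 * (L * (ρ + 1)) * ((ρ + 4 + δ) / δ) := by
    filter_upwards [hω₀] with ω hω
    have h0 : 0 ≤ 2 * (L * (ρ + 1)) := by positivity
    -- The ramps of the cutoff widen the slab to `ρ + 4`.
    have h1 := abs_gameValue_sub_le_of_slab (θ := θ) hf (hℓ.isRegularCost ω) (hreg ω) hh.le hδ hfe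
      h0 (s₀ := s - 1) (s₁ := s + 1 + ρ + 1 + 1) (by linarith) (fun x a b => by
        simp only [hc', slabCost]
        rw [sub_add_cancel_left, abs_neg, abs_mul, abs_of_nonneg slabCutoff_nonneg,
          abs_sub_comm]
        exact (mul_le_of_le_one_left (abs_nonneg _) slabCutoff_le_one).trans (hω x a b))
      (fun x a b hx => by
        simp only [hc', slabCost]
        rw [slabCutoff_eq_zero hx, zero_mul, add_zero]) n 0
    refine h1.trans (mul_le_mul_of_nonneg_left ?_ h0)
    gcongr
    · linarith
    · nlinarith
  have hXi' : Integrable X μ := Integrable.of_bound hXm.aestronglyMeasurable C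
    (Filter.Eventually.of_forall hb)
  exact ae_abs_condExp_sub_le_of_indep_sup (sigmaOn_mono hsub) (hℓ.sigmaOn_le _) (hℓ.sigmaOn_le _)
    (hrange _ _ (lt_setDist_halfSpaces he hρ.le (s + 1))) hYm.stronglyMeasurable hXi' hXY

/-- The number of martingale increments follows the distance `n * h * F` that a trajectory can
cover, so the bound depends on the horizon `n * h` but not on the number of steps. -/
theorem measure_abs_gameValue_sub_integral_ge_le (hA : IsCompact A) (hA' : A.Nonempty)
    (hB : IsCompact B) (hB' : B.Nonempty) (hfc : Continuous fun q : A × B => f q.1 q.2)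
    (hf : ∀ a b, ‖f a b‖ ≤ F) (he : ‖e‖ = 1) (hδ : 0 < δ) (hfe : ∀ a b, δ ≤ inner ℝ (f a b) e)
    (hL : 0 < L) (hρ : 0 < ρ) (hℓ : IsStationaryCost ℓ L)
    (hrange : HasFiniteRange μ (fun (i : A × B) x ω => ℓ x i.1 i.2 ω) ρ)
    (hh : 0 < h) (hh1 : h ≤ 1) (n : ℕ) {C : ℝ}
    (hb : ∀ ω, |gameValue f (fun x a b => ℓ x a b ω) h θ n 0| ≤ C) {r : ℝ} (hr : 0 ≤ r) :
    μ.real {ω | r ≤ |gameValue f (fun x a b => ℓ x a b ω) h θ n 0 -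
        ∫ ω', gameValue f (fun x a b => ℓ x a b ω') h θ n 0 ∂μ|} ≤
      2 * Real.exp (-r ^ 2 / (2 * (⌈n * h * F + ρ + 2⌉₊ *
        (2 * (2 * (L * (ρ + 1)) * ((ρ + 4 + δ) / δ))) ^ 2))) := by
  have := hA'.to_subtype
  have := hB'.to_subtype
  have := isCompact_iff_compactSpace.1 hA
  have := isCompact_iff_compactSpace.1 hB
  have hF0 : 0 ≤ F := by
    obtain ⟨a⟩ := ‹Nonempty A›
    obtain ⟨b⟩ := ‹Nonempty B›
    exact (norm_nonneg _).trans (hf a b)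
  have hfe0 : ∀ a b, 0 ≤ inner ℝ (f a b) e := fun a b => hδ.le.trans (hfe a b)
  have hfF : ∀ a b, inner ℝ (f a b) e ≤ F := fun a b => by
    have := real_inner_le_norm (f a b) e
    rw [he, mul_one] at this
    exact this.trans (hf a b)
  set X : Ω → ℝ := fun ω => gameValue f (fun x a b => ℓ x a b ω) h θ n 0 with hX
  set Xi := (fun (i : A × B) x ω => ℓ x i.1 i.2 ω) with hXi
  have hmeas : ∀ (S : Set (Eucl d)) (s₁ : ℝ), n * h * F < s₁ →
      (∀ y : Eucl d, 0 ≤ inner ℝ y e → inner ℝ y e < s₁ → y ∈ S) → Measurable[sigmaOn Xi S] X := by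
    intro S s₁ hs₁ hS
    exact measurable_gameValue (mΩ := sigmaOn Xi S) (e := e) (s₀ := 0) (s₁ := s₁) hfc hf
      (fun ω => hℓ.isRegularCost ω) hh.le (fun ω x => hℓ.continuous ω x) hfe0 hfF hF0
      (fun x a b h0 h1 => measurable_sigmaOn (hS x h0 h1) a b) n 0 (by simp) (by simpa using hs₁)
  have hXm : Measurable X :=
    (hmeas univ (n * h * F + 1) (by linarith) fun _ _ _ => mem_univ _).mono (hℓ.sigmaOn_le _) le_rfl
  have hXi' : Integrable X μ := Integrable.of_bound hXm.aestronglyMeasurable C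
    (Filter.Eventually.of_forall hb)
  -- The offset `ρ + 1` makes stage `0` independent of the half-space `0 ≤ ⟨y, e⟩`, which contains
  -- all that is seen from the origin; the number of stages lets the last half-space contain every
  -- reachable point.
  refine azuma_hoeffding (ℱ := fun k => sigmaOn Xi {y | inner ℝ y e < k - (ρ + 1)})
    (fun k => hℓ.sigmaOn_le _) (fun k => sigmaOn_mono ?_) hXm.aestronglyMeasurable
    (Filter.Eventually.of_forall hb) ?_ ?_ (by positivity) (fun k => ?_) hr
  · intro y (hy : inner ℝ y e < k - (ρ + 1))
    show inner ℝ y e < ((k + 1 : ℕ) : ℝ) - (ρ + 1)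
    push_cast; linarith
  · refine condExp_indep_eq (m₁ := sigmaOn Xi {y | 0 ≤ inner ℝ y e}) (hℓ.sigmaOn_le _)
      (hℓ.sigmaOn_le _) ?_ ?_
    · exact (hmeas _ (n * h * F + 1) (by linarith) fun y hy _ => hy).stronglyMeasurable
    · have h1 := lt_setDist_halfSpaces he hρ.le (((0 : ℕ) : ℝ) - (ρ + 1))
      have h2 := (hrange _ _ h1).symm
      rwa [show ((0 : ℕ) : ℝ) - (ρ + 1) + ρ + 1 = 0 by push_cast; ring] at h2
  · rw [condExp_of_stronglyMeasurable (hℓ.sigmaOn_le _) _ hXi']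
    refine (hmeas _ (⌈n * h * F + ρ + 2⌉₊ - (ρ + 1)) ?_ fun y _ hy => hy).stronglyMeasurable
    have := Nat.le_ceil (n * h * F + ρ + 2)
    linarith
  · have h1 := ae_abs_condExp_gameValue_sub_le (θ := θ) hA hA' hB hB' hfc hf he hδ hfe hL hρ hℓ
      hrange hh hh1 n (k - (ρ + 1)) hb
    rw [show (k : ℝ) - (ρ + 1) + 1 = ((k + 1 : ℕ) : ℝ) - (ρ + 1) by push_cast; ring] at h1
    exact h1

end Concentration

/-! ### Properties inherited by the limit. -/

section GameLimit

variable {d m : ℕ} {Ω : Type*} {A B : Set (Eucl m)}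

/-- `w` is the locally uniform limit, at integer times, of the discrete game values as the time step
tends to zero. -/
def IsGameLimit (f : A → B → Eucl d) (ℓ : Eucl d → A → B → Ω → ℝ) (θ : Eucl d)
    (w : ℕ → Eucl d → Ω → ℝ) : Prop :=
  ∀ (ω : Ω) (t : ℕ) (R κ : ℝ), 0 < κ → ∃ N₀ : ℕ, ∀ N ≥ N₀, ∀ x, ‖x‖ ≤ R →
    |gameValue f (fun x a b => ℓ x a b ω) (1 / ((N : ℝ) + 1)) θ (t * (N + 1)) x - w t x ω| ≤ κ

variable {f : A → B → Eucl d} {ℓ : Eucl d → A → B → Ω → ℝ} {θ : Eucl d} {w : ℕ → Eucl d → Ω → ℝ}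
  {F L : ℝ}

theorem cast_steps_mul (t N : ℕ) : ((t * (N + 1) : ℕ) : ℝ) * (1 / ((N : ℝ) + 1)) = t := by
  push_cast
  field_simp

theorem IsGameLimit.tendsto (hw : IsGameLimit f ℓ θ w) (t : ℕ) (x : Eucl d) (ω : Ω) :
    Filter.Tendsto (fun N : ℕ => gameValue f (fun x a b => ℓ x a b ω) (1 / ((N : ℝ) + 1)) θ
      (t * (N + 1)) x) Filter.atTop (nhds (w t x ω)) := by
  rw [Metric.tendsto_atTop]
  intro κ hκ
  obtain ⟨N₀, hN₀⟩ := hw ω t ‖x‖ (κ / 2) (by positivity)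
  refine ⟨N₀, fun N hN => ?_⟩
  rw [Real.dist_eq]
  exact lt_of_le_of_lt (hN₀ N hN x le_rfl) (by linarith)

variable [Nonempty A] [Nonempty B]

theorem IsGameLimit.lipschitz (hw : IsGameLimit f ℓ θ w) (hf : ∀ a b, ‖f a b‖ ≤ F)
    (hℓ : ∀ ω, IsRegularCost (fun x a b => ℓ x a b ω) L) (t : ℕ) (x y : Eucl d) (ω : Ω) :
    |w t x ω - w t y ω| ≤ (‖θ‖ + L * t) * ‖x - y‖ := by
  refine le_of_tendsto ((hw.tendsto t x ω).sub (hw.tendsto t y ω)).abs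
    (Filter.Eventually.of_forall fun N => ?_)
  have := gameValue_lipschitz (θ := θ) hf (hℓ ω) (h := 1 / ((N : ℝ) + 1)) (by positivity)
    (t * (N + 1)) x y
  rwa [cast_steps_mul, mul_comm (t : ℝ) L] at this

theorem abs_gameValue_sub_inner_le {C₁ : ℝ} (hf : ∀ a b, ‖f a b‖ ≤ F)
    (hℓ : ∀ ω, IsRegularCost (fun x a b => ℓ x a b ω) L)
    (hC₁ : ∀ ω x, |minimax (fun a b => ℓ x a b ω + inner ℝ (f a b) θ)| ≤ C₁)
    (t N : ℕ) (x : Eucl d) (ω : Ω) :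
    |gameValue f (fun x a b => ℓ x a b ω) (1 / ((N : ℝ) + 1)) θ (t * (N + 1)) x - inner ℝ θ x| ≤
      C₁ * t := by
  have := abs_gameValue_sub_le (θ := θ) hf (hℓ ω) (h := 1 / ((N : ℝ) + 1)) (by positivity)
    (hC₁ ω) 0 (t * (N + 1)) x
  rwa [cast_steps_mul, zero_add, gameValue_zero] at this

theorem IsGameLimit.abs_sub_inner_le {C₁ : ℝ} (hw : IsGameLimit f ℓ θ w)
    (hf : ∀ a b, ‖f a b‖ ≤ F) (hℓ : ∀ ω, IsRegularCost (fun x a b => ℓ x a b ω) L)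
    (hC₁ : ∀ ω x, |minimax (fun a b => ℓ x a b ω + inner ℝ (f a b) θ)| ≤ C₁)
    (t : ℕ) (x : Eucl d) (ω : Ω) : |w t x ω - inner ℝ θ x| ≤ C₁ * t :=
  le_of_tendsto ((hw.tendsto t x ω).sub_const _).abs
    (Filter.Eventually.of_forall fun N => abs_gameValue_sub_inner_le hf hℓ hC₁ t N x ω)

/-- Dynamic programming: running the game for time `t` from the data `w s` or `⟨θ, ·⟩ + c` separates
the results at `0` by no more than the data differ on the ball reachable in time `t`. -/
theorem IsGameLimit.semigroup (hw : IsGameLimit f ℓ θ w) (hf : ∀ a b, ‖f a b‖ ≤ F)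
    (hℓ : ∀ ω, IsRegularCost (fun x a b => ℓ x a b ω) L) (s t : ℕ) (ω : Ω) {c r : ℝ}
    (h : ∀ y, ‖y‖ ≤ F * t → |w s y ω - inner ℝ θ y - c| ≤ r) :
    |w (s + t) 0 ω - w t 0 ω - c| ≤ r := by
  refine le_of_forall_pos_le_add fun κ hκ => ?_
  obtain ⟨N₀, hN₀⟩ := hw ω s (F * t) κ hκ
  refine le_of_tendsto (((hw.tendsto (s + t) 0 ω).sub (hw.tendsto t 0 ω)).sub_const c).abs
    (Filter.eventually_atTop.2 ⟨N₀, fun N hN => ?_⟩)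
  have := abs_gameValue_add_sub_le (θ := θ) hf (hℓ ω) (h := 1 / ((N : ℝ) + 1)) (by positivity)
    (s * (N + 1)) 0 (t * (N + 1)) 0 (s := c) (r := r + κ) fun y hy => by
      rw [sub_zero, cast_steps_mul, mul_comm] at hy
      have h1 := hN₀ N hN y hy
      have h2 := h y hy
      have h3 := abs_add_le (gameValue f (fun x a b => ℓ x a b ω) (1 / ((N : ℝ) + 1)) θ
        (s * (N + 1)) y - w s y ω) (w s y ω - inner ℝ θ y - c)
      rw [gameValue_zero]
      rw [show gameValue f (fun x a b => ℓ x a b ω) (1 / ((N : ℝ) + 1)) θ (s * (N + 1)) y -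
        inner ℝ θ y - c = (gameValue f (fun x a b => ℓ x a b ω) (1 / ((N : ℝ) + 1)) θ
        (s * (N + 1)) y - w s y ω) + (w s y ω - inner ℝ θ y - c) by ring]
      linarith
  rwa [← add_mul, zero_add] at this

end GameLimit

/-! ### Concentration of the limit. -/

section GameLimitConcentration

open ProbabilityTheory

/-- The constant in the Gaussian concentration of the game value. -/
noncomputable def varianceConst (F ρ L δ : ℝ) : ℝ :=
  8 * (F + ρ + 3) * (2 * (2 * (L * (ρ + 1)) * ((ρ + 4 + δ) / δ))) ^ 2

/-- A random field, at integer times, with the Lipschitz, concentration and semigroup properties of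
the value of an oriented game in a random environment with finite range of dependence. -/
structure IsConcentratedValue {d : ℕ} {Ω : Type*} [MeasurableSpace Ω] (μ : Measure Ω) (θ : Eucl d)
    (w : ℕ → Eucl d → Ω → ℝ) (U : ℕ → ℝ) (L F c₀ C₁ : ℝ) : Prop where
  lipschitz : ∀ t x y ω, |w t x ω - w t y ω| ≤ (‖θ‖ + L * t) * ‖x - y‖
  concentration : ∀ (t : ℕ) x r, 0 ≤ r → μ {ω | r ≤ |w t x ω - inner ℝ θ x - U t|} ≤
    ENNReal.ofReal (2 * Real.exp (-r ^ 2 / (c₀ * (t + 1))))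
  semigroup : ∀ (s t : ℕ) ω c r, (∀ y, ‖y‖ ≤ F * t → |w s y ω - inner ℝ θ y - c| ≤ r) →
    |w (s + t) 0 ω - w t 0 ω - c| ≤ r
  mean_le : ∀ t, |U t| ≤ C₁ * t

variable {d m : ℕ} {Ω : Type*} [MeasurableSpace Ω] {μ : Measure Ω} [IsProbabilityMeasure μ]
  [AddAction (Eucl d) Ω] [MeasurableVAdd₂ (Eucl d) Ω] [VAddInvariantMeasure (Eucl d) Ω μ]
  {A B : Set (Eucl m)} {f : A → B → Eucl d} {ℓ : Eucl d → A → B → Ω → ℝ} {F L ρ δ C₁ : ℝ}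
  {θ : Eucl d} {w : ℕ → Eucl d → Ω → ℝ}

/-- The discrete concentration bound is uniform in the time step, so it survives the limit at the
origin; stationarity carries it to every `x`. -/
theorem IsGameLimit.isConcentratedValue (hw : IsGameLimit f ℓ θ w) (hA : IsCompact A)
    (hA' : A.Nonempty) (hB : IsCompact B) (hB' : B.Nonempty) (hf : ∀ a b, ‖f a b‖ ≤ F)
    (hδ : 0 < δ) (hfo : IsOrientedDynamics f δ)
    (hL : 0 < L) (hρ : 0 < ρ) (hℓ : IsStationaryCost ℓ L)
    (hrange : HasFiniteRange μ (fun (i : A × B) x ω => ℓ x i.1 i.2 ω) ρ)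
    (hC₁ : ∀ ω x, |minimax (fun a b => ℓ x a b ω + inner ℝ (f a b) θ)| ≤ C₁) :
    IsConcentratedValue μ θ w (fun t => ∫ ω, w t 0 ω ∂μ) L F (varianceConst F ρ L δ) C₁ := by
  have := hA'.to_subtype
  have := hB'.to_subtype
  have := isCompact_iff_compactSpace.1 hA
  have := isCompact_iff_compactSpace.1 hB
  obtain ⟨hfc, e, he, hfe⟩ := hfo
  have hF0 : 0 ≤ F := by
    obtain ⟨a⟩ := ‹Nonempty A›
    obtain ⟨b⟩ := ‹Nonempty B›
    exact (norm_nonneg _).trans (hf a b)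
  set V : ℕ → ℕ → Ω → ℝ := fun t N ω =>
    gameValue f (fun x a b => ℓ x a b ω) (1 / ((N : ℝ) + 1)) θ (t * (N + 1)) 0 with hV
  have hfe0 : ∀ a b, 0 ≤ inner ℝ (f a b) e := fun a b => hδ.le.trans (hfe a b)
  have hfF : ∀ a b, inner ℝ (f a b) e ≤ F := fun a b => by
    have := real_inner_le_norm (f a b) e
    rw [he, mul_one] at this
    exact this.trans (hf a b)
  have hVm : ∀ t N, Measurable (V t N) := fun t N =>
    measurable_gameValue (e := e) (s₀ := 0) (s₁ := t * F + 1) hfc hf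
      (fun ω => hℓ.isRegularCost ω) (by positivity) (fun ω x => hℓ.continuous ω x) hfe0 hfF hF0
      (fun x a b _ _ => hℓ.measurable_apply x a b) _ 0 (by simp) (by
        rw [cast_steps_mul]; simp)
  have hVb : ∀ t N ω, |V t N ω| ≤ C₁ * t := fun t N ω => by
    have := abs_gameValue_sub_inner_le hf hℓ.isRegularCost hC₁ t N 0 ω
    rwa [inner_zero_right, sub_zero] at this
  have hlim : ∀ t ω, Filter.Tendsto (fun N => V t N ω) Filter.atTop (nhds (w t 0 ω)) := fun t ω =>
    hw.tendsto t 0 ω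
  have hwm : ∀ t, Measurable (w t 0) := fun t =>
    measurable_of_tendsto_metrizable (hVm t) (tendsto_pi_nhds.2 (hlim t))
  have hwb : ∀ t ω, |w t 0 ω| ≤ C₁ * t := fun t ω => by
    have := hw.abs_sub_inner_le hf hℓ.isRegularCost hC₁ t 0 ω
    rwa [inner_zero_right, sub_zero] at this
  have hint : ∀ t, Filter.Tendsto (fun N => ∫ ω, V t N ω ∂μ) Filter.atTop
      (nhds (∫ ω, w t 0 ω ∂μ)) := fun t =>
    tendsto_integral_of_dominated_convergence (fun _ => C₁ * t)
      (fun N => (hVm t N).aestronglyMeasurable) (integrable_const _)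
      (fun N => Filter.Eventually.of_forall (hVb t N)) (Filter.Eventually.of_forall (hlim t))
  have hstat : ∀ t x ω, w t x ω - inner ℝ θ x = w t 0 (x +ᵥ ω) := fun t x ω => by
    have h1 := (hw.tendsto t x ω).sub_const (inner ℝ θ x)
    refine tendsto_nhds_unique h1 ((hlim t (x +ᵥ ω)).congr fun N => ?_)
    have h2 := gameValue_translate (θ := θ) hf (hℓ.isRegularCost ω) (h := 1 / ((N : ℝ) + 1))
      (by positivity) x (t * (N + 1)) 0
    rw [add_zero] at h2
    rw [h2, add_sub_cancel_right]
    simp only [hV]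
    congr 1
    ext y a b
    rw [hℓ.stationary y a b (x +ᵥ ω), hℓ.stationary (x + y) a b ω, vadd_vadd, add_comm]
  have hconc0 : ∀ (t : ℕ) r, 0 ≤ r → μ {ω | r ≤ |w t 0 ω - ∫ ω', w t 0 ω' ∂μ|} ≤
      ENNReal.ofReal (2 * Real.exp (-r ^ 2 / (varianceConst F ρ L δ * (t + 1)))) := by
    intro t r hr
    -- Convergence in measure needs a positive threshold; at `r = 0` the right side is `2`.
    rcases hr.eq_or_lt with rfl | hr0
    · refine prob_le_one.trans ?_
      simp
    set D : ℝ := 2 * (2 * (L * (ρ + 1)) * ((ρ + 4 + δ) / δ)) with hD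
    have hD0 : 0 < D := by positivity
    -- Half of `r` is left for the distance between the discrete value and its limit, whence the `8`
    -- in `varianceConst`.
    have hVc : ∀ N, μ {ω | r / 2 ≤ |V t N ω - ∫ ω', V t N ω' ∂μ|} ≤
        ENNReal.ofReal (2 * Real.exp (-r ^ 2 / (varianceConst F ρ L δ * (t + 1)))) := by
      intro N
      have h1 := measure_abs_gameValue_sub_integral_ge_le (θ := θ) hA hA' hB hB' hfc hf he hδ hfe
        hL hρ hℓ hrange (h := 1 / ((N : ℝ) + 1)) (by positivity) (by
          rw [div_le_one (by positivity)]; linarith [Nat.cast_nonneg (α := ℝ) N])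
        (t * (N + 1)) (hVb t N) (r := r / 2) (by positivity)
      rw [cast_steps_mul] at h1
      have h2 : (⌈(t : ℝ) * F + ρ + 2⌉₊ : ℝ) ≤ (F + ρ + 3) * (t + 1) := by
        have := (Nat.ceil_lt_add_one (a := (t : ℝ) * F + ρ + 2) (by positivity)).le
        have h3 : 0 ≤ (ρ + 3) * (t : ℝ) := by positivity
        linarith
      have h4 : 0 < (⌈(t : ℝ) * F + ρ + 2⌉₊ : ℝ) :=
        lt_of_lt_of_le (by positivity) (Nat.le_ceil ((t : ℝ) * F + ρ + 2))
      refine (ENNReal.le_ofReal_iff_toReal_le (measure_ne_top _ _) (by positivity)).2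
        (h1.trans ?_)
      gcongr 2 * Real.exp ?_
      rw [← hD, neg_div, neg_div, neg_le_neg_iff]
      have h5 : (r / 2) ^ 2 / (2 * (⌈(t : ℝ) * F + ρ + 2⌉₊ * D ^ 2)) =
          r ^ 2 / (8 * ⌈(t : ℝ) * F + ρ + 2⌉₊ * D ^ 2) := by field_simp; ring
      rw [h5, varianceConst, ← hD]
      refine div_le_div_of_nonneg_left (by positivity) (by positivity) ?_
      calc 8 * (⌈(t : ℝ) * F + ρ + 2⌉₊ : ℝ) * D ^ 2 ≤ 8 * ((F + ρ + 3) * (t + 1)) * D ^ 2 := by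
            gcongr
        _ = 8 * (F + ρ + 3) * D ^ 2 * (t + 1) := by ring
    have htm : TendstoInMeasure μ (fun N ω => V t N ω - ∫ ω', V t N ω' ∂μ) Filter.atTop
        (fun ω => w t 0 ω - ∫ ω', w t 0 ω' ∂μ) :=
      tendstoInMeasure_of_tendsto_ae
        (fun N => ((hVm t N).sub_const _).aestronglyMeasurable)
        (Filter.Eventually.of_forall fun ω => (hlim t ω).sub (hint t))
    have hz := (tendstoInMeasure_iff_norm.1 htm) (r / 2) (by positivity)
    have hle : ∀ N, μ {ω | r ≤ |w t 0 ω - ∫ ω', w t 0 ω' ∂μ|} ≤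
        ENNReal.ofReal (2 * Real.exp (-r ^ 2 / (varianceConst F ρ L δ * (t + 1)))) +
        μ {ω | r / 2 ≤ ‖(V t N ω - ∫ ω', V t N ω' ∂μ) - (w t 0 ω - ∫ ω', w t 0 ω' ∂μ)‖} := by
      intro N
      refine le_trans ?_ (add_le_add_left (hVc N) _)
      refine (measure_mono fun ω (hω : r ≤ |w t 0 ω - ∫ ω', w t 0 ω' ∂μ|) => ?_).trans
        (measure_union_le _ _)
      by_contra hcon
      simp only [mem_union, mem_ofPred_eq, not_or, not_le] at hcon
      obtain ⟨h1, h2⟩ := hcon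
      rw [Real.norm_eq_abs, abs_sub_comm] at h2
      have h3 := abs_sub_abs_le_abs_sub (w t 0 ω - ∫ ω', w t 0 ω' ∂μ)
        (V t N ω - ∫ ω', V t N ω' ∂μ)
      linarith
    have := ge_of_tendsto' (tendsto_const_nhds.add hz) hle
    rwa [add_zero] at this
  refine ⟨hw.lipschitz hf hℓ.isRegularCost, fun t x r hr => ?_,
    fun s t ω c r h => hw.semigroup hf hℓ.isRegularCost s t ω h, fun t => ?_⟩
  · have hmp : MeasurePreserving (fun ω : Ω => x +ᵥ ω) μ μ := measurePreserving_vadd x μ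
    simp_rw [hstat t x]
    have hms : MeasurableSet {ω | r ≤ |w t 0 ω - ∫ ω', w t 0 ω' ∂μ|} :=
      measurableSet_le measurable_const (((hwm t).sub_const _).abs)
    have := hmp.measure_preimage hms.nullMeasurableSet
    exact this.le.trans (hconc0 t r hr)
  · have := norm_integral_le_of_norm_le_const (μ := μ) (f := w t 0) (C := C₁ * t)
      (Filter.Eventually.of_forall (hwb t))
    simpa using this

end GameLimitConcentration

/-! ### A grid in the ball. -/

section Grid

/-- A ball of radius `n` in `ℝ^d` is covered by polynomially many balls of radius `d / n`. -/
theorem exists_finset_grid (d n : ℕ) (hn : 2 ≤ n) :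
    ∃ P : Finset (Eucl d), P.card ≤ n ^ (4 * d) ∧
      ∀ y : Eucl d, ‖y‖ ≤ n → ∃ z ∈ P, ‖y - z‖ ≤ d / n := by
  classical
  have hn0 : (0 : ℝ) < n := by positivity
  let g : (Fin d → ℤ) → Eucl d := fun k => WithLp.toLp 2 fun i => (k i : ℝ) / n
  -- Multiples of `1 / n` in the cube of half-side `n`; the count uses `2 n² + 1 ≤ n⁴` for `n ≥ 2`.
  refine ⟨(Fintype.piFinset fun _ => Finset.Icc (-(n ^ 2 : ℤ)) (n ^ 2)).image g, ?_, fun y hy => ?_⟩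
  · refine Finset.card_image_le.trans ?_
    rw [Fintype.card_piFinset_const, Int.card_Icc, pow_mul]
    refine Nat.pow_le_pow_left ?_ d
    have h1 : ((n : ℤ) ^ 2 + 1 - -(n : ℤ) ^ 2).toNat = 2 * n ^ 2 + 1 := by
      have : ((n : ℤ) ^ 2 + 1 - -(n : ℤ) ^ 2) = ((2 * n ^ 2 + 1 : ℕ) : ℤ) := by push_cast; ring
      rw [this, Int.toNat_natCast]
    rw [h1]
    nlinarith [Nat.pow_le_pow_left hn 2]
  · refine ⟨g fun i => ⌊y i * n⌋, Finset.mem_image_of_mem _ ?_, ?_⟩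
    · rw [Fintype.mem_piFinset]
      intro i
      have h1 : |y i| ≤ n := (PiLp.norm_apply_le y i).trans hy
      obtain ⟨h2, h3⟩ := abs_le.1 h1
      rw [Finset.mem_Icc]
      constructor
      · rw [Int.le_floor]; push_cast; nlinarith
      · have h4 : ((⌊y i * n⌋ : ℤ) : ℝ) ≤ ((n ^ 2 : ℤ) : ℝ) := by
          push_cast
          exact (Int.floor_le _).trans (by nlinarith)
        exact_mod_cast h4
    · set v := y - g fun i => ⌊y i * n⌋ with hv
      have hvi : ∀ i, |v i| ≤ 1 / n := fun i => by
        have e1 : v i = (y i * n - ⌊y i * n⌋) / n := by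
          simp only [hv, g, PiLp.sub_apply]
          field_simp
        rw [e1, abs_div, abs_of_pos hn0]
        gcongr
        rw [abs_le]
        constructor <;> linarith [Int.floor_le (y i * n), Int.lt_floor_add_one (y i * n)]
      rw [EuclideanSpace.norm_eq]
      refine Real.sqrt_le_iff.2 ⟨by positivity, ?_⟩
      calc ∑ i, ‖v i‖ ^ 2 ≤ ∑ _i : Fin d, (1 / (n : ℝ)) ^ 2 := by
            gcongr with i
            exact hvi i
        _ = d * (1 / (n : ℝ)) ^ 2 := by simp
        _ ≤ (d / n) ^ 2 := by
            rw [div_pow, div_pow, one_pow, mul_one_div]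
            gcongr
            rcases Nat.eq_zero_or_pos d with rfl | hd
            · simp
            · have : (1 : ℝ) ≤ d := by exact_mod_cast hd
              nlinarith

end Grid

/-! ### The rate `√(n log n)` and nearly additive sequences. -/

section RateFunction

/-- The order of magnitude `√(n log n)` of the fluctuations at time `n`. -/
noncomputable def rateFn (n : ℕ) : ℝ := Real.sqrt (n * Real.log n)

theorem rateFn_nonneg (n : ℕ) : 0 ≤ rateFn n := Real.sqrt_nonneg _

theorem one_le_mul_log {n : ℕ} (hn : 2 ≤ n) : 1 ≤ (n : ℝ) * Real.log n := by
  have h1 : (2 : ℝ) ≤ n := by exact_mod_cast hn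
  have h2 : Real.log 2 ≤ Real.log n := Real.log_le_log (by norm_num) h1
  nlinarith [Real.log_two_gt_d9]

theorem one_le_rateFn {n : ℕ} (hn : 2 ≤ n) : 1 ≤ rateFn n :=
  Real.one_le_sqrt.2 (one_le_mul_log hn)

theorem rateFn_sq {n : ℕ} (hn : 2 ≤ n) : rateFn n ^ 2 = n * Real.log n :=
  Real.sq_sqrt (by linarith [one_le_mul_log hn])

theorem rateFn_mono {m n : ℕ} (hm : 1 ≤ m) (h : m ≤ n) : rateFn m ≤ rateFn n := by
  have h1 : (1 : ℝ) ≤ m := by exact_mod_cast hm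
  have h2 : (m : ℝ) ≤ n := by exact_mod_cast h
  have h3 := Real.log_nonneg h1
  have h4 := Real.log_le_log (by linarith) h2
  unfold rateFn
  gcongr

theorem one_le_log {m : ℕ} (hm : 4 ≤ m) : 1 ≤ Real.log m := by
  have h1 : (4 : ℝ) ≤ m := by exact_mod_cast hm
  have h2 : Real.log 4 ≤ Real.log m := Real.log_le_log (by norm_num) h1
  have h3 : Real.log 4 = 2 * Real.log 2 := by
    rw [show (4 : ℝ) = 2 ^ 2 by norm_num, Real.log_pow]; norm_num
  linarith [Real.log_two_gt_d9]

/-- For `m ≥ 4`, `log 2` is at most half of `log m`, so the square grows by a factor at most `3 < (7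
/ 4)²`. What matters is `7 / 4 < 2`. -/
theorem rateFn_two_mul_le {m : ℕ} (hm : 4 ≤ m) : rateFn (2 * m) ≤ 7 / 4 * rateFn m := by
  have h1 : (4 : ℝ) ≤ m := by exact_mod_cast hm
  have h2 : 2 * Real.log 2 ≤ Real.log m := by
    have h3 : Real.log 4 = 2 * Real.log 2 := by
      rw [show (4 : ℝ) = 2 ^ 2 by norm_num, Real.log_pow]; norm_num
    rw [← h3]
    exact Real.log_le_log (by norm_num) h1
  refine Real.sqrt_le_iff.2 ⟨by have := rateFn_nonneg m; positivity, ?_⟩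
  rw [mul_pow, rateFn_sq (by omega)]
  push_cast
  rw [Real.log_mul (by norm_num) (by positivity)]
  have h3 := mul_le_mul_of_nonneg_left h2 (by linarith : (0 : ℝ) ≤ m)
  have h4 := one_le_mul_log (n := m) (by omega)
  linarith

theorem rateFn_two_pow_mul_le {m : ℕ} (hm : 4 ≤ m) (k : ℕ) :
    rateFn (2 ^ k * m) ≤ (7 / 4) ^ k * rateFn m := by
  induction k with
  | zero => simp
  | succ k ih =>
    have h1 : 4 ≤ 2 ^ k * m := by nlinarith [Nat.one_le_two_pow (n := k)]
    have h2 := rateFn_two_mul_le h1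
    rw [← mul_assoc, ← pow_succ'] at h2
    refine h2.trans ?_
    rw [pow_succ']
    linarith

theorem rateFn_mul_le {m k : ℕ} (hm : 4 ≤ m) (hk : 1 ≤ k) :
    rateFn (m * k) ≤ Real.sqrt (k * (1 + Real.log k)) * rateFn m := by
  have h1 := one_le_log hm
  have h2 : (1 : ℝ) ≤ k := by exact_mod_cast hk
  have h3 := Real.log_nonneg h2
  have h4 : (4 : ℝ) ≤ m := by exact_mod_cast hm
  rw [rateFn, rateFn, ← Real.sqrt_mul (by positivity)]
  apply Real.sqrt_le_sqrt
  push_cast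
  rw [Real.log_mul (by positivity) (by positivity)]
  have h5 : Real.log m + Real.log k ≤ (1 + Real.log k) * Real.log m := by nlinarith
  calc (m : ℝ) * k * (Real.log m + Real.log k) ≤ m * k * ((1 + Real.log k) * Real.log m) := by
        gcongr
    _ = _ := by ring

/-- A sequence which is additive up to `√(n log n)` is linear up to `√(n log n)`. -/
theorem exists_linear_of_nearly_additive {U : ℕ → ℝ} {C : ℝ}
    (hU : ∀ s t, 4 ≤ s + t → |U (s + t) - U s - U t| ≤ C * rateFn (s + t)) :
    ∃ γ, Filter.Tendsto (fun k : ℕ => U (2 ^ k) / 2 ^ k) Filter.atTop (nhds γ) ∧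
      ∀ m, 4 ≤ m → |U m - m * γ| ≤ 8 * C * rateFn m := by
  have hC : 0 ≤ C := by
    have h1 := (abs_nonneg _).trans (hU 0 4 (by norm_num))
    have h2 := one_le_rateFn (n := 0 + 4) (by norm_num)
    exact nonneg_of_mul_nonneg_left h1 (by linarith)
  have h4 : ∀ m k : ℕ, 4 ≤ m → 4 ≤ 2 ^ k * m := fun m k hm => by
    nlinarith [Nat.one_le_two_pow (n := k)]
  -- Doubling multiplies the error by `7 / 4` and the normalization by `2`; the sum of the ratio `7
  -- / 8` is the `8` of the conclusion.
  have hstep : ∀ m, 4 ≤ m → ∀ k : ℕ,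
      dist (U (2 ^ k * m) / 2 ^ k) (U (2 ^ (k + 1) * m) / 2 ^ (k + 1)) ≤
        C * rateFn m * (7 / 8) ^ k := by
    intro m hm k
    have h1 := hU (2 ^ k * m) (2 ^ k * m) (by have := h4 m k hm; omega)
    rw [← two_mul, ← mul_assoc, ← pow_succ'] at h1
    have h2 := rateFn_two_pow_mul_le hm (k + 1)
    rw [dist_comm, Real.dist_eq]
    have e1 : U (2 ^ (k + 1) * m) / 2 ^ (k + 1) - U (2 ^ k * m) / 2 ^ k =
        (U (2 ^ (k + 1) * m) - U (2 ^ k * m) - U (2 ^ k * m)) / 2 ^ (k + 1) := by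
      rw [pow_succ]; field_simp; ring
    rw [e1, abs_div, abs_of_pos (show (0 : ℝ) < 2 ^ (k + 1) by positivity),
      div_le_iff₀ (by positivity)]
    calc |U (2 ^ (k + 1) * m) - U (2 ^ k * m) - U (2 ^ k * m)|
        ≤ C * ((7 / 4) ^ (k + 1) * rateFn m) := h1.trans (mul_le_mul_of_nonneg_left h2 hC)
      _ = C * rateFn m * (7 / 8) ^ (k + 1) * 2 ^ (k + 1) := by
          rw [show (7 / 4 : ℝ) = 7 / 8 * 2 by norm_num, mul_pow]; ring
      _ ≤ C * rateFn m * (7 / 8) ^ k * 2 ^ (k + 1) := by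
          have := rateFn_nonneg m
          gcongr ?_ * ?_ * 2 ^ (k + 1)
          exact pow_le_pow_of_le_one (by norm_num) (by norm_num) (Nat.le_succ k)
  have hlim : ∀ m, 4 ≤ m → ∃ g, Filter.Tendsto (fun k : ℕ => U (2 ^ k * m) / 2 ^ k)
      Filter.atTop (nhds g) := fun m hm =>
    cauchySeq_tendsto_of_complete (cauchySeq_of_le_geometric _ _ (by norm_num) (hstep m hm))
  choose! G hG using hlim
  have hdist : ∀ m, 4 ≤ m → |U m - G m| ≤ 8 * C * rateFn m := fun m hm => by
    have := dist_le_of_le_geometric_of_tendsto₀ _ _ (by norm_num) (hstep m hm) (hG m hm)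
    rw [Real.dist_eq] at this
    simp only [pow_zero, one_mul, div_one] at this
    refine this.trans (le_of_eq ?_)
    ring
  -- The additivity defect at scale `2 ^ k` is of order `(7 / 4) ^ k` and vanishes after division by
  -- `2 ^ k`.
  have hadd : ∀ s t, 4 ≤ s → 4 ≤ t → G (s + t) = G s + G t := by
    intro s t hs ht
    have h1 := ((hG (s + t) (by omega)).sub (hG s hs)).sub (hG t ht)
    have h2 : Filter.Tendsto (fun k : ℕ => U (2 ^ k * (s + t)) / 2 ^ k - U (2 ^ k * s) / 2 ^ k -
        U (2 ^ k * t) / 2 ^ k) Filter.atTop (nhds 0) := by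
      have h3 : Filter.Tendsto (fun k : ℕ => C * rateFn (s + t) * (7 / 8) ^ k) Filter.atTop
          (nhds 0) := by
        have := (tendsto_pow_atTop_nhds_zero_of_lt_one (r := (7 / 8 : ℝ)) (by norm_num)
          (by norm_num)).const_mul (C * rateFn (s + t))
        rwa [mul_zero] at this
      refine squeeze_zero_norm (fun k => ?_) h3
      have h5 := hU (2 ^ k * s) (2 ^ k * t) (by have := h4 s k hs; omega)
      rw [← mul_add] at h5
      have h6 := rateFn_two_pow_mul_le (m := s + t) (by omega) k
      have e1 : U (2 ^ k * (s + t)) / 2 ^ k - U (2 ^ k * s) / 2 ^ k - U (2 ^ k * t) / 2 ^ k =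
          (U (2 ^ k * (s + t)) - U (2 ^ k * s) - U (2 ^ k * t)) / 2 ^ k := by ring
      rw [e1, Real.norm_eq_abs, abs_div, abs_of_pos (show (0 : ℝ) < 2 ^ k by positivity),
        div_le_iff₀ (by positivity)]
      calc _ ≤ C * ((7 / 4) ^ k * rateFn (s + t)) := h5.trans (mul_le_mul_of_nonneg_left h6 hC)
        _ = C * rateFn (s + t) * (7 / 8) ^ k * 2 ^ k := by
          rw [show (7 / 4 : ℝ) = 7 / 8 * 2 by norm_num, mul_pow]; ring
    linarith [tendsto_nhds_unique h1 h2]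
  have hmul : ∀ m, 1 ≤ m → G (m * 4) = m * G 4 := by
    intro m hm
    induction m, hm using Nat.le_induction with
    | base => simp
    | succ m hm ih =>
      rw [add_mul, one_mul, hadd _ _ (by omega) le_rfl, ih]
      push_cast; ring
  -- Computing `G (m * 4)` by additivity and by dyadic scaling gives `m * G 4 = 4 * G m`, hence
  -- linearity.
  have hquad : ∀ m, 4 ≤ m → G (m * 4) = 4 * G m := by
    intro m hm
    have h1 := (hG m hm).comp (Filter.tendsto_add_atTop_nat 2)
    have h2 := h1.const_mul 4
    refine tendsto_nhds_unique (hG (m * 4) (by omega)) (h2.congr fun k => ?_)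
    simp only [Function.comp]
    rw [show 2 ^ (k + 2) * m = 2 ^ k * (m * 4) by ring, pow_add]
    field_simp
    ring
  refine ⟨G 4 / 4, ?_, fun m hm => ?_⟩
  · have h1 := (hG 4 le_rfl).div_const 4
    rw [← Filter.tendsto_add_atTop_iff_nat 2]
    refine h1.congr fun k => ?_
    rw [show 2 ^ (k + 2) = 2 ^ k * 4 by ring, div_div]
    norm_num [pow_add]
  · have h1 : (m : ℝ) * (G 4 / 4) = G m := by
      have := hmul m (by omega)
      rw [hquad m hm] at this
      linarith
    rw [h1]
    exact hdist m hm

end RateFunction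

/-! ### Uniform concentration and linearity of the mean. -/

section NearAdditivity

variable {d : ℕ} {Ω : Type*} [MeasurableSpace Ω] {μ : Measure Ω}
  {θ : Eucl d} {w : ℕ → Eucl d → Ω → ℝ} {U : ℕ → ℝ} {L F c₀ C₁ : ℝ}

/-- The constant in the uniform concentration on balls. -/
noncomputable def ballConst (d : ℕ) (Θ L c₀ : ℝ) : ℝ :=
  Real.sqrt (2 * c₀ * (4 * d + 5)) + (2 * Θ + L) * d

/-- Union bound over at most `n ^ (4 * d)` grid points, each failing with probability at most `2 n ^
(-(4 d + 5))`. Off the grid the field moves by `O(1)`, its Lipschitz constant being `O(n)`. The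
spare power `5` pays for the later sum over times. -/
theorem IsConcentratedValue.measure_exists_ball_le (hw : IsConcentratedValue μ θ w U L F c₀ C₁)
    (hL : 0 ≤ L) (hc₀ : 0 < c₀) {n t : ℕ} (hn : 2 ≤ n) (ht : t ≤ n) :
    μ {ω | ∃ y, ‖y‖ ≤ n ∧ ballConst d ‖θ‖ L c₀ * rateFn n < |w t y ω - inner ℝ θ y - U t|} ≤
      ENNReal.ofReal (2 * ((n : ℝ) ^ 5)⁻¹) := by
  obtain ⟨P, hPc, hP⟩ := exists_finset_grid d n hn
  have hn0 : (0 : ℝ) < n := by positivity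
  have hn1 : (1 : ℝ) ≤ n := by exact_mod_cast (by omega : 1 ≤ n)
  have htn : (t : ℝ) ≤ n := by exact_mod_cast ht
  set lam : ℝ := Real.sqrt (2 * c₀ * (4 * d + 5)) * rateFn n with hlam
  have hlam0 : 0 ≤ lam := mul_nonneg (Real.sqrt_nonneg _) (rateFn_nonneg n)
  have hlogn : 0 ≤ Real.log n := Real.log_nonneg hn1
  have hexp : Real.exp (-lam ^ 2 / (c₀ * (t + 1))) ≤ ((n : ℝ) ^ (4 * d + 5))⁻¹ := by
    have h1 : lam ^ 2 = 2 * c₀ * (4 * d + 5) * (n * Real.log n) := by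
      rw [hlam, mul_pow, Real.sq_sqrt (by positivity), rateFn_sq hn]
    have h2 : (4 * d + 5) * Real.log n ≤ lam ^ 2 / (c₀ * (t + 1)) := by
      rw [h1, le_div_iff₀ (by positivity)]
      calc (4 * d + 5) * Real.log n * (c₀ * (t + 1)) ≤ (4 * d + 5) * Real.log n * (c₀ * (2 * n)) := by
            gcongr; linarith
        _ = _ := by ring
    have h3 : ((n : ℝ) ^ (4 * d + 5))⁻¹ = Real.exp (-((4 * d + 5) * Real.log n)) := by
      rw [Real.exp_neg, ← Real.exp_log (pow_pos hn0 (4 * d + 5)), Real.log_pow]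
      push_cast; rfl
    rw [h3, Real.exp_le_exp, neg_div]
    linarith
  have hsub : {ω | ∃ y, ‖y‖ ≤ n ∧
      ballConst d ‖θ‖ L c₀ * rateFn n < |w t y ω - inner ℝ θ y - U t|} ⊆
      ⋃ z ∈ P, {ω | lam ≤ |w t z ω - inner ℝ θ z - U t|} := by
    rintro ω ⟨y, hy, hlt⟩
    obtain ⟨z, hz, hyz⟩ := hP y hy
    refine mem_biUnion hz ?_
    show lam ≤ |w t z ω - inner ℝ θ z - U t|
    have h1 := hw.lipschitz t y z ω
    have h2 : |inner ℝ θ y - inner ℝ θ z| ≤ ‖θ‖ * ‖y - z‖ := by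
      rw [← inner_sub_right]; exact abs_real_inner_le_norm _ _
    have h3 : (2 * ‖θ‖ + L * t) * ‖y - z‖ ≤ (2 * ‖θ‖ + L) * d := by
      calc (2 * ‖θ‖ + L * t) * ‖y - z‖ ≤ (2 * ‖θ‖ * n + L * n) * (d / n) := by
            have h3 : 2 * ‖θ‖ ≤ 2 * ‖θ‖ * n := le_mul_of_one_le_right (by positivity) hn1
            have h4 : L * t ≤ L * n := mul_le_mul_of_nonneg_left htn hL
            exact mul_le_mul (add_le_add h3 h4) hyz (norm_nonneg _) (by positivity)
        _ = (2 * ‖θ‖ + L) * d := by field_simp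
    have h4 : (2 * ‖θ‖ + L) * d ≤ (2 * ‖θ‖ + L) * d * rateFn n :=
      le_mul_of_one_le_right (by positivity) (one_le_rateFn hn)
    have h5 : |w t y ω - inner ℝ θ y - U t| ≤ |w t z ω - inner ℝ θ z - U t| +
        (|w t y ω - w t z ω| + |inner ℝ θ y - inner ℝ θ z|) := by
      have e1 : w t y ω - inner ℝ θ y - U t = (w t z ω - inner ℝ θ z - U t) +
        ((w t y ω - w t z ω) - (inner ℝ θ y - inner ℝ θ z)) := by ring
      rw [e1]
      exact (abs_add_le _ _).trans (by gcongr; exact abs_sub _ _)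
    rw [ballConst, add_mul] at hlt
    linarith
  calc μ _ ≤ μ (⋃ z ∈ P, {ω | lam ≤ |w t z ω - inner ℝ θ z - U t|}) := measure_mono hsub
    _ ≤ ∑ z ∈ P, μ {ω | lam ≤ |w t z ω - inner ℝ θ z - U t|} := measure_biUnion_finset_le _ _
    _ ≤ ∑ z ∈ P, ENNReal.ofReal (2 * ((n : ℝ) ^ (4 * d + 5))⁻¹) := by
        gcongr with z hz
        exact (hw.concentration t z lam hlam0).trans (ENNReal.ofReal_le_ofReal (by linarith))
    _ = ENNReal.ofReal (P.card * (2 * ((n : ℝ) ^ (4 * d + 5))⁻¹)) := by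
        rw [Finset.sum_const, nsmul_eq_mul, ENNReal.ofReal_mul (p := (P.card : ℝ)) (by positivity),
          ENNReal.ofReal_natCast]
    _ ≤ ENNReal.ofReal (2 * ((n : ℝ) ^ 5)⁻¹) := by
        refine ENNReal.ofReal_le_ofReal ?_
        have h1 : (P.card : ℝ) ≤ (n : ℝ) ^ (4 * d) := by exact_mod_cast hPc
        calc (P.card : ℝ) * (2 * ((n : ℝ) ^ (4 * d + 5))⁻¹)
            ≤ (n : ℝ) ^ (4 * d) * (2 * ((n : ℝ) ^ (4 * d + 5))⁻¹) := by gcongr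
          _ = 2 * ((n : ℝ) ^ 5)⁻¹ := by rw [pow_add]; field_simp

/-- The claim is deterministic, so one sample outside three bad events of total probability below
`1` suffices: there the values of `w` stand in for the means and the semigroup property compares
them. -/
theorem IsConcentratedValue.abs_mean_add_sub_le [IsProbabilityMeasure μ]
    (hw : IsConcentratedValue μ θ w U L F c₀ C₁) (hL : 0 ≤ L) (hc₀ : 0 < c₀) {n s t : ℕ}
    (hn : 2 ≤ n) (hst : s + t ≤ n) (hF : F * t ≤ n) :
    |U (s + t) - U s - U t| ≤ 3 * (ballConst d ‖θ‖ L c₀ * rateFn n) := by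
  set C := ballConst d ‖θ‖ L c₀ * rateFn n with hC
  set bad : ℕ → Set Ω := fun k => {ω | ∃ y, ‖y‖ ≤ n ∧ C < |w k y ω - inner ℝ θ y - U k|} with hbad
  have hb : ∀ k ≤ n, μ (bad k) ≤ ENNReal.ofReal (1 / 16) := fun k hk => by
    refine (hw.measure_exists_ball_le hL hc₀ hn hk).trans (ENNReal.ofReal_le_ofReal ?_)
    have h1 : (2 : ℝ) ^ 5 ≤ (n : ℝ) ^ 5 := by
      gcongr; exact_mod_cast hn
    rw [← div_eq_mul_inv, div_le_iff₀ (by positivity)]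
    linarith
  have hlt : μ (bad (s + t) ∪ bad t ∪ bad s) < 1 := by
    calc μ (bad (s + t) ∪ bad t ∪ bad s) ≤ μ (bad (s + t)) + μ (bad t) + μ (bad s) :=
          (measure_union_le _ _).trans (add_le_add_left (measure_union_le _ _) _)
      _ ≤ ENNReal.ofReal (1 / 16) + ENNReal.ofReal (1 / 16) + ENNReal.ofReal (1 / 16) :=
          add_le_add (add_le_add (hb _ hst) (hb _ (by omega))) (hb _ (by omega))
      _ = ENNReal.ofReal (3 / 16) := by
          rw [← ENNReal.ofReal_add (by norm_num) (by norm_num),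
            ← ENNReal.ofReal_add (by norm_num) (by norm_num)]
          norm_num
      _ < 1 := by
          rw [← ENNReal.ofReal_one, ENNReal.ofReal_lt_ofReal_iff one_pos]; norm_num
  obtain ⟨ω, hω⟩ : ∃ ω, ω ∉ bad (s + t) ∪ bad t ∪ bad s := by
    by_contra! hall
    rw [eq_univ_of_forall hall, measure_univ] at hlt
    exact lt_irrefl _ hlt
  simp only [hbad, mem_union, not_or, mem_ofPred_eq, not_exists, not_and, not_lt] at hω
  obtain ⟨⟨h1, h2⟩, h3⟩ := hω
  have e1 := h1 0 (by simp)
  have e2 := h2 0 (by simp)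
  rw [inner_zero_right, sub_zero] at e1 e2
  have e3 := hw.semigroup s t ω (U s) C fun y hy => h3 y (hy.trans hF)
  have e4 : U (s + t) - U s - U t = -(w (s + t) 0 ω - U (s + t)) + (w t 0 ω - U t) +
      (w (s + t) 0 ω - w t 0 ω - U s) := by ring
  rw [e4]
  refine (abs_add_le _ _).trans ?_
  have e5 := abs_add_le (-(w (s + t) 0 ω - U (s + t))) (w t 0 ω - U t)
  rw [abs_neg] at e5
  linarith

/-- The constant in the approximate additivity of the mean. -/
noncomputable def additivityConst (d : ℕ) (Θ L c₀ F : ℝ) : ℝ :=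
  3 * ballConst d Θ L c₀ *
    Real.sqrt ((⌈F⌉₊ + 1 : ℕ) * (1 + Real.log (⌈F⌉₊ + 1 : ℕ)))

theorem ballConst_nonneg {Θ : ℝ} (hΘ : 0 ≤ Θ) (hL : 0 ≤ L) : 0 ≤ ballConst d Θ L c₀ := by
  unfold ballConst; positivity

theorem IsConcentratedValue.exists_rate [IsProbabilityMeasure μ]
    (hw : IsConcentratedValue μ θ w U L F c₀ C₁) (hL : 0 ≤ L) (hc₀ : 0 < c₀) :
    ∃ γ, Filter.Tendsto (fun k : ℕ => U (2 ^ k) / 2 ^ k) Filter.atTop (nhds γ) ∧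
      ∀ m, 4 ≤ m → |U m - m * γ| ≤ 8 * additivityConst d ‖θ‖ L c₀ F * rateFn m := by
  refine exists_linear_of_nearly_additive fun s t hst => ?_
  -- The factor `⌈F⌉₊ + 1` makes the controlled ball contain the one reached in time `t`; it only
  -- changes the constant.
  have h1 : s + t ≤ (s + t) * (⌈F⌉₊ + 1) := Nat.le_mul_of_pos_right _ (by omega)
  have h2 : F * t ≤ ((s + t) * (⌈F⌉₊ + 1) : ℕ) := by
    have h3 := Nat.le_ceil F
    have h4 : (0 : ℝ) ≤ s := Nat.cast_nonneg s
    have h5 : (0 : ℝ) ≤ t := Nat.cast_nonneg t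
    have h6 : (0 : ℝ) ≤ ⌈F⌉₊ := Nat.cast_nonneg _
    push_cast
    nlinarith [mul_nonneg h4 h6]
  refine (hw.abs_mean_add_sub_le hL hc₀ (by omega) h1 h2).trans ?_
  have h7 := rateFn_mul_le hst (show 1 ≤ ⌈F⌉₊ + 1 by omega)
  have h8 := ballConst_nonneg (d := d) (c₀ := c₀) (norm_nonneg θ) hL
  rw [additivityConst]
  calc 3 * (ballConst d ‖θ‖ L c₀ * rateFn ((s + t) * (⌈F⌉₊ + 1)))
      ≤ 3 * (ballConst d ‖θ‖ L c₀ * (Real.sqrt ((⌈F⌉₊ + 1 : ℕ) *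
        (1 + Real.log (⌈F⌉₊ + 1 : ℕ))) * rateFn (s + t))) := by gcongr
    _ = _ := by ring

/-- The constant in the uniform rate of convergence. -/
noncomputable def rateConst (d : ℕ) (Θ L c₀ F C₁ : ℝ) : ℝ :=
  ballConst d Θ L c₀ + 8 * additivityConst d Θ L c₀ F + 8 * C₁

theorem IsConcentratedValue.measure_exists_rate_le [IsProbabilityMeasure μ]
    (hw : IsConcentratedValue μ θ w U L F c₀ C₁) (hL : 0 ≤ L) (hc₀ : 0 < c₀) {γ : ℝ}
    (hγ : Filter.Tendsto (fun k : ℕ => U (2 ^ k) / 2 ^ k) Filter.atTop (nhds γ)) {n : ℕ}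
    (hn : 4 ≤ n) :
    |γ| ≤ C₁ ∧ μ {ω | ∃ t : ℕ, t ≤ n ∧ ∃ y, ‖y‖ ≤ n ∧
      rateConst d ‖θ‖ L c₀ F C₁ * rateFn n < |w t y ω - inner ℝ θ y - t * γ|} ≤
      ENNReal.ofReal (((n : ℝ) ^ 2)⁻¹) := by
  have hγC : |γ| ≤ C₁ := by
    refine le_of_tendsto hγ.abs (Filter.Eventually.of_forall fun k => ?_)
    have := hw.mean_le (2 ^ k)
    push_cast at this
    rw [abs_div, abs_of_pos (show (0 : ℝ) < 2 ^ k by positivity), div_le_iff₀ (by positivity)]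
    exact this
  refine ⟨hγC, ?_⟩
  have hC₁ : 0 ≤ C₁ := (abs_nonneg _).trans hγC
  obtain ⟨γ', hγ', hrate⟩ := hw.exists_rate hL hc₀
  obtain rfl := tendsto_nhds_unique hγ hγ'
  have hadd : 0 ≤ additivityConst d ‖θ‖ L c₀ F := by
    have := ballConst_nonneg (d := d) (c₀ := c₀) (norm_nonneg θ) hL
    unfold additivityConst
    positivity
  have hrn := rateFn_nonneg n
  have hrn1 := one_le_rateFn (n := n) (by omega)
  have hmean : ∀ t ≤ n, |U t - t * γ| ≤
      (8 * additivityConst d ‖θ‖ L c₀ F + 8 * C₁) * rateFn n := by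
    intro t ht
    -- The linear approximation starts at `t = 4`; before that each of the two terms is at most `4 *
    -- C₁`.
    rcases lt_or_ge t 4 with h | h
    · have h1 : (t : ℝ) ≤ 4 := by exact_mod_cast h.le
      have h2 := hw.mean_le t
      have h3 : |t * γ| ≤ C₁ * t := by
        rw [abs_mul, abs_of_nonneg (Nat.cast_nonneg t), mul_comm]
        gcongr
      have h4 : C₁ * t ≤ C₁ * 4 := by gcongr
      have h5 := abs_sub (U t) (t * γ)
      have h6 : 8 * C₁ ≤ 8 * C₁ * rateFn n := le_mul_of_one_le_right (by positivity) hrn1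
      have h7 : 0 ≤ 8 * additivityConst d ‖θ‖ L c₀ F * rateFn n := by positivity
      linarith
    · refine (hrate t h).trans ?_
      have h1 := rateFn_mono (by omega : 1 ≤ t) ht
      exact mul_le_mul (by linarith) h1 (rateFn_nonneg t) (by positivity)
  have hsub : {ω | ∃ t : ℕ, t ≤ n ∧ ∃ y, ‖y‖ ≤ n ∧
      rateConst d ‖θ‖ L c₀ F C₁ * rateFn n < |w t y ω - inner ℝ θ y - t * γ|} ⊆
      ⋃ t ∈ Finset.range (n + 1), {ω | ∃ y, ‖y‖ ≤ n ∧
        ballConst d ‖θ‖ L c₀ * rateFn n < |w t y ω - inner ℝ θ y - U t|} := by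
    rintro ω ⟨t, ht, y, hy, hlt⟩
    refine mem_biUnion (Finset.mem_coe.2 (Finset.mem_range.2 (Nat.lt_succ_of_le ht)))
      ⟨y, hy, ?_⟩
    have h1 := hmean t ht
    have h2 := abs_add_le (w t y ω - inner ℝ θ y - U t) (U t - t * γ)
    rw [sub_add_sub_cancel] at h2
    rw [rateConst] at hlt
    linarith
  calc μ _ ≤ _ := measure_mono hsub
    _ ≤ ∑ t ∈ Finset.range (n + 1), μ {ω | ∃ y, ‖y‖ ≤ n ∧
        ballConst d ‖θ‖ L c₀ * rateFn n < |w t y ω - inner ℝ θ y - U t|} :=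
        measure_biUnion_finset_le _ _
    _ ≤ ∑ _t ∈ Finset.range (n + 1), ENNReal.ofReal (2 * ((n : ℝ) ^ 5)⁻¹) := by
        gcongr with t ht
        exact hw.measure_exists_ball_le hL hc₀ (by omega) (Nat.lt_succ_iff.1 (Finset.mem_range.1 ht))
    _ = ENNReal.ofReal ((n + 1 : ℕ) * (2 * ((n : ℝ) ^ 5)⁻¹)) := by
        rw [Finset.sum_const, nsmul_eq_mul,
          ENNReal.ofReal_mul (p := ((n + 1 : ℕ) : ℝ)) (by positivity),
          ENNReal.ofReal_natCast, Finset.card_range]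
    _ ≤ ENNReal.ofReal (((n : ℝ) ^ 2)⁻¹) := by
        refine ENNReal.ofReal_le_ofReal ?_
        have h4 : (4 : ℝ) ≤ n := by exact_mod_cast hn
        have h5 : (n : ℝ) ^ 5 = n ^ 2 * n ^ 3 := by ring
        have h6 : 2 * ((n : ℝ) + 1) ≤ n ^ 3 := by nlinarith [sq_nonneg ((n : ℝ) - 4)]
        rw [h5, mul_inv]
        push_cast
        calc ((n : ℝ) + 1) * (2 * (((n : ℝ) ^ 2)⁻¹ * ((n : ℝ) ^ 3)⁻¹))
            = ((n : ℝ) ^ 2)⁻¹ * (2 * ((n : ℝ) + 1) * ((n : ℝ) ^ 3)⁻¹) := by ring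
          _ ≤ ((n : ℝ) ^ 2)⁻¹ * 1 := by
              gcongr
              rw [← div_eq_mul_inv, div_le_one (by positivity)]
              exact h6
          _ = _ := mul_one _

end NearAdditivity

/-! ### Time regularity of solutions. -/

section TimeRegularity

variable {d : ℕ} {A B : Type*} [Nonempty A] [Nonempty B]

/-- Inherited from the discrete values, whose time Lipschitz bound does not depend on the step. -/
theorem abs_solution_sub_le {f : A → B → Eucl d} {c : Eucl d → A → B → ℝ}
    {F L β β' C₁ : ℝ} {θ : Eucl d} {H : Eucl d → Eucl d → ℝ} {u : ℝ → Eucl d → ℝ}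
    (hf : ∀ a b, ‖f a b‖ ≤ F) (hc : IsRegularCost c L) (hL : 0 ≤ L) (hβ : 0 < β) (hβ' : 0 ≤ β')
    (hH : ∀ x p, H x p = -minimax fun a b => c x a b + inner ℝ (f a b) p)
    (hHp : ∀ x p q, |H x p - H x q| ≤ β * ‖p - q‖)
    (hHx : ∀ x y p, |H x p - H y p| ≤ β' * ‖x - y‖) (hC₁ : ∀ x, |H x θ| ≤ C₁)
    (hu : IsCauchySolution H (fun x => inner ℝ θ x) u) {s t : ℝ} (hs : 0 ≤ s) (hst : s ≤ t)
    (x : Eucl d) : |u t x - u s x| ≤ C₁ * (t - s) := by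
  rcases hst.eq_or_lt with rfl | hlt
  · simp
  have ht : 0 < t := hs.trans_lt hlt
  have hC0 : 0 ≤ C₁ := (abs_nonneg _).trans (hC₁ 0)
  have hC₁' : ∀ x, |minimax (fun a b => c x a b + inner ℝ (f a b) θ)| ≤ C₁ := fun x => by
    have := hC₁ x
    rwa [hH, abs_neg] at this
  refine le_of_forall_pos_le_add fun κ' hκ' => ?_
  set κ : ℝ := κ' / (3 + C₁) with hκdef
  have hκ : 0 < κ := by positivity
  obtain ⟨h₀, hh₀, hconv⟩ := exists_abs_gameValue_sub_solution_le (R := ‖x‖) hf hc hL hβ hβ' hH hHp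
    hHx hC₁ hu ht hκ
  obtain ⟨r, hr, hcont⟩ : ∃ r > 0, ∀ s', 0 ≤ s' → |s' - s| < r → |u s' x - u s x| ≤ κ := by
    have h1 := Metric.continuousWithinAt_iff.1 (hu.continuousOn (s, x) ⟨hs, mem_univ _⟩) κ hκ
    obtain ⟨r, hr, h2⟩ := h1
    refine ⟨r, hr, fun s' hs' hd => ?_⟩
    have := h2 (x := (s', x)) ⟨hs', mem_univ _⟩ (by rwa [dist_prod_same_right, Real.dist_eq])
    rw [Real.dist_eq] at this
    exact this.le
  -- The step `t / N` makes `t` a grid time, while `s` is rounded down to the grid.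
  obtain ⟨N, hN⟩ := exists_nat_gt (t / min h₀ (min r κ))
  have hmin : 0 < min h₀ (min r κ) := lt_min hh₀ (lt_min hr hκ)
  have hN0 : (0 : ℝ) < N := lt_trans (by positivity) hN
  set h : ℝ := t / N with hh
  have hh0 : 0 < h := by positivity
  have hhmin : h < min h₀ (min r κ) := by
    rw [hh, div_lt_iff₀ hN0]
    rwa [div_lt_iff₀ hmin, mul_comm] at hN
  have hNh : N * h = t := by rw [hh]; field_simp
  set k : ℕ := ⌊s / h⌋₊ with hk
  have hk1 : k * h ≤ s := by
    rw [← le_div_iff₀ hh0]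
    exact Nat.floor_le (by positivity)
  have hk2 : s < k * h + h := by
    have := Nat.lt_floor_add_one (s / h)
    rw [div_lt_iff₀ hh0] at this
    linarith
  have hkN : k ≤ N := by
    have : (k : ℝ) * h ≤ N * h := by rw [hNh]; linarith
    exact_mod_cast le_of_mul_le_mul_right this hh0
  have e1 := hconv h hh0 (hhmin.trans_le (min_le_left _ _)) N x hNh.le le_rfl
  have e2 := hconv h hh0 (hhmin.trans_le (min_le_left _ _)) k x (by linarith) le_rfl
  have e3 := hcont (k * h) (by positivity) (by
    have : h < r := hhmin.trans_le ((min_le_right _ _).trans (min_le_left _ _))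
    rw [abs_lt]; constructor <;> linarith)
  have hhκ : h < κ := hhmin.trans_le ((min_le_right _ _).trans (min_le_right _ _))
  have e4 := abs_gameValue_sub_le (θ := θ) hf hc hh0.le hC₁' k (N - k) x
  rw [Nat.add_sub_cancel' hkN, Nat.cast_sub hkN, sub_mul, hNh] at e4
  rw [hNh] at e1
  have e5 : C₁ * (t - k * h) ≤ C₁ * (t - s) + C₁ * κ := by
    rw [← mul_add]
    gcongr
    linarith
  have e6 : 3 * κ + C₁ * κ = κ' := by
    rw [hκdef]; field_simp
  rw [abs_le] at *
  constructor <;> linarith [e1.1, e1.2, e2.1, e2.2, e3.1, e3.2, e4.1, e4.2]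

end TimeRegularity

/-! ### The effective Hamiltonian and rescaling. -/

section EffectiveHamiltonian

variable {d m : ℕ} {Ω : Type*} {A B : Set (Eucl m)}

/-- The limit, at integer times, of the discrete game values as the time step tends to zero. -/
noncomputable def gameLimit (f : A → B → Eucl d) (ℓ : Eucl d → A → B → Ω → ℝ) (θ : Eucl d)
    (t : ℕ) (x : Eucl d) (ω : Ω) : ℝ :=
  Filter.limUnder Filter.atTop fun N : ℕ =>
    gameValue f (fun x a b => ℓ x a b ω) (1 / ((N : ℝ) + 1)) θ (t * (N + 1)) x

/-- The effective Hamiltonian `θ ↦ - lim_k 𝔼[w(2 ^ k, 0)] / 2 ^ k`. -/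
noncomputable def effectiveHamiltonian [MeasurableSpace Ω] (μ : Measure Ω) (f : A → B → Eucl d)
    (ℓ : Eucl d → A → B → Ω → ℝ) (θ : Eucl d) : ℝ :=
  -Filter.limUnder Filter.atTop fun k : ℕ => (∫ ω, gameLimit f ℓ θ (2 ^ k) 0 ω ∂μ) / 2 ^ k

/-- The discrete values determine the limit, so one effective Hamiltonian serves every `ε` and every
solution. -/
theorem IsGameLimit.eq_gameLimit {f : A → B → Eucl d} {ℓ : Eucl d → A → B → Ω → ℝ} {θ : Eucl d}
    {w : ℕ → Eucl d → Ω → ℝ} (hw : IsGameLimit f ℓ θ w) (t : ℕ) (x : Eucl d) (ω : Ω) :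
    gameLimit f ℓ θ t x ω = w t x ω :=
  (hw.tendsto t x ω).limUnder_eq

theorem IsGameLimit.tendsto_effectiveHamiltonian [MeasurableSpace Ω] {μ : Measure Ω}
    [IsProbabilityMeasure μ]
    {f : A → B → Eucl d} {ℓ : Eucl d → A → B → Ω → ℝ} {θ : Eucl d} {w : ℕ → Eucl d → Ω → ℝ}
    {L F c₀ C₁ : ℝ} (hw : IsGameLimit f ℓ θ w)
    (hc : IsConcentratedValue μ θ w (fun t => ∫ ω, w t 0 ω ∂μ) L F c₀ C₁) (hL : 0 ≤ L)
    (hc₀ : 0 < c₀) :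
    Filter.Tendsto (fun k : ℕ => (∫ ω, w (2 ^ k) 0 ω ∂μ) / 2 ^ k) Filter.atTop
      (nhds (-effectiveHamiltonian μ f ℓ θ)) := by
  obtain ⟨γ, hγ, -⟩ := hc.exists_rate hL hc₀
  have : effectiveHamiltonian μ f ℓ θ = -γ := by
    unfold effectiveHamiltonian
    simp_rw [hw.eq_gameLimit]
    rw [hγ.limUnder_eq]
  rw [this, neg_neg]
  exact hγ

theorem IsRegularCost.rescale {A B : Type*} {c : Eucl d → A → B → ℝ} {L ε : ℝ}
    (hc : IsRegularCost c L) (hε : 0 < ε) : IsRegularCost (fun x => c (ε⁻¹ • x)) (L * ε⁻¹) := by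
  refine ⟨hc.bounded.imp fun C hC x => hC _, fun x y a b => ?_⟩
  have := hc.lipschitz (ε⁻¹ • x) (ε⁻¹ • y) a b
  rwa [← smul_sub, norm_smul, Real.norm_of_nonneg (by positivity), ← mul_assoc] at this

/-- Solutions of the oscillating Cauchy problem, rescaled to the unit scale, are limits of the
discrete game values. -/
theorem isGameLimit_of_isCauchySolution [Nonempty A] [Nonempty B] {f : A → B → Eucl d}
    {ℓ : Eucl d → A → B → Ω → ℝ} {F L β ε : ℝ} {θ : Eucl d} {u : ℝ → Eucl d → Ω → ℝ}
    (hf : ∀ a b, ‖f a b‖ ≤ F) (hℓ : ∀ ω, IsRegularCost (fun x a b => ℓ x a b ω) L) (hL : 0 < L)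
    (hβ : 0 < β) [MeasurableSpace Ω] (hH : IsClassH (gameHamiltonian f ℓ) β) (hε : 0 < ε)
    (hu : ∀ ω, IsCauchySolution (fun x p => gameHamiltonian f ℓ (ε⁻¹ • x) p ω)
      (fun x => inner ℝ θ x) (fun t x => u t x ω)) :
    IsGameLimit f ℓ θ (fun t x ω => ε⁻¹ * u (ε * t) (ε • x) ω) ∧
      ∀ ω s t x, 0 ≤ s → s ≤ t → |u t x ω - u s x ω| ≤ β * (1 + ‖θ‖) * (t - s) := by
  have hHeq : ∀ ω x p, gameHamiltonian f ℓ (ε⁻¹ • x) p ω =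
      -minimax fun a b => ℓ (ε⁻¹ • x) a b ω + inner ℝ (f a b) p := fun ω x p =>
    gameHamiltonian_eq f ℓ _ p ω
  have hHx : ∀ ω x y p, |gameHamiltonian f ℓ (ε⁻¹ • x) p ω - gameHamiltonian f ℓ (ε⁻¹ • y) p ω| ≤
      β * ε⁻¹ * ‖x - y‖ := fun ω x y p => by
    have := hH.lipschitz_x (ε⁻¹ • x) (ε⁻¹ • y) p ω
    rwa [← smul_sub, norm_smul, Real.norm_of_nonneg (by positivity), ← mul_assoc] at this
  refine ⟨fun ω t R κ hκ => ?_, fun ω s t x hs hst => ?_⟩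
  -- The `+ 1` keeps the horizon positive when `t = 0`.
  · obtain ⟨h₀, hh₀, hconv⟩ := exists_abs_gameValue_sub_solution_le (R := ε * R) (T := ε * t + 1)
      (κ := ε * κ) hf ((hℓ ω).rescale hε) (by positivity) hβ (β' := β * ε⁻¹) (by positivity)
      (hHeq ω) (fun x p q => hH.lipschitz_p _ p q ω) (hHx ω) (fun x => hH.growth _ θ ω) (hu ω)
      (by positivity) (by positivity)
    obtain ⟨N₀, hN₀⟩ := exists_nat_gt (ε / h₀)
    refine ⟨N₀, fun N hN x hx => ?_⟩
    have hN' : ε / h₀ < N + 1 := by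
      have : (N₀ : ℝ) ≤ N := by exact_mod_cast hN
      linarith
    have hlt : ε * (1 / ((N : ℝ) + 1)) < h₀ := by
      rw [mul_one_div, div_lt_iff₀ (by positivity)]
      rwa [div_lt_iff₀ hh₀, mul_comm] at hN'
    have e1 : ((t * (N + 1) : ℕ) : ℝ) * (ε * (1 / ((N : ℝ) + 1))) = ε * t := by
      rw [mul_left_comm, cast_steps_mul]
    have h1 := hconv (ε * (1 / ((N : ℝ) + 1))) (by positivity) hlt (t * (N + 1)) (ε • x)
      (by rw [e1]; linarith)
      (by rw [norm_smul, Real.norm_of_nonneg hε.le]; exact mul_le_mul_of_nonneg_left hx hε.le)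
    rw [gameValue_scale (c := fun x a b => ℓ x a b ω) hε, e1, smul_smul, inv_mul_cancel₀ hε.ne',
      one_smul] at h1
    have e2 : ∀ g v : ℝ, g - ε⁻¹ * v = ε⁻¹ * (ε * g - v) := fun g v => by field_simp
    rw [e2, abs_mul, abs_of_pos (by positivity), inv_mul_le_iff₀ hε]
    exact h1
  · exact abs_solution_sub_le hf ((hℓ ω).rescale hε) (by positivity) hβ (β' := β * ε⁻¹)
      (by positivity) (hHeq ω) (fun x p q => hH.lipschitz_p _ p q ω) (hHx ω)
      (fun x => hH.growth _ θ ω) (hu ω) hs hst x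

/-- For `ε ≤ 1 / 2` one has `-log ε ≥ 1 / 2`, so the `log c` in the bound for `log n` is absorbed in
a multiple of `-log ε`. -/
theorem mul_rateFn_le {ε c : ℝ} (hε : 0 < ε) (hε2 : ε ≤ 1 / 2) (hc : 1 ≤ c) {n : ℕ} (hn : 1 ≤ n)
    (hnc : n ≤ c / ε) :
    ε * rateFn n ≤ Real.sqrt (c * (1 + 2 * Real.log c)) * Real.sqrt (-(ε * Real.log ε)) := by
  have hn1 : (1 : ℝ) ≤ n := by exact_mod_cast hn
  have hlogc := Real.log_nonneg hc
  have hlogε : 1 / 2 ≤ -Real.log ε := by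
    have h1 := Real.log_le_log hε hε2
    rw [one_div, Real.log_inv] at h1
    linarith [Real.log_two_gt_d9]
  have hlogn : Real.log n ≤ (1 + 2 * Real.log c) * -Real.log ε := by
    have h1 := Real.log_le_log (by linarith) hnc
    rw [Real.log_div (by linarith) hε.ne'] at h1
    nlinarith
  rw [← Real.sqrt_mul (by positivity), rateFn]
  conv_lhs => rw [← Real.sqrt_sq hε.le, ← Real.sqrt_mul (sq_nonneg ε)]
  apply Real.sqrt_le_sqrt
  calc ε ^ 2 * (n * Real.log n)
      ≤ ε ^ 2 * (c / ε * ((1 + 2 * Real.log c) * -Real.log ε)) := by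
        have := Real.log_nonneg hn1
        gcongr
    _ = c * (1 + 2 * Real.log c) * -(ε * Real.log ε) := by field_simp

end EffectiveHamiltonian

/-! ### The quantitative homogenization theorem. -/

theorem mainTheorem2 (d : ℕ) :
    -- `K` takes `R`, `T`, `|θ|`, `β`, `ρ`, `δ`, `Lip(ℓ)` and a bound for `|f|`
    ∃ K : (R T absθ β ρ δ L F : ℝ) → ℝ,
      ∀ (Ω : Type*) [MeasurableSpace Ω] (μ : Measure Ω) [IsProbabilityMeasure μ]
        [AddAction (Eucl d) Ω] [MeasurableVAdd₂ (Eucl d) Ω] [ErgodicVAdd (Eucl d) Ω μ]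
        (m : ℕ) (A B : Set (Eucl m)) (f : A → B → Eucl d) (ℓ : Eucl d → A → B → Ω → ℝ)
        (β ρ δ L F : ℝ),
        IsCompact A → A.Nonempty → IsCompact B → B.Nonempty →
        0 < β → 0 < ρ → 0 < δ → 0 < L →
        (∀ a b, ‖f a b‖ ≤ F) →
        IsOrientedDynamics f δ →
        IsStationaryCost ℓ L →
        HasFiniteRange μ (fun (i : A × B) x ω => ℓ x i.1 i.2 ω) ρ →
        IsClassH (gameHamiltonian f ℓ) β →
        ∃ Hbar : Eucl d → ℝ,
          ∀ (θ : Eucl d) (T R : ℝ), 0 < T → 0 < R →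
          ∀ ε : ℝ, 0 < ε → ε ≤ 1 / 2 →
          ∀ u : ℝ → Eucl d → Ω → ℝ,
            (∀ ω, IsCauchySolution (fun x p => gameHamiltonian f ℓ (ε⁻¹ • x) p ω)
              (fun x => inner ℝ θ x) (fun t x => u t x ω)) →
            μ {ω | K R T ‖θ‖ β ρ δ L F * Real.sqrt (-(ε * Real.log ε)) ≤
                sSup ((fun q : ℝ × Eucl d => |u q.1 q.2 ω - inner ℝ θ q.2 + q.1 * Hbar θ|) ''
                  (Icc 0 T ×ˢ Metric.ball 0 R))}
              ≤ ENNReal.ofReal (ε ^ 2) := by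
  -- The term `2 * (β * (1 + Θ))` pays for rounding times to multiples of `ε`; the final `+ 1` makes
  -- the bound on the good event strict, since the bad event is defined by `≤`.
  refine ⟨fun R T Θ β ρ δ L F =>
    (rateConst d Θ L (varianceConst F ρ L δ) F (β * (1 + Θ)) + 2 * (β * (1 + Θ))) *
      Real.sqrt ((T + R + 3) * (1 + 2 * Real.log (T + R + 3))) + 1, ?_⟩
  intro Ω _ μ _ _ _ _ m A B f ℓ β ρ δ L F hA hA' hB hB' hβ hρ hδ hL hf hfo hℓ hrange hH
  refine ⟨effectiveHamiltonian μ f ℓ, fun θ T R hT hR ε hε hε2 u hu => ?_⟩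
  have := hA'.to_subtype
  have := hB'.to_subtype
  have hF0 : 0 ≤ F := by
    obtain ⟨a⟩ := ‹Nonempty A›
    obtain ⟨b⟩ := ‹Nonempty B›
    exact (norm_nonneg _).trans (hf a b)
  have hc₀ : 0 < varianceConst F ρ L δ := by unfold varianceConst; positivity
  set C₁ : ℝ := β * (1 + ‖θ‖) with hC₁
  have hC₁0 : 0 ≤ C₁ := by positivity
  obtain ⟨hlim, htime⟩ := isGameLimit_of_isCauchySolution hf hℓ.isRegularCost hL hβ hH hε hu
  have hcv := hlim.isConcentratedValue (μ := μ) (C₁ := C₁) hA hA' hB hB' hf hδ hfo hL hρ hℓ hrange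
    fun ω x => by
      have := hH.growth x θ ω
      rwa [gameHamiltonian_eq, abs_neg] at this
  set γ : ℝ := -effectiveHamiltonian μ f ℓ θ with hγ
  have hγt := hlim.tendsto_effectiveHamiltonian hcv hL.le hc₀
  -- At the unit scale the cylinder lies within times and radii at most `n`, and `1 / ε ≤ n` turns
  -- the probability `n⁻²` into `ε²`.
  set n : ℕ := ⌈(T + R + 1) / ε⌉₊ + 2 with hn
  have hnge : (T + R + 1) / ε ≤ n := by
    rw [hn]; push_cast
    linarith [Nat.le_ceil ((T + R + 1) / ε)]
  have hnle : (n : ℝ) ≤ (T + R + 3) / ε := by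
    have h1 := (Nat.ceil_lt_add_one (a := (T + R + 1) / ε) (by positivity)).le
    have h2 : (3 : ℝ) ≤ 2 / ε := by rw [le_div_iff₀ hε]; linarith
    have h3 : (T + R + 3) / ε = (T + R + 1) / ε + 2 / ε := by ring
    rw [hn]; push_cast
    linarith
  have hn4 : 4 ≤ n := by
    have h1 : ((2 : ℕ) : ℝ) ≤ (T + R + 1) / ε := by
      rw [le_div_iff₀ hε]; push_cast; linarith
    have h2 : 2 ≤ ⌈(T + R + 1) / ε⌉₊ := by
      exact_mod_cast h1.trans (Nat.le_ceil _)
    omega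
  obtain ⟨hγC, hmeas⟩ := hcv.measure_exists_rate_le hL.le hc₀ hγt hn4
  have hε1 : 1 / ε ≤ n := le_trans (by gcongr; linarith) hnge
  refine le_trans (measure_mono ?_) (hmeas.trans (ENNReal.ofReal_le_ofReal ?_))
  · intro ω hω
    by_contra hgood
    simp only [mem_ofPred_eq, not_exists, not_and, not_lt] at hgood hω
    have hsq : 0 < Real.sqrt (-(ε * Real.log ε)) := by
      rw [Real.sqrt_pos, neg_pos]
      exact mul_neg_of_pos_of_neg hε (Real.log_neg hε (by linarith))
    have hrc : 0 ≤ rateConst d ‖θ‖ L (varianceConst F ρ L δ) F C₁ := by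
      have := ballConst_nonneg (d := d) (c₀ := varianceConst F ρ L δ) (norm_nonneg θ) hL.le
      unfold rateConst additivityConst
      positivity
    have hrate := mul_rateFn_le hε hε2 (by linarith : 1 ≤ T + R + 3) (by omega : 1 ≤ n) hnle
    have hbound : sSup ((fun q : ℝ × Eucl d =>
        |u q.1 q.2 ω - inner ℝ θ q.2 + q.1 * effectiveHamiltonian μ f ℓ θ|) ''
        (Icc 0 T ×ˢ Metric.ball 0 R)) ≤
        (rateConst d ‖θ‖ L (varianceConst F ρ L δ) F C₁ + 2 * C₁) * (ε * rateFn n) := by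
      refine Real.sSup_le ?_ (by have := rateFn_nonneg n; positivity)
      rintro _ ⟨⟨t, x⟩, ⟨⟨ht0, htT⟩, hx⟩, rfl⟩
      simp only at ht0 htT hx ⊢
      rw [mem_ball_zero_iff] at hx
      -- Only multiples of `ε` are controlled; rounding `t` down costs at most `C₁ * ε` for the
      -- solution and as much for the linear profile.
      set j : ℕ := ⌊t / ε⌋₊ with hj
      have hj1 : ε * j ≤ t := by
        rw [mul_comm, ← le_div_iff₀ hε]
        exact Nat.floor_le (by positivity)
      have hj2 : t ≤ ε * j + ε := by
        have := (Nat.lt_floor_add_one (t / ε)).le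
        rw [div_le_iff₀ hε] at this
        linarith
      have hjn : j ≤ n := by
        have h1 : (j : ℝ) ≤ n := by
          refine (Nat.floor_le (by positivity)).trans (le_trans ?_ hnge)
          gcongr
          linarith
        exact_mod_cast h1
      have hy : ‖ε⁻¹ • x‖ ≤ n := by
        rw [norm_smul, Real.norm_of_nonneg (by positivity)]
        refine le_trans ?_ hnge
        rw [inv_mul_eq_div]
        gcongr
        linarith
      have e1 := hgood j hjn (ε⁻¹ • x) hy
      rw [smul_smul, mul_inv_cancel₀ hε.ne', one_smul, inner_smul_right] at e1
      have e2 := htime ω (ε * j) t x (by positivity) hj1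
      have e3 : |u (ε * j) x ω - inner ℝ θ x - ε * j * γ| ≤
          ε * (rateConst d ‖θ‖ L (varianceConst F ρ L δ) F C₁ * rateFn n) := by
        have h1 : u (ε * j) x ω - inner ℝ θ x - ε * j * γ =
            ε * (ε⁻¹ * u (ε * j) x ω - ε⁻¹ * inner ℝ θ x - j * γ) := by field_simp
        rw [h1, abs_mul, abs_of_pos hε]
        exact mul_le_mul_of_nonneg_left e1 hε.le
      have e4 : |(t - ε * j) * γ| ≤ C₁ * ε := by
        rw [abs_mul, abs_of_nonneg (by linarith), mul_comm]
        exact mul_le_mul hγC (by linarith) (by linarith) hC₁0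
      have e5 : C₁ * (t - ε * j) ≤ C₁ * ε := mul_le_mul_of_nonneg_left (by linarith) hC₁0
      have e6 : u t x ω - inner ℝ θ x + t * effectiveHamiltonian μ f ℓ θ =
          (u t x ω - u (ε * j) x ω) + (u (ε * j) x ω - inner ℝ θ x - ε * j * γ) -
            (t - ε * j) * γ := by
        rw [hγ]; ring
      have e7 := abs_sub ((u t x ω - u (ε * j) x ω) + (u (ε * j) x ω - inner ℝ θ x - ε * j * γ))
        ((t - ε * j) * γ)
      have e8 := abs_add_le (u t x ω - u (ε * j) x ω) (u (ε * j) x ω - inner ℝ θ x - ε * j * γ)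
      have e9 : 2 * C₁ * ε ≤ 2 * C₁ * (ε * rateFn n) := by
        gcongr
        exact le_mul_of_one_le_right hε.le (one_le_rateFn (by omega))
      rw [e6]
      linarith
    have h1 := mul_le_mul_of_nonneg_left hrate
      (by positivity : 0 ≤ rateConst d ‖θ‖ L (varianceConst F ρ L δ) F C₁ + 2 * C₁)
    rw [add_mul, one_mul, mul_assoc] at hω
    linarith
  · rw [inv_le_comm₀ (by positivity) (by positivity), ← inv_pow, inv_eq_one_div]
    gcongr
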